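/- Let $K$ be a compact connected Lie group of dimension $n$ with Lie algebra $\mathfrak K$, let $(\cdot,\cdot)$ be an $\mathrm{Ad}_K$-invariant inner product on $\mathfrak K$, and let $\{X_j\}_{j=1}^n$ be an orthonormal basis of $\mathfrak K$, regarded also as left-invariant vector fields on $K$, with dual left-invariant $1$-forms $w^j$. Identify $T^*K\cong K\times\mathfrak K$ (by left-invariant forms and the inner product), with coordinates $y^j$ on $\mathfrak K$ relative to $\{X_j\}$, and put $$\theta=\sum_{j}y^jw^j,\qquad \omega=-\mathrm d\theta,\qquad \epsilon=\tfrac1{n!}\,\omega^n,\qquad b=(2i)^n(-1)^{n(n-1)/2}.$$ Let $K_{\mathbb C}\supset K$ be the complexification of $K$, that is, the connected complex Lie group with Lie algebra $\mathfrak K\oplus i\mathfrak K$ to which every smooth homomorphism of $K$ into a complex Lie group extends uniquely as a holomorphic homomorphism. For $s>0$ let $\psi_s:T^*K\to K_{\mathbb C}$, $\psi_s(x,Y)=xe^{isY}$, and let $J_s$ be the complex structure on $T^*K$ induced by the diffeomorphism $\psi_s$. Let $\tilde X_j$ be the vector field on $T^*K$ with $\psi_{s*}\tilde X_j=X_{j,\mathbb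 C}$, where $X_{j,\mathbb C}$ is the left-invariant vector field on $K_{\mathbb C}$ extending $X_j$; let $\tilde w^j$ be the $1$-forms on $T^*K$ with $\tilde w^j(\tilde X_k)=\delta^j_k$ and $\tilde w^j(J_s\tilde X_k)=0$; and put $$\tilde\eta^j_s=\tilde w^j-i\,J_s\tilde w^j,\qquad (J_s w)(v)=w(J_sv),\qquad \Omega_s=\tilde\eta^1_s\wedge\cdots\wedge\tilde\eta^n_s .$$ For an $n$-form $\alpha$ of type $(n,0)$ with respect to $J_s$, let $|\alpha|\ge 0$ be the function with $\bar\alpha\wedge\alpha=|\alpha|^2\,b\,\epsilon$. Let $\mathfrak t\subset\mathfrak K$ be a Cartan subalgebra, let $R\subset\mathfrak t^*$ be the set of real roots (the nonzero real linear forms $\alpha$ on $\mathfrak t$ for which some nonzero $v\in\mathfrak K\otimes\mathbb C$ satisfies $[H,v]=i\alpha(H)v$ for all $H\in\mathfrak t$), let $R^+\subset R$ be a set of positive roots, and let $\eta:\mathfrak K\to\mathbb R$ be the $\mathrm{Ad}_K$-invariant function with $$\eta(Y)=\prod_{\alpha\in R^+}\frac{\sinh\alpha(Y)}{\alpha(Y)}\qquad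 (Y\in\mathfrak t),$$ where a factor with $\alpha(Y)=0$ is read as $1$. Then for all $s,s'>0$, at every point $(x,Y)$ of $T^*K$, $$\bar\Omega_s\wedge\Omega_{s'}=\Big(\frac{s+s'}2\Big)^{n}\,\eta^2\Big(\frac{s+s'}2\,Y\Big)\,b\,\epsilon=\Big|\Omega_{\frac{s+s'}2}\Big|^2\,b\,\epsilon .$$ -/

import Mathlib

open scoped Manifold ContDiff TensorProduct

noncomputable section

namespace CotangentLieGroup

/-! ### Differential forms at a point: complex-valued alternating maps on a real vector space -/

section Wedge

variable {V : Type*} [AddCommGroup V] [Module ℝ V]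

/-- The exterior product of complex-valued forms,
`(a ∧ b)(u₁, …, u_{k+l}) = ∑_{shuffles σ} sign σ a(u_{σ 1}, …) b(u_{σ (k+1)}, …)`. -/
def wedge {k l : ℕ} (a : V [⋀^Fin k]→ₗ[ℝ] ℂ) (b : V [⋀^Fin l]→ₗ[ℝ] ℂ) :
    V [⋀^Fin (k + l)]→ₗ[ℝ] ℂ :=
  ((LinearMap.mul' ℝ ℂ).compAlternatingMap (a.domCoprod b)).domDomCongr finSumFinEquiv

/-- The exterior powers `a ∧ ⋯ ∧ a` (`m` factors) of a `2`-form. -/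
def wedgePow (a : V [⋀^Fin 2]→ₗ[ℝ] ℂ) : (m : ℕ) → V [⋀^Fin (2 * m)]→ₗ[ℝ] ℂ
  | 0 => AlternatingMap.constOfIsEmpty ℝ V (Fin 0) (1 : ℂ)
  | m + 1 => wedge (wedgePow a m) a

/-- The exterior product `η 0 ∧ ⋯ ∧ η (n - 1)` of `1`-forms: it maps `(v_j)` to `det (η i v_j)`. -/
def wedgeOneForms {n : ℕ} (η : Fin n → V →ₗ[ℝ] ℂ) : V [⋀^Fin n]→ₗ[ℝ] ℂ :=
  AlternatingMap.compLinearMap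
    { (Matrix.detRowAlternating (n := Fin n) (R := ℂ)).toMultilinearMap.restrictScalars ℝ with
      map_eq_zero_of_eq' := fun v _ _ h hij =>
        (Matrix.detRowAlternating (n := Fin n) (R := ℂ)).map_eq_zero_of_eq v h hij }
    (LinearMap.pi η)

/-- Complex conjugation of complex-valued forms. -/
def conjForm {k : ℕ} (a : V [⋀^Fin k]→ₗ[ℝ] ℂ) : V [⋀^Fin k]→ₗ[ℝ] ℂ :=
  Complex.conjAe.toLinearMap.compAlternatingMap a

end Wedge

/-! ### The exterior derivative on a manifold -/

section ExteriorDerivative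

variable {F : Type*} [NormedAddCommGroup F] [NormedSpace ℝ F]
  {H : Type*} [TopologicalSpace H] (I : ModelWithCorners ℝ F H)
  {M : Type*} [TopologicalSpace M] [ChartedSpace H M]

/-- The exterior derivative of a `k`-form on a boundaryless manifold at the point `p`:
push the form forward by the preferred chart at `p`, differentiate, and pull the result back. -/
def mextDeriv {k : ℕ} (α : (p : M) → (TangentSpace I p) [⋀^Fin k]→L[ℝ] ℝ) (p : M) :
    (TangentSpace I p) [⋀^Fin (k + 1)]→L[ℝ] ℝ :=
  ContinuousAlternatingMap.compContinuousLinearMap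
    (extDeriv (𝕜 := ℝ) (E := F)
      (fun z => (α ((extChartAt I p).symm z)).compContinuousLinearMap
        (mfderiv 𝓘(ℝ, F) I (extChartAt I p).symm z))
      (extChartAt I p p))
    (mfderiv I 𝓘(ℝ, F) (extChartAt I p) p)

end ExteriorDerivative

/-! ### The adjoint action, the exponential map -/

section LieGroups

variable {E : Type*} [NormedAddCommGroup E] [NormedSpace ℝ E]
  {K : Type*} [TopologicalSpace K] [ChartedSpace E K] [Group K]

instance instLieGroupMinSmoothness [LieGroup 𝓘(ℝ, E) ∞ K] :
    LieGroup 𝓘(ℝ, E) (minSmoothness ℝ 3) K :=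
  LieGroup.of_le (n := ∞) (by
    rw [minSmoothness_of_isRCLikeNormedField]
    exact ENat.LEInfty.out)

/-- The adjoint action of `K` on its Lie algebra: `Ad k` is the derivative at `1` of
`x ↦ k x k⁻¹`. -/
def Ad (k : K) : GroupLieAlgebra 𝓘(ℝ, E) K →L[ℝ] GroupLieAlgebra 𝓘(ℝ, E) K :=
  (mfderiv 𝓘(ℝ, E) 𝓘(ℝ, E) (fun x : K => k * x * k⁻¹) 1 : E →L[ℝ] E)

/-- The exponential map of a (finite-dimensional real) Lie group: `exp X = γ 1`, where `γ` is the
integral curve through `1` of the left-invariant vector field with value `X` at `1`. -/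
def lieExp (X : GroupLieAlgebra 𝓘(ℝ, E) K) : K :=
  Classical.epsilon (fun γ : ℝ → K =>
    IsMIntegralCurve (I := 𝓘(ℝ, E)) γ (mulInvariantVectorField X) ∧ γ 0 = 1) 1

end LieGroups

/-! ### The complexification of a compact Lie group -/

section Complexification

variable {E : Type*} [NormedAddCommGroup E] [NormedSpace ℝ E]
  {K : Type*} [TopologicalSpace K] [ChartedSpace E K] [Group K]
  {EG : Type*} [NormedAddCommGroup EG] [NormedSpace ℂ EG]
  {G : Type*} [TopologicalSpace G] [ChartedSpace EG G] [Group G]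

/-- The complex structure on the tangent spaces of a complex manifold: multiplication by `i`. -/
def mulI (g : G) : TangentSpace 𝓘(ℝ, EG) g →L[ℝ] TangentSpace 𝓘(ℝ, EG) g :=
  (((Complex.I • ContinuousLinearMap.id ℂ EG : EG →L[ℂ] EG)).restrictScalars ℝ : EG →L[ℝ] EG)

/-- The homomorphism of Lie algebras induced by a smooth homomorphism of Lie groups. -/
def lieMap (ι : K →* G) : GroupLieAlgebra 𝓘(ℝ, E) K →L[ℝ] GroupLieAlgebra 𝓘(ℝ, EG) G :=
  (mfderiv 𝓘(ℝ, E) 𝓘(ℝ, EG) ι 1 : E →L[ℝ] EG)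

variable (E EG) in
/-- `ι : K → G` exhibits the complex Lie group `G` as the complexification `K_ℂ` of the compact
connected Lie group `K`: `G` is connected, `ι` is a smooth embedding of `K` as a (necessarily
closed) subgroup, `Lie G = Lie K ⊕ i Lie K`, and every smooth homomorphism of `K` into a complex Lie
group `L` extends uniquely to a holomorphic homomorphism of `G` into `L`. -/
structure IsComplexification (ι : K →* G) : Prop where
  connected : ConnectedSpace G
  smooth : ContMDiff 𝓘(ℝ, E) 𝓘(ℝ, EG) ∞ ι
  injective : Function.Injective ι
  lie_eq : ∀ Z : GroupLieAlgebra 𝓘(ℝ, EG) G,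
    ∃! A : GroupLieAlgebra 𝓘(ℝ, E) K × GroupLieAlgebra 𝓘(ℝ, E) K,
      Z = lieMap (E := E) (EG := EG) ι A.1 +
        mulI (EG := EG) (1 : G) (lieMap (E := E) (EG := EG) ι A.2)
  universal : ∀ (m : ℕ) (L : Type) [TopologicalSpace L] [T2Space L] [Group L]
    [ChartedSpace (EuclideanSpace ℂ (Fin m)) L] [LieGroup 𝓘(ℂ, EuclideanSpace ℂ (Fin m)) ∞ L]
    (φ : K →* L), ContMDiff 𝓘(ℝ, E) 𝓘(ℝ, EuclideanSpace ℂ (Fin m)) ∞ φ →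
    ∃! Φ : G →* L, ContMDiff 𝓘(ℂ, EG) 𝓘(ℂ, EuclideanSpace ℂ (Fin m)) ∞ Φ ∧
      ∀ x : K, Φ (ι x) = φ x

/-! ### The Kähler polarizations of `T^*K = K × Lie K`

The Lie algebra `GroupLieAlgebra 𝓘(ℝ, E) K` is, as a vector space, the model space `E`, so that
`T^*K = K × Lie K` is the manifold `K × E`, with tangent spaces `E × E`. -/

/-- The diffeomorphism `ψ_s : T^*K → K_ℂ`, `ψ_s (x, Y) = x exp (i s Y)`. -/
def psi (ι : K →* G) (s : ℝ) (p : K × E) : G :=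
  ι p.1 * lieExp (E := EG) (K := G)
    (mulI (EG := EG) (1 : G) (lieMap (E := E) (EG := EG) ι (s • p.2 : E)))

/-- The derivative of `ψ_s`. -/
def dpsi (ι : K →* G) (s : ℝ) (p : K × E) :
    TangentSpace (𝓘(ℝ, E).prod 𝓘(ℝ, E)) p →L[ℝ] TangentSpace 𝓘(ℝ, EG) (psi (EG := EG) ι s p) :=
  mfderiv (𝓘(ℝ, E).prod 𝓘(ℝ, E)) 𝓘(ℝ, EG) (psi (EG := EG) ι s) p

variable (EG) in
/-- The complex structure `J_s` on `T^*K` induced by `ψ_s`. -/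
def J (ι : K →* G) (s : ℝ) (p : K × E) :
    TangentSpace (𝓘(ℝ, E).prod 𝓘(ℝ, E)) p →L[ℝ] TangentSpace (𝓘(ℝ, E).prod 𝓘(ℝ, E)) p :=
  (dpsi (EG := EG) ι s p).inverse ∘L mulI (psi (EG := EG) ι s p) ∘L dpsi (EG := EG) ι s p

variable (EG) in
/-- The vector field `X̃` on `T^*K` with `ψ_{s*} X̃ = X_ℂ`, where `X_ℂ` is the left-invariant vector
field on `K_ℂ` extending the left-invariant vector field `X` on `K`. -/
def tildeX (ι : K →* G) (s : ℝ) (X : GroupLieAlgebra 𝓘(ℝ, E) K) (p : K × E) :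
    TangentSpace (𝓘(ℝ, E).prod 𝓘(ℝ, E)) p :=
  (dpsi (EG := EG) ι s p).inverse
    (mulInvariantVectorField (I := 𝓘(ℝ, EG)) (lieMap (E := E) (EG := EG) ι X)
      (psi (EG := EG) ι s p))

variable (EG) in
/-- The (unique) `1`-forms `w̃^j` with `w̃^j (X̃_k) = δ^j_k` and `w̃^j (J_s X̃_k) = 0`. -/
def tildeW (ι : K →* G) {n : ℕ} (X : Module.Basis (Fin n) ℝ (GroupLieAlgebra 𝓘(ℝ, E) K)) (s : ℝ)
    (j : Fin n) (p : K × E) : TangentSpace (𝓘(ℝ, E).prod 𝓘(ℝ, E)) p →ₗ[ℝ] ℝ :=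
  Classical.epsilon fun w => ∀ k : Fin n,
    w (tildeX EG ι s (X k) p) = (if j = k then 1 else 0) ∧
    w (J EG ι s p (tildeX EG ι s (X k) p)) = 0

variable (EG) in
/-- The `J_s`-holomorphic `1`-forms `η̃^j_s = w̃^j - i J_s w̃^j`, where `(J_s w) v = w (J_s v)`. -/
def tildeEta (ι : K →* G) {n : ℕ} (X : Module.Basis (Fin n) ℝ (GroupLieAlgebra 𝓘(ℝ, E) K)) (s : ℝ)
    (j : Fin n) (p : K × E) : TangentSpace (𝓘(ℝ, E).prod 𝓘(ℝ, E)) p →ₗ[ℝ] ℂ :=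
  Complex.ofRealCLM.toLinearMap ∘ₗ tildeW EG ι X s j p -
    Complex.I • (Complex.ofRealCLM.toLinearMap ∘ₗ tildeW EG ι X s j p ∘ₗ (J EG ι s p).toLinearMap)

variable (EG) in
/-- The `J_s`-holomorphic `n`-form `Ω_s = η̃^1_s ∧ ⋯ ∧ η̃^n_s`. -/
def Omega (ι : K →* G) {n : ℕ} (X : Module.Basis (Fin n) ℝ (GroupLieAlgebra 𝓘(ℝ, E) K)) (s : ℝ)
    (p : K × E) : (TangentSpace (𝓘(ℝ, E).prod 𝓘(ℝ, E)) p) [⋀^Fin n]→ₗ[ℝ] ℂ :=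
  wedgeOneForms fun j => tildeEta EG ι X s j p

end Complexification

/-! ### The symplectic form and the Liouville form of `T^*K` -/

section Symplectic

variable {E : Type*} [NormedAddCommGroup E] [NormedSpace ℝ E]
  {K : Type*} [TopologicalSpace K] [ChartedSpace E K] [Group K]

/-- The left-invariant `1`-form `w^i` on `K`, dual to the left-invariant vector fields `X_j`. -/
def leftForm [FiniteDimensional ℝ E] {n : ℕ}
    (X : Module.Basis (Fin n) ℝ (GroupLieAlgebra 𝓘(ℝ, E) K)) (i : Fin n) (x : K) :
    TangentSpace 𝓘(ℝ, E) x →L[ℝ] ℝ :=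
  (LinearMap.toContinuousLinearMap (E := E) (X.coord i) : E →L[ℝ] ℝ) ∘L
    (mfderiv 𝓘(ℝ, E) 𝓘(ℝ, E) (fun y : K => x⁻¹ * y) x : E →L[ℝ] E)

/-- The canonical `1`-form `θ = ∑ i, y^i w^i` on `T^*K`. -/
def theta [FiniteDimensional ℝ E] {n : ℕ}
    (X : Module.Basis (Fin n) ℝ (GroupLieAlgebra 𝓘(ℝ, E) K)) (p : K × E) :
    TangentSpace (𝓘(ℝ, E).prod 𝓘(ℝ, E)) p →L[ℝ] ℝ :=
  ∑ i : Fin n, X.coord i p.2 •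
    ((leftForm X i p.1 : E →L[ℝ] ℝ) ∘L (ContinuousLinearMap.fst ℝ E E : E × E →L[ℝ] E))

/-- The canonical symplectic form `ω = -dθ` on `T^*K`. -/
def omega [FiniteDimensional ℝ E] {n : ℕ}
    (X : Module.Basis (Fin n) ℝ (GroupLieAlgebra 𝓘(ℝ, E) K)) (p : K × E) :
    (TangentSpace (𝓘(ℝ, E).prod 𝓘(ℝ, E)) p) [⋀^Fin 2]→L[ℝ] ℝ :=
  -mextDeriv (𝓘(ℝ, E).prod 𝓘(ℝ, E))
    (fun q => ContinuousAlternatingMap.ofSubsingleton ℝ _ ℝ (0 : Fin 1) (theta X q)) p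

/-- The Liouville volume form `ε = ωⁿ / n!` on `T^*K`. -/
def liouville [FiniteDimensional ℝ E] {n : ℕ}
    (X : Module.Basis (Fin n) ℝ (GroupLieAlgebra 𝓘(ℝ, E) K)) (p : K × E) :
    (TangentSpace (𝓘(ℝ, E).prod 𝓘(ℝ, E)) p) [⋀^Fin (n + n)]→ₗ[ℝ] ℂ :=
  ((n.factorial : ℂ)⁻¹ • wedgePow
    (Complex.ofRealCLM.toLinearMap.compAlternatingMap (omega X p).toAlternatingMap) n).domDomCongr
      (finCongr (two_mul n))

/-- The constant `b = (2 i)ⁿ (-1)^{n (n - 1) / 2}`. -/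
def bConst (n : ℕ) : ℂ := (2 * Complex.I) ^ n * (-1) ^ (n * (n - 1) / 2)

/-- The norm `|α|` of an `n`-form `α` on `T^*K`: at each point, the (unique) nonnegative real number
`c` with `ᾱ ∧ α = c² b ε`. -/
def formNorm [FiniteDimensional ℝ E] {n : ℕ}
    (X : Module.Basis (Fin n) ℝ (GroupLieAlgebra 𝓘(ℝ, E) K))
    (α : (p : K × E) → (TangentSpace (𝓘(ℝ, E).prod 𝓘(ℝ, E)) p) [⋀^Fin n]→ₗ[ℝ] ℂ) (p : K × E) : ℝ :=
  Classical.epsilon fun c : ℝ => 0 ≤ c ∧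
    wedge (conjForm (α p)) (α p) = ((c : ℂ) ^ 2 * bConst n) • liouville X p

end Symplectic

/-! ### Roots and the function `η` -/

section Roots

variable {E : Type*} [NormedAddCommGroup E] [NormedSpace ℝ E] [CompleteSpace E]
  {K : Type*} [TopologicalSpace K] [ChartedSpace E K] [Group K] [LieGroup 𝓘(ℝ, E) ∞ K]

/-- The (real) roots of a compact Lie algebra `𝔨` relative to a Cartan subalgebra `𝔱`: the nonzero
real linear forms `α` on `𝔱` such that `[H, v] = i α(H) v` for all `H ∈ 𝔱`, for some nonzero `v` in
the complexification of `𝔨`. -/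
def realRoots (𝔱 : LieSubalgebra ℝ (GroupLieAlgebra 𝓘(ℝ, E) K)) : Set (Module.Dual ℝ 𝔱) :=
  {α | α ≠ 0 ∧ ∃ v : ℂ ⊗[ℝ] GroupLieAlgebra 𝓘(ℝ, E) K, v ≠ 0 ∧ ∀ H : 𝔱,
    ⁅((1 : ℂ) ⊗ₜ[ℝ] (H : GroupLieAlgebra 𝓘(ℝ, E) K) : ℂ ⊗[ℝ] GroupLieAlgebra 𝓘(ℝ, E) K), v⁆ =
      (Complex.I * (α H : ℂ)) • v}

/-- `P` is a set of positive roots in the set of roots `R`. -/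
structure IsPositiveSystem {V : Type*} [AddCommGroup V] (R : Set V) (P : Finset V) : Prop where
  subset : ∀ α ∈ P, α ∈ R
  mem_or_neg_mem : ∀ α ∈ R, α ∈ P ∨ -α ∈ P
  not_both : ∀ α ∈ P, -α ∉ P
  add_mem : ∀ α ∈ P, ∀ β ∈ P, α + β ∈ R → α + β ∈ P

/-- `sinh t / t`, with value `1` at `t = 0`. -/
def sinhc (t : ℝ) : ℝ := if t = 0 then 1 else Real.sinh t / t

/-- The (unique) `Ad_K`-invariant function `η` on the Lie algebra of `K` that is given by
`η (H) = ∏_{α ∈ R⁺} sinh α(H) / α(H)` for `H` in the Cartan subalgebra `𝔱`. -/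
def eta (𝔱 : LieSubalgebra ℝ (GroupLieAlgebra 𝓘(ℝ, E) K)) (P : Finset (Module.Dual ℝ 𝔱)) :
    GroupLieAlgebra 𝓘(ℝ, E) K → ℝ :=
  Classical.epsilon fun f =>
    (∀ (k : K) (Y : GroupLieAlgebra 𝓘(ℝ, E) K), f (Ad k Y) = f Y) ∧
    ∀ H : 𝔱, f H = ∏ α ∈ P, sinhc (α H)

/-- `B` is an `Ad_K`-invariant inner product on the Lie algebra of `K`. -/
structure IsAdInvariantInner (B : LinearMap.BilinForm ℝ (GroupLieAlgebra 𝓘(ℝ, E) K)) : Prop where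
  symm : ∀ Y Z, B Y Z = B Z Y
  pos : ∀ Y, Y ≠ 0 → 0 < B Y Y
  invariant : ∀ (k : K) (Y Z), B (Ad k Y) (Ad k Z) = B Y Z

end Roots

end CotangentLieGroup

end

open CotangentLieGroup

/-! Let `M` be the matrix of `-i ad Y` in the orthonormal basis `X`, and let `E_M(t) = ∫₀ᵗ exp (u M)
du`. Invariance of the inner product makes `ad Y` skew, so `M` is skew-symmetric, purely imaginary
and Hermitian.

The derivative of `ψ_s`, translated to `Lie G` from the left, is computed from the product rule, `Ad
(exp (-W)) = exp (-ad W)` and the formula for the derivative of the exponential map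
(`hasLeftDerivAt_expE`). In the complex coordinates given by `X` it reads `exp (s M) w + i E_M(s)
dy` (`exists_dpsi_eq`). It turns `J_s` into multiplication by `i` and sends `X̃_k` to the `k`-th
unit vector, so its components are exactly the forms `η̃^j_s` (`tildeEta_apply`).

Hence `Ω̄_s ∧ Ω_{s'}` is `w¹ ∧ ⋯ ∧ wⁿ ∧ dy¹ ∧ ⋯ ∧ dyⁿ` times the determinant of the block matrix
with rows `(exp (-s M), -i E_{-M}(s))` and `(exp (s' M), i E_M(s'))`. Since `det exp (-s M) = 1` and
`exp (s M) E_{-M}(s) = E_M(s)`, the Schur complement is `i (E_M(s') + exp (s' M) E_M(s)) = i E_M(s +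
s')`. This cocycle identity is the reason why only `s + s'` matters (`det_exp_expIntegral_blocks`).

It remains to evaluate `det E_M(s + s')`. Put `τ = (s + s') / 2`. By maximality of a linear function
on an adjoint orbit, `Y` is conjugate into `𝔱` (`exists_Ad_mem`). There `2 τ M` has eigenvalues `2
r`, with `r` running through the weights at `τ Y`, and `∫₀¹ exp (2 r u) du = exp r · sinh r / r`.
The factors `exp r` multiply to `1` because the trace vanishes; zero weights contribute `1`; root
spaces are one-dimensional and roots occur in pairs `±α`, so the rest is `η²(τ Y)`
(`det_expIntegral_adMatrix`).

Finally `ω = ∑ w^j ∧ dy^j` up to terms in `w^j ∧ w^k`, which a unipotent change of coframe absorbs,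
so `ε` is `(-1)^{n(n-1)/2} w¹ ∧ ⋯ ∧ dyⁿ` (`liouville_eq`) and `b` supplies the sign and `(2i)ⁿ`. The
second equality is the first one applied to the pair `τ, τ`. -/

noncomputable section

namespace CotangentLieGroup

set_option linter.unusedSectionVars false

/-! ### Exterior products of 1-forms and powers of a 2-form -/

section Wedge

variable {V : Type*} [AddCommGroup V] [Module ℝ V]

/-- The product `v ↦ ∏ i, η i (v i)` of `1`-forms, as a multilinear map. -/
def prodForms {n : ℕ} (η : Fin n → V →ₗ[ℝ] ℂ) : MultilinearMap ℝ (fun _ : Fin n => V) ℂ :=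
  (MultilinearMap.mkPiAlgebra ℝ (Fin n) ℂ).compLinearMap η

theorem prodForms_apply {n : ℕ} (η : Fin n → V →ₗ[ℝ] ℂ) (v : Fin n → V) :
    prodForms η v = ∏ i, η i (v i) := by
  simp [prodForms]

theorem wedgeOneForms_apply {n : ℕ} (η : Fin n → V →ₗ[ℝ] ℂ) (v : Fin n → V) :
    wedgeOneForms η v = (Matrix.of fun i j => η i (v j)).det := by
  rw [← Matrix.det_transpose]
  rfl

theorem alternatization_prodForms {n : ℕ} (η : Fin n → V →ₗ[ℝ] ℂ) :
    (prodForms η).alternatization = wedgeOneForms η := by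
  ext v
  rw [MultilinearMap.alternatization_apply, wedgeOneForms_apply, ← Matrix.det_transpose,
    Matrix.det_apply]
  refine Finset.sum_congr rfl fun σ _ => ?_
  simp [prodForms_apply]

/-- Alternatization here is the signed sum without a factorial, matching the shuffle normalization
of `wedge`; exterior products of 1-forms thus reduce to plain products of functions. -/
theorem wedge_alternatization {k l : ℕ} (f : MultilinearMap ℝ (fun _ : Fin k => V) ℂ)
    (g : MultilinearMap ℝ (fun _ : Fin l => V) ℂ) :
    wedge f.alternatization g.alternatization =
      (((LinearMap.mul' ℝ ℂ).compMultilinearMap (f.domCoprod g)).domDomCongr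
        finSumFinEquiv).alternatization := by
  rw [wedge, ← MultilinearMap.domCoprod_alternization,
    ← LinearMap.compMultilinearMap_alternatization]
  ext v
  simp only [AlternatingMap.domDomCongr_apply, MultilinearMap.alternatization_apply]
  refine Fintype.sum_equiv (finSumFinEquiv.permCongr) _ _ fun σ => ?_
  rw [Equiv.Perm.sign_permCongr]
  congr 1
  simp [MultilinearMap.domDomCongr_apply, Function.comp_def]

theorem wedge_wedgeOneForms {k l : ℕ} (η : Fin k → V →ₗ[ℝ] ℂ) (ζ : Fin l → V →ₗ[ℝ] ℂ) :
    wedge (wedgeOneForms η) (wedgeOneForms ζ) = wedgeOneForms (Fin.append η ζ) := by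
  rw [← alternatization_prodForms, ← alternatization_prodForms, wedge_alternatization,
    ← alternatization_prodForms]
  congr 1
  ext v
  simp [prodForms_apply, MultilinearMap.domDomCongr_apply, MultilinearMap.domCoprod_apply,
    Fin.prod_univ_add]

theorem conjForm_wedgeOneForms {n : ℕ} (η : Fin n → V →ₗ[ℝ] ℂ) :
    conjForm (wedgeOneForms η) =
      wedgeOneForms fun i => Complex.conjAe.toLinearMap ∘ₗ η i := by
  ext v
  simp only [conjForm, LinearMap.compAlternatingMap_apply, wedgeOneForms_apply]
  exact RingHom.map_det (starRingEnd ℂ) _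

theorem wedgeOneForms_perm {n : ℕ} (η : Fin n → V →ₗ[ℝ] ℂ) (σ : Equiv.Perm (Fin n)) :
    (wedgeOneForms fun i => η (σ i)) = ((Equiv.Perm.sign σ : ℤ) : ℂ) • wedgeOneForms η := by
  ext v
  rw [AlternatingMap.smul_apply, wedgeOneForms_apply, wedgeOneForms_apply, smul_eq_mul,
    ← Matrix.det_permute]
  rfl

theorem wedgeOneForms_eq_zero {n : ℕ} (η : Fin n → V →ₗ[ℝ] ℂ) {i j : Fin n} (hij : i ≠ j)
    (h : η i = η j) : wedgeOneForms η = 0 := by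
  ext v
  rw [wedgeOneForms_apply]
  exact Matrix.det_zero_of_row_eq hij (by ext k; simp [h])

/-- Forms which are linear combinations of given forms wedge to a determinant multiple. -/
theorem wedgeOneForms_matrix {n : ℕ} (M : Matrix (Fin n) (Fin n) ℂ) (η ζ : Fin n → V →ₗ[ℝ] ℂ)
    (h : ∀ i v, ζ i v = ∑ j, M i j * η j v) :
    wedgeOneForms ζ = M.det • wedgeOneForms η := by
  ext v
  rw [AlternatingMap.smul_apply, wedgeOneForms_apply, wedgeOneForms_apply, smul_eq_mul,
    ← Matrix.det_mul]
  congr 1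
  ext i j
  simp [Matrix.mul_apply, h]

theorem wedge_add_left {k l : ℕ} (a a' : V [⋀^Fin k]→ₗ[ℝ] ℂ) (b : V [⋀^Fin l]→ₗ[ℝ] ℂ) :
    wedge (a + a') b = wedge a b + wedge a' b := by
  have : (a + a').domCoprod b = a.domCoprod b + a'.domCoprod b := by
    simp only [← AlternatingMap.domCoprod'_apply, TensorProduct.add_tmul, map_add]
  ext v
  simp [wedge, this]

theorem wedge_add_right {k l : ℕ} (a : V [⋀^Fin k]→ₗ[ℝ] ℂ) (b b' : V [⋀^Fin l]→ₗ[ℝ] ℂ) :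
    wedge a (b + b') = wedge a b + wedge a b' := by
  have : a.domCoprod (b + b') = a.domCoprod b + a.domCoprod b' := by
    simp only [← AlternatingMap.domCoprod'_apply, TensorProduct.tmul_add, map_add]
  ext v
  simp [wedge, this]

/-- The wedge product as a biadditive map. -/
def wedgeAddHom (k l : ℕ) :
    (V [⋀^Fin k]→ₗ[ℝ] ℂ) →+ (V [⋀^Fin l]→ₗ[ℝ] ℂ) →+ (V [⋀^Fin (k + l)]→ₗ[ℝ] ℂ) :=
  AddMonoidHom.mk' (fun a => AddMonoidHom.mk' (wedge a) (wedge_add_right a))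
    fun a a' => by ext1 b; exact wedge_add_left a a' b

theorem wedge_sum_sum {ι κ : Type*} (s : Finset ι) (t : Finset κ) {k l : ℕ}
    (a : ι → V [⋀^Fin k]→ₗ[ℝ] ℂ) (b : κ → V [⋀^Fin l]→ₗ[ℝ] ℂ) :
    wedge (∑ i ∈ s, a i) (∑ j ∈ t, b j) = ∑ i ∈ s, ∑ j ∈ t, wedge (a i) (b j) := by
  change wedgeAddHom k l _ _ = _
  rw [map_sum (wedgeAddHom k l), AddMonoidHom.finsetSum_apply]
  refine Finset.sum_congr rfl fun i _ => ?_
  rw [map_sum]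
  rfl

theorem wedge_zsmul_left {k l : ℕ} (z : ℤ) (a : V [⋀^Fin k]→ₗ[ℝ] ℂ) (b : V [⋀^Fin l]→ₗ[ℝ] ℂ) :
    wedge (z • a) b = z • wedge a b := by
  change wedgeAddHom k l _ _ = _
  rw [map_zsmul]
  rfl

/-- The sequence `a 0, b 0, a 1, b 1, …`. -/
def interleave {α : Type*} (a b : ℕ → α) (i : ℕ) : α := if i % 2 = 0 then a (i / 2) else b (i / 2)

/-- The sequence `a 0, …, a (n - 1), b 0, b 1, …`. -/
def concat {α : Type*} (n : ℕ) (a b : ℕ → α) (i : ℕ) : α := if i < n then a i else b (i - n)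

theorem wedge_wedgeOneForms_seq {k l : ℕ} (c d e : ℕ → V →ₗ[ℝ] ℂ) (h₁ : ∀ i < k, c i = e i)
    (h₂ : ∀ i < l, d i = e (k + i)) :
    wedge (wedgeOneForms fun i : Fin k => c i) (wedgeOneForms fun i : Fin l => d i) =
      wedgeOneForms fun i : Fin (k + l) => e i := by
  rw [wedge_wedgeOneForms]
  congr 1
  ext i : 1
  refine Fin.addCases (fun i => ?_) (fun i => ?_) i
  · simp [h₁ i i.2]
  · simp [h₂ i i.2]

/-- Induction on `n`: appending the pair `a n, b n` to the sorted sequence leaves `a n` to be moved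
left past the `n` entries `b 0, …, b (n - 1)`, at the cost of `(-1)ⁿ`. The exponents add up to the
triangular number. -/
theorem wedgeOneForms_interleave (a b : ℕ → V →ₗ[ℝ] ℂ) (n : ℕ) :
    (wedgeOneForms fun i : Fin (2 * n) => interleave a b i) =
      ((-1 : ℤ) ^ (n * (n - 1) / 2)) • wedgeOneForms fun i : Fin (2 * n) => concat n a b i := by
  induction n with
  | zero => simp; congr 1; ext i; exact i.elim0
  | succ n ih =>
    have h1 : wedge (wedgeOneForms fun i : Fin (2 * n) => interleave a b i)
        (wedgeOneForms fun i : Fin 2 => interleave a b (2 * n + i)) =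
        wedgeOneForms fun i : Fin (2 * (n + 1)) => interleave a b i :=
      wedge_wedgeOneForms_seq (interleave a b) (fun i => interleave a b (2 * n + i)) _
        (fun _ _ => rfl) (fun _ _ => rfl)
    rw [← h1, ih, wedge_zsmul_left]
    have h2 : wedge (wedgeOneForms fun i : Fin (2 * n) => concat n a b i)
        (wedgeOneForms fun i : Fin 2 => interleave a b (2 * n + i)) =
        wedgeOneForms fun i : Fin (2 * (n + 1)) =>
          (if (i : ℕ) < 2 * n then concat n a b i else interleave a b i) :=
      wedge_wedgeOneForms_seq (concat n a b) (fun i => interleave a b (2 * n + i))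
        (fun i => if i < 2 * n then concat n a b i else interleave a b i)
        (fun i hi => by simp [hi]) (fun i _ => by simp)
    rw [h2]
    have hn : n < 2 * (n + 1) := by omega
    have h2n : 2 * n < 2 * (n + 1) := by omega
    have hle : (⟨n, hn⟩ : Fin (2 * (n + 1))) ≤ ⟨2 * n, h2n⟩ := by
      rw [Fin.mk_le_mk]; omega
    -- The move of `a n` from position `2 n` to position `n` is a cycle on the positions `n, …, 2
    -- n`.
    have h3 : (fun i : Fin (2 * (n + 1)) =>
        (if (i : ℕ) < 2 * n then concat n a b i else interleave a b i)) =
        fun i => (fun i : Fin (2 * (n + 1)) => concat (n + 1) a b i)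
          (Fin.cycleIcc ⟨n, hn⟩ ⟨2 * n, h2n⟩ i) := by
      ext i : 1
      dsimp only
      rcases lt_or_ge (i : ℕ) n with h | h
      · rw [Fin.cycleIcc_of_lt (by rwa [Fin.lt_def])]
        simp [concat, h, show (i : ℕ) < 2 * n by omega, show (i : ℕ) < n + 1 by omega]
      rcases lt_trichotomy (i : ℕ) (2 * n) with h' | h' | h'
      · rw [Fin.cycleIcc_of_ge_of_lt (by rwa [Fin.le_def]) (by rwa [Fin.lt_def])]
        have hv : ((i + 1 : Fin (2 * (n + 1))) : ℕ) = i + 1 := by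
          rw [Fin.val_add_one_of_lt]
          rw [Fin.lt_def]; simp [Fin.val_last]; omega
        simp [concat, h', hv, not_lt.2 h]
      · have : i = ⟨2 * n, h2n⟩ := Fin.ext h'
        rw [this, Fin.cycleIcc_of_last hle]
        simp [concat, interleave]
      · rw [Fin.cycleIcc_of_gt (by rwa [Fin.lt_def])]
        have : (i : ℕ) = 2 * n + 1 := by omega
        have h5 : 2 * n + 1 - (n + 1) = n := by omega
        have h6 : (2 * n + 1) / 2 = n := by omega
        have h7 : ¬ (2 * n + 1) < (n + 1) := by omega
        have h8 : ¬ (2 * n + 1) < 2 * n := by omega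
        simp only [this, concat, interleave, h5, h6, if_neg h7, if_neg h8]
        rw [if_neg (by omega)]
    rw [h3, wedgeOneForms_perm (fun i : Fin (2 * (n + 1)) => concat (n + 1) a b i)]
    rw [Fin.sign_cycleIcc_of_le hle]
    have h4 : (n + 1) * (n + 1 - 1) / 2 = n * (n - 1) / 2 + n := by
      have := Nat.triangle_succ n
      omega
    rw [h4, pow_add, mul_smul]
    have h5 : 2 * n - n = n := by omega
    congr 1
    rw [← Int.cast_smul_eq_zsmul ℂ]
    simp [h5]

theorem wedgePow_sum {n : ℕ} (a b : Fin n → V →ₗ[ℝ] ℂ) (m : ℕ) :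
    wedgePow (∑ j, wedgeOneForms ![a j, b j]) m =
      ∑ f : Fin m → Fin n, wedgeOneForms fun i : Fin (2 * m) =>
        if (i : ℕ) % 2 = 0 then a (f ⟨i / 2, by omega⟩) else b (f ⟨i / 2, by omega⟩) := by
  induction m with
  | zero =>
    ext v
    simp [wedgePow, wedgeOneForms_apply]
  | succ m ih =>
    -- An index function on `m + 1` factors is one on `m` factors followed by a last value.
    rw [wedgePow, ih, wedge_sum_sum, ← (Fin.snocEquiv fun _ => Fin n).sum_comp,
      Fintype.sum_prod_type_right]
    refine Finset.sum_congr rfl fun f _ => Finset.sum_congr rfl fun j _ => ?_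
    rw [wedge_wedgeOneForms]
    congr 1
    ext i : 1
    refine Fin.addCases (fun i => ?_) (fun i => ?_) i
    · have h1 : (i : ℕ) / 2 < m := by have : (i : ℕ) < 2 * m := i.2; omega
      simp [Fin.snocEquiv, Fin.snoc, h1]
    · fin_cases i
      · simp [Fin.snocEquiv, Fin.snoc]
      · have h1 : (2 * m + 1) / 2 = m := by omega
        simp [Fin.snocEquiv, Fin.snoc, h1, Nat.add_mod]

/-- The permutation of `0, 1, …, 2 n - 1` which permutes the pairs `(2 i, 2 i + 1)` by `σ`. -/
def permPairs {n : ℕ} (σ : Equiv.Perm (Fin n)) : Equiv.Perm (Fin (2 * n)) :=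
  (finProdFinEquiv.trans (finCongr (mul_comm n 2))).permCongr (Equiv.prodCongrLeft fun _ => σ)

/-- The permutation acts by `σ` once on the even and once on the odd positions, so its sign is
`(sign σ)² = 1`. -/
theorem sign_permPairs {n : ℕ} (σ : Equiv.Perm (Fin n)) : Equiv.Perm.sign (permPairs σ) = 1 := by
  rw [permPairs, Equiv.Perm.sign_permCongr, Equiv.Perm.sign_prodCongrLeft]
  simp

theorem permPairs_apply {n : ℕ} (σ : Equiv.Perm (Fin n)) (i : Fin (2 * n)) :
    (permPairs σ i : ℕ) = i % 2 + 2 * σ ⟨i / 2, by omega⟩ := by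
  simp [permPairs, Equiv.permCongr_apply, finProdFinEquiv]
  rfl

/-- In the multinomial expansion over index functions `f`, a non-injective `f` repeats a 1-form and
gives `0`. The `n!` permutations all give the same term, since permuting pairs is even. -/
theorem wedgePow_eq {n : ℕ} (a b : ℕ → V →ₗ[ℝ] ℂ) :
    wedgePow (∑ j : Fin n, wedgeOneForms ![a j, b j]) n =
      ((n.factorial : ℤ) * (-1) ^ (n * (n - 1) / 2)) •
        wedgeOneForms fun i : Fin (2 * n) => concat n a b i := by
  rw [wedgePow_sum (fun j : Fin n => a j) (fun j : Fin n => b j), mul_smul,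
    ← wedgeOneForms_interleave]
  have hperm : ∀ σ : Equiv.Perm (Fin n), (wedgeOneForms fun i : Fin (2 * n) =>
        if (i : ℕ) % 2 = 0 then a (σ ⟨i / 2, by omega⟩) else b (σ ⟨i / 2, by omega⟩)) =
      wedgeOneForms fun i : Fin (2 * n) => interleave a b i := by
    intro σ
    have := wedgeOneForms_perm (fun i : Fin (2 * n) => interleave a b i) (permPairs σ)
    rw [sign_permPairs] at this
    simp only [Units.val_one, Int.cast_one, one_smul] at this
    rw [← this]
    congr 1
    ext i : 1
    rcases Nat.mod_two_eq_zero_or_one i with h | h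
    · simp [interleave, permPairs_apply, h]
    · have : ∀ k : ℕ, (1 + 2 * k) / 2 = k := fun k => by omega
      simp [interleave, permPairs_apply, h, this]
  have hinj : ∀ f : Fin n → Fin n, ¬ Function.Bijective f →
      (wedgeOneForms fun i : Fin (2 * n) =>
        if (i : ℕ) % 2 = 0 then a (f ⟨i / 2, by omega⟩) else b (f ⟨i / 2, by omega⟩)) = 0 := by
    intro f hf
    have : ¬ Function.Injective f := fun h => hf (Finite.injective_iff_bijective.1 h)
    simp only [Function.Injective, not_forall] at this
    obtain ⟨i, j, hij, hne⟩ := this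
    refine wedgeOneForms_eq_zero _ (i := ⟨2 * i, by omega⟩) (j := ⟨2 * j, by omega⟩) ?_ ?_
    · intro h
      rw [Fin.mk.injEq] at h
      exact hne (Fin.ext (by omega))
    · simp [hij]
  rw [← Finset.sum_subset (Finset.subset_univ
    (Finset.univ.image (fun σ : Equiv.Perm (Fin n) => (σ : Fin n → Fin n))))]
  · rw [Finset.sum_image (fun σ _ τ _ h => DFunLike.coe_injective h),
      Finset.sum_congr rfl fun σ _ => hperm σ, Finset.sum_const, Finset.card_univ,
      Fintype.card_perm, Fintype.card_fin, natCast_zsmul]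
  · intro f _ hf
    refine hinj f fun hb => hf ?_
    exact Finset.mem_image.2 ⟨Equiv.ofBijective f hb, Finset.mem_univ _, rfl⟩

end Wedge

/-! ### Derivatives of maps between manifolds, on the model spaces -/

section TangentDerivative

variable {F : Type*} [NormedAddCommGroup F] [NormedSpace ℝ F]
  {H : Type*} [TopologicalSpace H] (I : ModelWithCorners ℝ F H)
  {M : Type*} [TopologicalSpace M] [ChartedSpace H M]
  {F' : Type*} [NormedAddCommGroup F'] [NormedSpace ℝ F']
  {H' : Type*} [TopologicalSpace H'] (I' : ModelWithCorners ℝ F' H')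
  {M' : Type*} [TopologicalSpace M'] [ChartedSpace H' M']
  {F'' : Type*} [NormedAddCommGroup F''] [NormedSpace ℝ F'']
  {H'' : Type*} [TopologicalSpace H''] (I'' : ModelWithCorners ℝ F'' H'')
  {M'' : Type*} [TopologicalSpace M''] [ChartedSpace H'' M'']

/-- The manifold derivative as a map between the model vector spaces. -/
def tderiv (f : M → M') (x : M) : F →L[ℝ] F' := mfderiv I I' f x

/-- The predicate `HasMFDerivAt` for derivatives given as maps of the model vector spaces. -/
def HasTDerivAt (f : M → M') (x : M) (D : F →L[ℝ] F') : Prop := HasMFDerivAt I I' f x D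

variable {I I' I''}

theorem HasTDerivAt.tderiv {f : M → M'} {x : M} {D : F →L[ℝ] F'} (h : HasTDerivAt I I' f x D) :
    tderiv I I' f x = D :=
  HasMFDerivAt.mfderiv h

theorem HasTDerivAt.mdifferentiableAt {f : M → M'} {x : M} {D : F →L[ℝ] F'}
    (h : HasTDerivAt I I' f x D) : MDifferentiableAt I I' f x :=
  HasMFDerivAt.mdifferentiableAt h

theorem HasTDerivAt.unique {f : M → M'} {x : M} {D D' : F →L[ℝ] F'} (h : HasTDerivAt I I' f x D)
    (h' : HasTDerivAt I I' f x D') : D = D' :=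
  hasMFDerivAt_unique h h'

theorem _root_.MDifferentiableAt.hasTDerivAt {f : M → M'} {x : M} (h : MDifferentiableAt I I' f x) :
    HasTDerivAt I I' f x (CotangentLieGroup.tderiv I I' f x) :=
  h.hasMFDerivAt

theorem HasTDerivAt.comp {g : M' → M''} {f : M → M'} {x : M} {D' : F' →L[ℝ] F''} {D : F →L[ℝ] F'}
    (hg : HasTDerivAt I' I'' g (f x) D') (hf : HasTDerivAt I I' f x D) :
    HasTDerivAt I I'' (fun y => g (f y)) x (D' ∘L D) :=
  HasMFDerivAt.comp x hg hf

theorem hasTDerivAt_const (c : M') (x : M) : HasTDerivAt I I' (fun _ => c) x 0 :=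
  hasMFDerivAt_const c x

theorem hasTDerivAt_id (x : M) : HasTDerivAt I I (fun y => y) x (ContinuousLinearMap.id ℝ F) :=
  hasMFDerivAt_id x

theorem HasTDerivAt.prodMk {f : M → M'} {g : M → M''} {x : M} {D : F →L[ℝ] F'} {D' : F →L[ℝ] F''}
    (hf : HasTDerivAt I I' f x D) (hg : HasTDerivAt I I'' g x D') :
    HasTDerivAt I (I'.prod I'') (fun y => (f y, g y)) x (D.prod D') :=
  HasMFDerivAt.prodMk hf hg

theorem hasTDerivAt_fst (x : M × M') :
    HasTDerivAt (I.prod I') I (fun p : M × M' => p.1) x (ContinuousLinearMap.fst ℝ F F') :=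
  hasMFDerivAt_fst x

theorem hasTDerivAt_snd (x : M × M') :
    HasTDerivAt (I.prod I') I' (fun p : M × M' => p.2) x (ContinuousLinearMap.snd ℝ F F') :=
  hasMFDerivAt_snd x

theorem HasTDerivAt.congr_of_eventuallyEq {f g : M → M'} {x : M} {D : F →L[ℝ] F'}
    (h : HasTDerivAt I I' f x D) (hfg : g =ᶠ[nhds x] f) : HasTDerivAt I I' g x D := by
  refine HasMFDerivAt.congr_of_eventuallyEq (f := f) ?_ hfg
  exact h

theorem hasTDerivAt_iff_hasFDerivAt {f : F → F'} {x : F} {D : F →L[ℝ] F'} :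
    HasTDerivAt 𝓘(ℝ, F) 𝓘(ℝ, F') f x D ↔ HasFDerivAt f D x :=
  hasMFDerivAt_iff_hasFDerivAt

end TangentDerivative

/-! ### Left logarithmic derivatives and the adjoint action -/

section LeftDerivative

variable {E : Type*} [NormedAddCommGroup E] [NormedSpace ℝ E]
  {G : Type*} [TopologicalSpace G] [ChartedSpace E G] [Group G]

/-- The adjoint action as an endomorphism of the model vector space. -/
def adE (g : G) : E →L[ℝ] E := tderiv 𝓘(ℝ, E) 𝓘(ℝ, E) (fun y : G => g * y * g⁻¹) 1

/-- The differential at `1` of the left translation by `g`. -/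
def dL (g : G) : E →L[ℝ] E := tderiv 𝓘(ℝ, E) 𝓘(ℝ, E) (fun y : G => g * y) 1

/-- The differential at `g` of the left translation by `g⁻¹`. -/
def dLInv (g : G) : E →L[ℝ] E := tderiv 𝓘(ℝ, E) 𝓘(ℝ, E) (fun y : G => g⁻¹ * y) g

variable {F : Type*} [NormedAddCommGroup F] [NormedSpace ℝ F]
  {H : Type*} [TopologicalSpace H] {I : ModelWithCorners ℝ F H}
  {M : Type*} [TopologicalSpace M] [ChartedSpace H M]

variable (I) in
/-- `A` is the left logarithmic derivative of `f : M → G` at `x`: the derivative of `f` at `x`,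
translated to the Lie algebra from the left. -/
def HasLeftDerivAt (f : M → G) (x : M) (A : F →L[ℝ] E) : Prop :=
  HasTDerivAt I 𝓘(ℝ, E) f x (dL (f x) ∘L A)

variable [LieGroup 𝓘(ℝ, E) ∞ G]

theorem mdifferentiable_mul_left (g : G) :
    MDifferentiable 𝓘(ℝ, E) 𝓘(ℝ, E) (fun y : G => g * y) :=
  (contMDiff_mul_left (I := 𝓘(ℝ, E)) (n := ∞) (a := g)).mdifferentiable (by simp)

theorem mdifferentiable_mul_right (g : G) :
    MDifferentiable 𝓘(ℝ, E) 𝓘(ℝ, E) (fun y : G => y * g) :=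
  (contMDiff_mul_right (I := 𝓘(ℝ, E)) (n := ∞) (a := g)).mdifferentiable (by simp)

theorem contMDiff_conj (k : G) :
    ContMDiff 𝓘(ℝ, E) 𝓘(ℝ, E) ∞ (fun x : G => k * x * k⁻¹) :=
  (contMDiff_const.mul contMDiff_id).mul contMDiff_const

theorem mdifferentiable_conj (k : G) :
    MDifferentiable 𝓘(ℝ, E) 𝓘(ℝ, E) (fun x : G => k * x * k⁻¹) :=
  (contMDiff_conj k).mdifferentiable (by simp)

theorem dL_one : dL (1 : G) = ContinuousLinearMap.id ℝ E := by
  simp only [dL, one_mul]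
  exact (hasTDerivAt_id _).tderiv

theorem adE_one : adE (1 : G) = ContinuousLinearMap.id ℝ E := by
  simp only [adE, one_mul, inv_one, mul_one]
  exact (hasTDerivAt_id _).tderiv

theorem mul_left_comp_dL (g h : G) :
    tderiv 𝓘(ℝ, E) 𝓘(ℝ, E) (fun y : G => g * y) h ∘L dL h = dL (E := E) (g * h) := by
  have h1 := HasTDerivAt.comp (g := fun y : G => g * y) (f := fun y : G => h * y) (x := 1)
    (mdifferentiable_mul_left g _).hasTDerivAt (mdifferentiable_mul_left (E := E) h 1).hasTDerivAt
  simp only [mul_one, ← mul_assoc] at h1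
  exact h1.tderiv.symm

/-- Differentiate `g y h = (g h) (h⁻¹ y h)` at `y = 1`. -/
theorem mul_right_comp_dL (g h : G) :
    tderiv 𝓘(ℝ, E) 𝓘(ℝ, E) (fun y : G => y * h) g ∘L dL g = dL (E := E) (g * h) ∘L adE h⁻¹ := by
  have h1 := HasTDerivAt.comp (g := fun y : G => y * h) (f := fun y : G => g * y) (x := 1)
    (mdifferentiable_mul_right h _).hasTDerivAt (mdifferentiable_mul_left (E := E) g 1).hasTDerivAt
  have h2 := HasTDerivAt.comp (g := fun y : G => g * h * y) (f := fun y : G => h⁻¹ * y * h⁻¹⁻¹)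
    (x := 1) (mdifferentiable_mul_left (g * h) _).hasTDerivAt
    (mdifferentiable_conj (E := E) h⁻¹ 1).hasTDerivAt
  have h3 : (fun y : G => g * h * (h⁻¹ * y * h⁻¹⁻¹)) = fun y => g * y * h := by
    ext y; simp [mul_assoc]
  rw [h3] at h2
  simp only [mul_one, mul_inv_cancel] at h1 h2
  exact h1.unique h2

theorem dLInv_comp_dL (g : G) : dLInv g ∘L dL g = ContinuousLinearMap.id ℝ E := by
  have := mul_left_comp_dL (E := E) g⁻¹ g
  rwa [inv_mul_cancel, dL_one] at this

theorem dL_comp_dLInv (g : G) : dL g ∘L dLInv g = ContinuousLinearMap.id ℝ E := by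
  have h1 := HasTDerivAt.comp (g := fun y : G => g * y) (f := fun y : G => g⁻¹ * y) (x := g)
    (mdifferentiable_mul_left g _).hasTDerivAt (mdifferentiable_mul_left (E := E) g⁻¹ g).hasTDerivAt
  simp only [mul_inv_cancel_left, inv_mul_cancel] at h1
  exact h1.unique (hasTDerivAt_id _)

theorem dLInv_dL (g : G) (v : E) : dLInv g (dL g v) = v :=
  congrArg (fun f : E →L[ℝ] E => f v) (dLInv_comp_dL g)

theorem dL_dLInv (g : G) (v : E) : dL g (dLInv g v) = v :=
  congrArg (fun f : E →L[ℝ] E => f v) (dL_comp_dLInv g)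

theorem dL_injective (g : G) : Function.Injective (dL (E := E) g) :=
  Function.LeftInverse.injective (dLInv_dL g)

theorem adE_mul (g h : G) : adE (E := E) (g * h) = adE g ∘L adE h := by
  have h1 := HasTDerivAt.comp (g := fun y : G => g * y * g⁻¹) (f := fun y : G => h * y * h⁻¹)
    (x := 1) (mdifferentiable_conj g _).hasTDerivAt (mdifferentiable_conj (E := E) h 1).hasTDerivAt
  have h2 : (fun y : G => g * (h * y * h⁻¹) * g⁻¹) = fun y => g * h * y * (g * h)⁻¹ := by
    ext y; simp [mul_assoc]
  rw [h2] at h1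
  simp only [mul_one, mul_inv_cancel] at h1
  exact h1.tderiv

theorem adE_mul_apply (g h : G) (V : E) : adE (g * h) V = adE g (adE h V) := by
  rw [adE_mul]; rfl

theorem adE_inv_apply (g : G) (V : E) : adE g⁻¹ (adE g V) = V := by
  rw [← adE_mul_apply, inv_mul_cancel, adE_one]; rfl

theorem adE_apply_inv (g : G) (V : E) : adE g (adE g⁻¹ V) = V := by
  rw [← adE_mul_apply, mul_inv_cancel, adE_one]; rfl

theorem HasTDerivAt.hasLeftDerivAt {f : M → G} {x : M} {D : F →L[ℝ] E}
    (h : HasTDerivAt I 𝓘(ℝ, E) f x D) : HasLeftDerivAt I f x (dLInv (f x) ∘L D) := by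
  rw [HasLeftDerivAt, ← ContinuousLinearMap.comp_assoc, dL_comp_dLInv,
    ContinuousLinearMap.id_comp]
  exact h

theorem HasLeftDerivAt.unique {f : M → G} {x : M} {A B : F →L[ℝ] E}
    (hA : HasLeftDerivAt I f x A) (hB : HasLeftDerivAt I f x B) : A = B := by
  have := HasTDerivAt.unique hA hB
  ext v
  exact dL_injective (f x) (congrArg (fun T : F →L[ℝ] E => T v) this)

theorem hasLeftDerivAt_const (g : G) (x : M) : HasLeftDerivAt I (fun _ => g) x (0 : F →L[ℝ] E) := by
  rw [HasLeftDerivAt, ContinuousLinearMap.comp_zero]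
  exact hasTDerivAt_const _ _

theorem hasTDerivAt_mul (g h : G) :
    HasTDerivAt (𝓘(ℝ, E).prod 𝓘(ℝ, E)) 𝓘(ℝ, E) (fun p : G × G => p.1 * p.2) (g, h)
      ((tderiv 𝓘(ℝ, E) 𝓘(ℝ, E) (fun y : G => y * h) g).coprod
        (tderiv 𝓘(ℝ, E) 𝓘(ℝ, E) (fun y : G => g * y) h)) := by
  have hm : MDifferentiableAt (𝓘(ℝ, E).prod 𝓘(ℝ, E)) 𝓘(ℝ, E) (fun p : G × G => p.1 * p.2)
      (g, h) :=
    (contMDiff_mul 𝓘(ℝ, E) ∞).mdifferentiable (by simp) _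
  convert hm.hasTDerivAt using 1
  symm
  refine ContinuousLinearMap.ext fun v => ?_
  refine (mfderiv_prod_eq_add_apply (v := v) hm).trans ?_
  rw [ContinuousLinearMap.coprod_apply]
  rfl

/-- The derivative of the first factor is right-translated by `g x`; bringing it back to the
identity from the left costs `Ad (g x)⁻¹`. -/
theorem HasLeftDerivAt.mul {f g : M → G} {x : M} {A B : F →L[ℝ] E}
    (hf : HasLeftDerivAt I f x A) (hg : HasLeftDerivAt I g x B) :
    HasLeftDerivAt I (fun y => f y * g y) x (adE (g x)⁻¹ ∘L A + B) := by
  have h := HasTDerivAt.comp (f := fun y => (f y, g y)) (hasTDerivAt_mul (f x) (g x))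
    (HasTDerivAt.prodMk hf hg)
  rw [HasLeftDerivAt]
  convert h using 1
  ext v
  have h2 := congrArg (fun T : E →L[ℝ] E => T (A v)) (mul_right_comp_dL (E := E) (f x) (g x))
  have h3 := congrArg (fun T : E →L[ℝ] E => T (B v)) (mul_left_comp_dL (E := E) (f x) (g x))
  simp only [ContinuousLinearMap.comp_apply] at h2 h3
  simp [h2, h3]

/-- The inverse is differentiable, so the product rule applied to the constant `f f⁻¹ = 1`
determines its derivative. -/
theorem HasLeftDerivAt.inv {f : M → G} {x : M} {A : F →L[ℝ] E} (hf : HasLeftDerivAt I f x A) :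
    HasLeftDerivAt I (fun y => (f y)⁻¹) x (-(adE (f x) ∘L A)) := by
  have hi : MDifferentiableAt 𝓘(ℝ, E) 𝓘(ℝ, E) (fun y : G => y⁻¹) (f x) :=
    (contMDiff_inv 𝓘(ℝ, E) ∞).mdifferentiable (by simp) _
  have h1 := HasTDerivAt.hasLeftDerivAt (HasTDerivAt.comp hi.hasTDerivAt hf)
  have h2 := hf.mul h1
  simp only [mul_inv_cancel] at h2
  have h4 := h2.unique (hasLeftDerivAt_const 1 x)
  rw [inv_inv] at h4
  rw [← eq_neg_of_add_eq_zero_right h4]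
  exact h1

theorem HasLeftDerivAt.comp {F' : Type*} [NormedAddCommGroup F'] [NormedSpace ℝ F']
    {H' : Type*} [TopologicalSpace H'] {I' : ModelWithCorners ℝ F' H'}
    {M' : Type*} [TopologicalSpace M'] [ChartedSpace H' M'] {f : M → G} {g : M' → M} {x : M'}
    {A : F →L[ℝ] E} {D : F' →L[ℝ] F} (hf : HasLeftDerivAt I f (g x) A)
    (hg : HasTDerivAt I' I g x D) : HasLeftDerivAt I' (fun y => f (g y)) x (A ∘L D) := by
  rw [HasLeftDerivAt, ← ContinuousLinearMap.comp_assoc]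
  exact HasTDerivAt.comp (g := f) (f := g) (show HasTDerivAt _ _ _ _ _ from hf) hg

end LeftDerivative

/-! ### The preferred charts and their derivatives -/

section Chart

variable {E : Type*} [NormedAddCommGroup E] [NormedSpace ℝ E]
  {M : Type*} [TopologicalSpace M] [ChartedSpace E M] [IsManifold 𝓘(ℝ, E) ∞ M]

variable (E) in
/-- The preferred chart at `x`. -/
abbrev cht (x : M) : PartialEquiv M E := extChartAt 𝓘(ℝ, E) x

theorem cht_contMDiffAt {x y : M} (h : y ∈ (cht E x).source) :
    ContMDiffAt 𝓘(ℝ, E) 𝓘(ℝ, E) ∞ (cht E x) y :=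
  contMDiffAt_extChartAt' (by rwa [← extChartAt_source 𝓘(ℝ, E)])

theorem cht_symm_contMDiffAt {x : M} {z : E} (h : z ∈ (cht E x).target) :
    ContMDiffAt 𝓘(ℝ, E) 𝓘(ℝ, E) ∞ (cht E x).symm z :=
  (contMDiffOn_extChartAt_symm x).contMDiffAt ((isOpen_extChartAt_target x).mem_nhds h)

theorem cht_hasTDerivAt {x y : M} (h : y ∈ (cht E x).source) :
    HasTDerivAt 𝓘(ℝ, E) 𝓘(ℝ, E) (cht E x) y (tderiv 𝓘(ℝ, E) 𝓘(ℝ, E) (cht E x) y) :=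
  ((cht_contMDiffAt h).mdifferentiableAt (by simp)).hasTDerivAt

theorem cht_symm_hasTDerivAt {x : M} {z : E} (h : z ∈ (cht E x).target) :
    HasTDerivAt 𝓘(ℝ, E) 𝓘(ℝ, E) (cht E x).symm z (tderiv 𝓘(ℝ, E) 𝓘(ℝ, E) (cht E x).symm z) :=
  ((cht_symm_contMDiffAt h).mdifferentiableAt (by simp)).hasTDerivAt

theorem cht_comp_symm {x : M} {z : E} (h : z ∈ (cht E x).target) :
    tderiv 𝓘(ℝ, E) 𝓘(ℝ, E) (cht E x) ((cht E x).symm z) ∘L tderiv 𝓘(ℝ, E) 𝓘(ℝ, E) (cht E x).symm z =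
      ContinuousLinearMap.id ℝ E := by
  have h1 := (cht_hasTDerivAt ((cht E x).map_target h)).comp (cht_symm_hasTDerivAt h)
  refine h1.unique ((hasTDerivAt_id z).congr_of_eventuallyEq ?_)
  filter_upwards [(isOpen_extChartAt_target x).mem_nhds h] with w hw using (cht E x).right_inv hw

theorem cht_symm_comp {x : M} {z : E} (h : z ∈ (cht E x).target) :
    tderiv 𝓘(ℝ, E) 𝓘(ℝ, E) (cht E x).symm z ∘L tderiv 𝓘(ℝ, E) 𝓘(ℝ, E) (cht E x) ((cht E x).symm z) =
      ContinuousLinearMap.id ℝ E := by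
  have h1 := HasTDerivAt.comp (f := cht E x) (x := (cht E x).symm z) (g := (cht E x).symm)
    (by rw [(cht E x).right_inv h]; exact cht_symm_hasTDerivAt h)
    (cht_hasTDerivAt ((cht E x).map_target h))
  refine h1.unique ((hasTDerivAt_id _).congr_of_eventuallyEq ?_)
  filter_upwards [(isOpen_extChartAt_source x).mem_nhds ((cht E x).map_target h)] with w hw
    using (cht E x).left_inv hw

theorem tderiv_cht_self (x : M) :
    tderiv 𝓘(ℝ, E) 𝓘(ℝ, E) (cht E x) x = ContinuousLinearMap.id ℝ E :=
  mfderiv_extChartAt_self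

theorem cht_symm_self (x : M) : (cht E x).symm (cht E x x) = x := extChartAt_to_inv x

theorem cht_self_mem (x : M) : cht E x x ∈ (cht E x).target := mem_extChartAt_target x

theorem cht_target_mem_nhds (x : M) : (cht E x).target ∈ nhds (cht E x x) :=
  extChartAt_target_mem_nhds x

theorem tderiv_cht_symm_self (x : M) :
    tderiv 𝓘(ℝ, E) 𝓘(ℝ, E) (cht E x).symm (cht E x x) = ContinuousLinearMap.id ℝ E := by
  have := cht_comp_symm (cht_self_mem (E := E) x)
  rwa [cht_symm_self, tderiv_cht_self, ContinuousLinearMap.id_comp] at this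

end Chart

/-! ### The Lie bracket as the derivative of the adjoint action -/

section Bracket

variable {E : Type*} [NormedAddCommGroup E] [NormedSpace ℝ E]
  {G : Type*} [TopologicalSpace G] [ChartedSpace E G] [Group G] [LieGroup 𝓘(ℝ, E) ∞ G]

variable (E G) in
/-- The multiplication of `G` in the chart at `1`. -/
def chtMul (p : E × E) : E := cht E (1 : G) ((cht E (1 : G)).symm p.1 * (cht E (1 : G)).symm p.2)

variable (E G) in
/-- The conjugation of `G` in the chart at `1`. -/
def chtConj (p : E × E) : E :=
  cht E (1 : G) ((cht E (1 : G)).symm p.1 * (cht E (1 : G)).symm p.2 * ((cht E (1 : G)).symm p.1)⁻¹)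

theorem contMDiffAt_cht_symm_fst :
    ContMDiffAt (𝓘(ℝ, E).prod 𝓘(ℝ, E)) 𝓘(ℝ, E) ∞ (fun p : E × E => (cht E (1 : G)).symm p.1)
      (cht E (1 : G) 1, cht E (1 : G) 1) :=
  ContMDiffAt.comp (I' := 𝓘(ℝ, E)) (g := (cht E (1 : G)).symm) _ (cht_symm_contMDiffAt (cht_self_mem (1 : G))) contMDiffAt_fst

theorem contMDiffAt_cht_symm_snd :
    ContMDiffAt (𝓘(ℝ, E).prod 𝓘(ℝ, E)) 𝓘(ℝ, E) ∞ (fun p : E × E => (cht E (1 : G)).symm p.2)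
      (cht E (1 : G) 1, cht E (1 : G) 1) :=
  ContMDiffAt.comp (I' := 𝓘(ℝ, E)) (g := (cht E (1 : G)).symm) _ (cht_symm_contMDiffAt (cht_self_mem (1 : G))) contMDiffAt_snd

theorem contDiffAt_chtMul : ContDiffAt ℝ ∞ (chtMul E G) (cht E (1 : G) 1, cht E (1 : G) 1) := by
  have h : ContMDiffAt (𝓘(ℝ, E).prod 𝓘(ℝ, E)) 𝓘(ℝ, E) ∞ (chtMul E G)
      (cht E (1 : G) 1, cht E (1 : G) 1) :=
    ContMDiffAt.comp (I' := 𝓘(ℝ, E)) _ (cht_contMDiffAt (by simp))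
      (contMDiffAt_cht_symm_fst.mul contMDiffAt_cht_symm_snd)
  rw [← contMDiffAt_iff_contDiffAt, modelWithCornersSelf_prod, ← chartedSpaceSelf_prod]
  exact h

theorem contDiffAt_chtConj : ContDiffAt ℝ ∞ (chtConj E G) (cht E (1 : G) 1, cht E (1 : G) 1) := by
  have h : ContMDiffAt (𝓘(ℝ, E).prod 𝓘(ℝ, E)) 𝓘(ℝ, E) ∞ (chtConj E G)
      (cht E (1 : G) 1, cht E (1 : G) 1) :=
    ContMDiffAt.comp (I' := 𝓘(ℝ, E)) _ (cht_contMDiffAt (by simp))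
      ((contMDiffAt_cht_symm_fst.mul contMDiffAt_cht_symm_snd).mul contMDiffAt_cht_symm_fst.inv)
  rw [← contMDiffAt_iff_contDiffAt, modelWithCornersSelf_prod, ← chartedSpaceSelf_prod]
  exact h

variable (E G) in
/-- The left-invariant vector fields in the chart at `1`. -/
def chtLeft (z : E) : E →L[ℝ] E :=
  fderiv ℝ (chtMul E G) (z, cht E (1 : G) 1) ∘L ContinuousLinearMap.inr ℝ E E

variable (E G) in
/-- The right-invariant vector fields in the chart at `1`. -/
def chtRight (z : E) : E →L[ℝ] E :=
  fderiv ℝ (chtMul E G) (cht E (1 : G) 1, z) ∘L ContinuousLinearMap.inl ℝ E E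

variable (E G) in
/-- The second derivative of the multiplication at `1`. -/
def chtSnd : E →L[ℝ] E →L[ℝ] E :=
  (((ContinuousLinearMap.compL ℝ E (E × E) E).flip (ContinuousLinearMap.inr ℝ E E)) ∘L
    fderiv ℝ (fderiv ℝ (chtMul E G)) (cht E (1 : G) 1, cht E (1 : G) 1)) ∘L
      ContinuousLinearMap.inl ℝ E E

theorem contDiffAt_fderiv_chtMul :
    ContDiffAt ℝ ∞ (fderiv ℝ (chtMul E G)) (cht E (1 : G) 1, cht E (1 : G) 1) :=
  contDiffAt_chtMul.fderiv_right (m := ∞) (by simp)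

theorem eventually_differentiableAt_chtMul :
    ∀ᶠ p in nhds ((cht E (1 : G) 1, cht E (1 : G) 1) : E × E), DifferentiableAt ℝ (chtMul E G) p :=
  (contDiffAt_chtMul.of_le (m := 1) (by simp)).eventually (by simp) |>.mono
    fun _ h => h.differentiableAt (by simp)

theorem contDiffAt_chtLeft : ContDiffAt ℝ ∞ (chtLeft E G) (cht E (1 : G) 1) :=
  (ContDiffAt.comp (g := fderiv ℝ (chtMul E G)) (f := fun z => (z, cht E (1 : G) 1)) _
    contDiffAt_fderiv_chtMul (contDiffAt_id.prodMk contDiffAt_const)).clm_comp contDiffAt_const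

theorem contDiffAt_chtRight : ContDiffAt ℝ ∞ (chtRight E G) (cht E (1 : G) 1) :=
  (ContDiffAt.comp (g := fderiv ℝ (chtMul E G)) (f := fun z => (cht E (1 : G) 1, z)) _
    contDiffAt_fderiv_chtMul (contDiffAt_const.prodMk contDiffAt_id)).clm_comp contDiffAt_const

theorem hasFDerivAt_chtLeft (V : E) :
    HasFDerivAt (fun z => chtLeft E G z V) ((chtSnd E G).flip V) (cht E (1 : G) 1) := by
  have h1 : HasFDerivAt (𝕜 := ℝ) (fderiv ℝ (chtMul E G)) (fderiv ℝ (fderiv ℝ (chtMul E G)) (cht E (1 : G) 1, cht E (1 : G) 1)) (cht E (1 : G) 1, cht E (1 : G) 1) :=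
    ((contDiffAt_fderiv_chtMul (E := E) (G := G)).differentiableAt (by simp)).hasFDerivAt
  have h2 : HasFDerivAt (𝕜 := ℝ) (fun z : E => (z, cht E (1 : G) 1)) (ContinuousLinearMap.inl ℝ E E)
    (cht E (1 : G) 1) := hasFDerivAt_prodMk_left _ _
  have h3 : HasFDerivAt (𝕜 := ℝ) (fun z => chtLeft E G z V) _ _ :=
    (HasFDerivAt.comp (g := fderiv ℝ (chtMul E G)) (f := fun z : E => (z, cht E (1 : G) 1))
      _ h1 h2).clm_apply (hasFDerivAt_const ((0, V) : E × E) (cht E (1 : G) 1))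
  refine h3.congr_fderiv ?_
  ext w
  simp [chtSnd]

theorem hasFDerivAt_chtRight (V : E) :
    HasFDerivAt (fun z => chtRight E G z V) (chtSnd E G V) (cht E (1 : G) 1) := by
  have h1 : HasFDerivAt (𝕜 := ℝ) (fderiv ℝ (chtMul E G)) (fderiv ℝ (fderiv ℝ (chtMul E G)) (cht E (1 : G) 1, cht E (1 : G) 1)) (cht E (1 : G) 1, cht E (1 : G) 1) :=
    ((contDiffAt_fderiv_chtMul (E := E) (G := G)).differentiableAt (by simp)).hasFDerivAt
  have h2 : HasFDerivAt (fun z : E => (cht E (1 : G) 1, z)) (ContinuousLinearMap.inr ℝ E E)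
    (cht E (1 : G) 1) := hasFDerivAt_prodMk_right _ _
  have h3 : HasFDerivAt (𝕜 := ℝ) (fun z => chtRight E G z V) _ _ :=
    (HasFDerivAt.comp (g := fderiv ℝ (chtMul E G)) (f := fun z : E => (cht E (1 : G) 1, z))
      _ h1 h2).clm_apply (hasFDerivAt_const ((V, 0) : E × E) (cht E (1 : G) 1))
  -- Symmetry of the second derivative expresses the right-invariant fields through the same mixed
  -- derivative `chtSnd` as the left-invariant ones, with the arguments exchanged.
  have hs : IsSymmSndFDerivAt ℝ (chtMul E G) (cht E (1 : G) 1, cht E (1 : G) 1) :=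
    contDiffAt_chtMul.isSymmSndFDerivAt (by
      rw [minSmoothness_of_isRCLikeNormedField]; exact ENat.LEInfty.out)
  refine h3.congr_fderiv ?_
  ext w
  simpa [chtSnd] using (hs.eq (V, 0) (0, w)).symm

theorem eventually_chtLeft : ∀ᶠ z in nhds (cht E (1 : G) 1),
    chtLeft E G z = tderiv 𝓘(ℝ, E) 𝓘(ℝ, E) (cht E (1 : G)) ((cht E (1 : G)).symm z) ∘L
      dL ((cht E (1 : G)).symm z) := by
  have h0 : Filter.Tendsto (fun z : E => (z, cht E (1 : G) 1)) (nhds (cht E (1 : G) 1))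
    (nhds (cht E (1 : G) 1, cht E (1 : G) 1)) := (Continuous.prodMk_left _).tendsto _
  filter_upwards [h0.eventually eventually_differentiableAt_chtMul, cht_target_mem_nhds (E := E) (1 : G)]
    with z hz hz'
  have h1 := HasFDerivAt.comp (f := fun w : E => (z, w)) (cht E (1 : G) 1) hz.hasFDerivAt
    (hasFDerivAt_prodMk_right _ _)
  have h2 : HasTDerivAt 𝓘(ℝ, E) 𝓘(ℝ, E) (fun y : G => (cht E (1 : G)).symm z * y)
      ((cht E (1 : G)).symm (cht E (1 : G) 1)) (dL ((cht E (1 : G)).symm z)) := by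
    rw [cht_symm_self]
    exact (mdifferentiable_mul_left _ _).hasTDerivAt
  have h3 := h2.comp (cht_symm_hasTDerivAt (cht_self_mem (E := E) (1 : G)))
  have h4 := HasTDerivAt.comp (g := cht E (1 : G)) (D' := tderiv 𝓘(ℝ, E) 𝓘(ℝ, E) (cht E (1 : G))
    ((cht E (1 : G)).symm z)) (by
      rw [cht_symm_self, mul_one]; exact cht_hasTDerivAt ((cht E (1 : G)).map_target hz')) h3
  rw [tderiv_cht_symm_self, ContinuousLinearMap.comp_id, hasTDerivAt_iff_hasFDerivAt] at h4
  exact h1.unique h4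

theorem eventually_chtRight : ∀ᶠ z in nhds (cht E (1 : G) 1),
    chtRight E G z = tderiv 𝓘(ℝ, E) 𝓘(ℝ, E) (cht E (1 : G)) ((cht E (1 : G)).symm z) ∘L
      dL ((cht E (1 : G)).symm z) ∘L adE ((cht E (1 : G)).symm z)⁻¹ := by
  have h0 : Filter.Tendsto (fun z : E => (cht E (1 : G) 1, z)) (nhds (cht E (1 : G) 1))
    (nhds (cht E (1 : G) 1, cht E (1 : G) 1)) := (Continuous.prodMk_right _).tendsto _
  filter_upwards [h0.eventually eventually_differentiableAt_chtMul, cht_target_mem_nhds (E := E) (1 : G)]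
    with z hz hz'
  have h1 := HasFDerivAt.comp (f := fun w : E => (w, z)) (cht E (1 : G) 1) hz.hasFDerivAt
    (hasFDerivAt_prodMk_left _ _)
  have h2 : HasTDerivAt 𝓘(ℝ, E) 𝓘(ℝ, E) (fun y : G => y * (cht E (1 : G)).symm z)
      ((cht E (1 : G)).symm (cht E (1 : G) 1))
      (dL ((cht E (1 : G)).symm z) ∘L adE ((cht E (1 : G)).symm z)⁻¹) := by
    have := mul_right_comp_dL (E := E) 1 ((cht E (1 : G)).symm z)
    rw [dL_one, ContinuousLinearMap.comp_id, one_mul] at this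
    rw [cht_symm_self, ← this]
    exact (mdifferentiable_mul_right _ _).hasTDerivAt
  have h3 := h2.comp (cht_symm_hasTDerivAt (cht_self_mem (E := E) (1 : G)))
  have h4 := HasTDerivAt.comp (g := cht E (1 : G)) (D' := tderiv 𝓘(ℝ, E) 𝓘(ℝ, E) (cht E (1 : G))
    ((cht E (1 : G)).symm z)) (by
      rw [cht_symm_self, one_mul]; exact cht_hasTDerivAt ((cht E (1 : G)).map_target hz')) h3
  rw [tderiv_cht_symm_self, ContinuousLinearMap.comp_id, hasTDerivAt_iff_hasFDerivAt] at h4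
  exact h1.unique h4

theorem chtRight_one : chtRight E G (cht E (1 : G) 1) = ContinuousLinearMap.id ℝ E := by
  have := (eventually_chtRight (E := E) (G := G)).self_of_nhds
  rw [cht_symm_self, tderiv_cht_self, inv_one, adE_one, dL_one] at this
  exact this

/-- This exhibits `Ad` near `1` as a partial derivative of a smooth map, which gives its
differentiability. -/
theorem eventually_adE_chart : ∀ᶠ z in nhds (cht E (1 : G) 1),
    adE ((cht E (1 : G)).symm z) =
      fderiv ℝ (chtConj E G) (z, cht E (1 : G) 1) ∘L ContinuousLinearMap.inr ℝ E E := by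
  have h0 : Filter.Tendsto (fun z : E => (z, cht E (1 : G) 1)) (nhds (cht E (1 : G) 1))
    (nhds (cht E (1 : G) 1, cht E (1 : G) 1)) := (Continuous.prodMk_left _).tendsto _
  have h00 : ∀ᶠ p in nhds ((cht E (1 : G) 1, cht E (1 : G) 1) : E × E),
      DifferentiableAt ℝ (chtConj E G) p :=
    (contDiffAt_chtConj.of_le (m := 1) (by simp)).eventually (by simp) |>.mono
      fun _ h => h.differentiableAt (by simp)
  filter_upwards [h0.eventually h00] with z hz
  have h1 := HasFDerivAt.comp (f := fun w : E => (z, w)) (cht E (1 : G) 1) hz.hasFDerivAt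
    (hasFDerivAt_prodMk_right _ _)
  have h2 : HasTDerivAt 𝓘(ℝ, E) 𝓘(ℝ, E)
      (fun y : G => (cht E (1 : G)).symm z * y * ((cht E (1 : G)).symm z)⁻¹)
      ((cht E (1 : G)).symm (cht E (1 : G) 1)) (adE ((cht E (1 : G)).symm z)) := by
    rw [cht_symm_self]
    exact (mdifferentiable_conj _ _).hasTDerivAt
  have h3 := h2.comp (cht_symm_hasTDerivAt (cht_self_mem (E := E) (1 : G)))
  have h4 := HasTDerivAt.comp (g := cht E (1 : G)) (D' := ContinuousLinearMap.id ℝ E) (by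
      rw [cht_symm_self, mul_one, mul_inv_cancel, ← tderiv_cht_self (1 : G)]
      exact cht_hasTDerivAt (mem_extChartAt_source _)) h3
  rw [tderiv_cht_symm_self, ContinuousLinearMap.comp_id, hasTDerivAt_iff_hasFDerivAt] at h4
  exact h4.unique h1

/-- Near the identity, the right-invariant field with value `Ad (g) V` agrees at `g` with the
left-invariant field of `V`. Differentiating this identity at `1` gives `R' + Ad' = L'`, where `R'`
and `L'` are both given by `chtSnd`. -/
theorem hasFDerivAt_adE_chart (V : E) :
    HasFDerivAt (fun z => adE ((cht E (1 : G)).symm z) V)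
      ((chtSnd E G).flip V - chtSnd E G V) (cht E (1 : G) 1) := by
  have h1 : DifferentiableAt ℝ (fun z => adE (E := E) ((cht E (1 : G)).symm z)) (cht E (1 : G) 1) := by
    have : ContDiffAt ℝ ∞ (fun z => fderiv ℝ (chtConj E G) (z, cht E (1 : G) 1) ∘L
        ContinuousLinearMap.inr ℝ E E) (cht E (1 : G) 1) :=
      (ContDiffAt.comp (g := fderiv ℝ (chtConj E G)) (f := fun z => (z, cht E (1 : G) 1)) _
        (contDiffAt_chtConj.fderiv_right (m := ∞) (by simp))
        (contDiffAt_id.prodMk contDiffAt_const)).clm_comp contDiffAt_const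
    exact (this.differentiableAt (by simp)).congr_of_eventuallyEq eventually_adE_chart
  have h2 := (h1.clm_apply (differentiableAt_const V)).hasFDerivAt
  have h3 := ((contDiffAt_chtRight (E := E) (G := G)).differentiableAt (by simp)).hasFDerivAt.clm_apply h2
  have h4 : (fun z => chtRight E G z (adE ((cht E (1 : G)).symm z) V)) =ᶠ[nhds (cht E (1 : G) 1)]
      fun z => chtLeft E G z V := by
    filter_upwards [eventually_chtLeft (E := E) (G := G), eventually_chtRight (E := E) (G := G)]
      with z hz hz'
    rw [hz, hz']
    simp [adE_inv_apply]
  have h5 := h3.unique ((hasFDerivAt_chtLeft V).congr_of_eventuallyEq h4)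
  have h6 := ((((contDiffAt_chtRight (E := E) (G := G)).differentiableAt (by simp)).hasFDerivAt.clm_apply
    (hasFDerivAt_const V _)).unique (hasFDerivAt_chtRight V))
  convert h2 using 1
  ext w
  have h7 := congrArg (fun T : E →L[ℝ] E => T w) h5
  have h8 := congrArg (fun T : E →L[ℝ] E => T w) h6
  simp only [chtRight_one, cht_symm_self, adE_one] at h7
  simp at h7 h8
  rw [h8] at h7
  simp [← h7]

variable [CompleteSpace E]

/-- The chart at `1` turns left-invariant fields into `z ↦ chtLeft E G z V`; their bracket is a
difference of derivatives at the base point, where `chtLeft` is the identity. -/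
theorem bracket_eq_chtSnd (X Y : GroupLieAlgebra 𝓘(ℝ, E) G) :
    (⁅X, Y⁆ : GroupLieAlgebra 𝓘(ℝ, E) G) = (chtSnd E G X Y - chtSnd E G Y X : E) := by
  have hfield : ∀ V : E, (VectorField.mpullbackWithin 𝓘(ℝ, E) 𝓘(ℝ, E) (cht E (1 : G)).symm
      (mulInvariantVectorField (I := 𝓘(ℝ, E)) (show GroupLieAlgebra 𝓘(ℝ, E) G from V))
      (Set.range 𝓘(ℝ, E)) : E → E) =ᶠ[nhds (cht E (1 : G) 1)] fun z => chtLeft E G z V := by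
    intro V
    filter_upwards [eventually_chtLeft (E := E) (G := G), cht_target_mem_nhds (E := E) (1 : G)] with z hz hz'
    rw [hz, VectorField.mpullbackWithin_apply]
    have h1 : (mfderivWithin 𝓘(ℝ, E) 𝓘(ℝ, E) (cht E (1 : G)).symm (Set.range 𝓘(ℝ, E)) z) =
        tderiv 𝓘(ℝ, E) 𝓘(ℝ, E) (cht E (1 : G)).symm z := by
      rw [modelWithCornersSelf_coe, Set.range_id, mfderivWithin_univ]
      rfl
    rw [h1]
    have h2 : (tderiv 𝓘(ℝ, E) 𝓘(ℝ, E) (cht E (1 : G)).symm z).inverse =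
        tderiv 𝓘(ℝ, E) 𝓘(ℝ, E) (cht E (1 : G)) ((cht E (1 : G)).symm z) :=
      ContinuousLinearMap.inverse_eq (cht_symm_comp hz') (cht_comp_symm hz')
    exact congrArg (fun T : E →L[ℝ] E => T (dL ((cht E (1 : G)).symm z) V)) h2
  rw [GroupLieAlgebra.bracket_def, VectorField.mlieBracket, VectorField.mlieBracketWithin_apply]
  have h3 : (mfderiv 𝓘(ℝ, E) 𝓘(ℝ, E) (cht E (1 : G)) 1).inverse = ContinuousLinearMap.id ℝ E := by
    have : mfderiv 𝓘(ℝ, E) 𝓘(ℝ, E) (cht E (1 : G)) 1 = ContinuousLinearMap.id ℝ E :=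
      tderiv_cht_self 1
    rw [this]
    exact ContinuousLinearMap.inverse_id
  rw [h3]
  simp only [modelWithCornersSelf_coe, Set.range_id, Set.preimage_univ, Set.univ_inter] at hfield ⊢
  have h4 := (Filter.EventuallyEq.lieBracket_vectorField (𝕜 := ℝ) (hfield X)
    (hfield Y)).self_of_nhds
  rw [VectorField.lieBracket_eq (V := fun z => chtLeft E G z X)] at h4
  have h5 : ∀ A B : E → E, ContinuousLinearMap.id ℝ E (VectorField.lieBracketWithin ℝ A B Set.univ
      (cht E (1 : G) 1)) = VectorField.lieBracket ℝ A B (cht E (1 : G) 1) := by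
    intro A B
    rw [VectorField.lieBracketWithin_univ]
    rfl
  refine (h5 _ _).trans (h4.trans ?_)
  have hone : chtLeft E G (cht E (1 : G) 1) = ContinuousLinearMap.id ℝ E := by
    have := (eventually_chtLeft (E := E) (G := G)).self_of_nhds
    rwa [cht_symm_self, tderiv_cht_self, dL_one] at this
  have h6 : ∀ V : E, fderiv ℝ (fun z => chtLeft E G z V) (cht E (1 : G) 1) = (chtSnd E G).flip V :=
    fun V => (hasFDerivAt_chtLeft V).fderiv
  simp only [hone]
  exact congrArg₂ (fun A B : E →L[ℝ] E => A (show E from X) - B (show E from Y)) (h6 Y) (h6 X)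

variable (G) in
/-- The operator `X ↦ ⁅X, V⁆` of the Lie algebra, on the model vector space. -/
def brR (V : E) : E →L[ℝ] E := (chtSnd E G).flip V - chtSnd E G V

theorem brR_apply (V X : E) : brR G V X =
    (⁅(show GroupLieAlgebra 𝓘(ℝ, E) G from X), (show GroupLieAlgebra 𝓘(ℝ, E) G from V)⁆ :
      GroupLieAlgebra 𝓘(ℝ, E) G) :=
  (bracket_eq_chtSnd (G := G) X V).symm

theorem brR_swap (V X : E) : brR G V X = - brR G X V := by
  simp [brR]

theorem hasTDerivAt_adE_one (V : E) :
    HasTDerivAt 𝓘(ℝ, E) 𝓘(ℝ, E) (fun g : G => adE g V) 1 (brR G V) := by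
  have h1 := HasTDerivAt.comp (x := (1 : G)) (f := cht E (1 : G))
    (hasTDerivAt_iff_hasFDerivAt.2 (hasFDerivAt_adE_chart (G := G) V))
    (cht_hasTDerivAt (mem_extChartAt_source _))
  rw [tderiv_cht_self, ContinuousLinearMap.comp_id] at h1
  refine h1.congr_of_eventuallyEq ?_
  filter_upwards [extChartAt_source_mem_nhds (I := 𝓘(ℝ, E)) (1 : G)] with g hg
  rw [(cht E (1 : G)).left_inv hg]

/-- Reduced to the derivative at `1` by `Ad y = Ad g ∘ Ad (g⁻¹ y)`. -/
theorem hasTDerivAt_adE (V : E) (g : G) :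
    HasTDerivAt 𝓘(ℝ, E) 𝓘(ℝ, E) (fun g : G => adE g V) g (adE g ∘L brR G V ∘L dLInv g) := by
  have h1 : HasTDerivAt 𝓘(ℝ, E) 𝓘(ℝ, E) (fun y : G => adE (g⁻¹ * y) V) g (brR G V ∘L dLInv g) := by
    refine HasTDerivAt.comp (g := fun y : G => adE y V) (f := fun y : G => g⁻¹ * y) ?_
      (mdifferentiable_mul_left g⁻¹ g).hasTDerivAt
    rw [inv_mul_cancel]
    exact hasTDerivAt_adE_one V
  have h2 := HasTDerivAt.comp (hasTDerivAt_iff_hasFDerivAt.2 (adE (E := E) g).hasFDerivAt) h1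
  simpa only [← adE_mul_apply, mul_inv_cancel_left] using h2

theorem HasLeftDerivAt.adE {F : Type*} [NormedAddCommGroup F] [NormedSpace ℝ F]
    {H : Type*} [TopologicalSpace H] {I : ModelWithCorners ℝ F H}
    {M : Type*} [TopologicalSpace M] [ChartedSpace H M] {f : M → G} {x : M} {A : F →L[ℝ] E}
    (hf : HasLeftDerivAt I f x A) (V : E) :
    HasTDerivAt I 𝓘(ℝ, E) (fun y => adE (f y) V) x (adE (f x) ∘L brR G V ∘L A) := by
  have h := HasTDerivAt.comp (f := f) (hasTDerivAt_adE (E := E) V (f x)) hf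
  have h2 : (CotangentLieGroup.adE (f x) ∘L brR G V ∘L dLInv (f x)) ∘L (dL (f x) ∘L A) =
      CotangentLieGroup.adE (f x) ∘L brR G V ∘L A := by
    ext v
    simp [dLInv_dL]
  rwa [h2] at h

end Bracket

/-! ### Comparison of an approximately linear equation with a linear one -/

section Gronwall

variable {E : Type*} [NormedAddCommGroup E] [NormedSpace ℝ E]

theorem gronwallBound_zero_le {K ε t : ℝ} (hK : 1 ≤ K) (hε : 0 ≤ ε) (ht0 : 0 ≤ t) (ht : t ≤ 1) :
    gronwallBound 0 K ε t ≤ ε * Real.exp K := by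
  rw [gronwallBound_of_K_ne_0 (by positivity)]
  have h1 : Real.exp (K * t) ≤ Real.exp K := Real.exp_le_exp.2 (by nlinarith)
  have h2 : ε / K ≤ ε := div_le_self hε hK
  have h3 : 0 ≤ Real.exp (K * t) - 1 := by
    rw [sub_nonneg]; exact Real.one_le_exp (by positivity)
  have h4 : ε / K * (Real.exp (K * t) - 1) ≤ ε * Real.exp K :=
    mul_le_mul h2 (by linarith) h3 hε
  linarith

theorem norm_le_of_deriv_le {A : E →L[ℝ] E} {y y' : ℝ → E} {T c : ℝ} (hc : 0 ≤ c) (hT : T ≤ 1)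
    (h0 : y 0 = 0) (hy : ∀ t ∈ Set.Icc 0 T, HasDerivAt y (y' t) t)
    (hb : ∀ t ∈ Set.Icc 0 T, ‖y' t‖ ≤ (‖A‖ + 1) * ‖y t‖ + c) :
    ∀ t ∈ Set.Icc 0 T, ‖y t‖ ≤ c * Real.exp (‖A‖ + 1) := by
  intro t ht
  have h := norm_le_gronwallBound_of_norm_deriv_right_le (f := y) (f' := y') (δ := 0)
    (K := ‖A‖ + 1) (ε := c) (a := 0) (b := T)
    (fun s hs => (hy s hs).continuousAt.continuousWithinAt)
    (fun s hs => (hy s ⟨hs.1, hs.2.le⟩).hasDerivWithinAt) (by simp [h0])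
    (fun s hs => hb s ⟨hs.1, hs.2.le⟩) t ht
  rw [sub_zero] at h
  exact h.trans (gronwallBound_zero_le (by linarith [norm_nonneg A]) hc ht.1 (ht.2.trans hT))

/-- As `ε ≤ 1`, the hypothesis gives `‖y'‖ ≤ (‖A‖ + 1) ‖y‖ + 2 ‖V‖`. This a priori bound, linear in
`‖V‖`, keeps the curve inside the chart later on. -/
theorem norm_le_of_approx_linear {A : E →L[ℝ] E} {V : E} {y y' : ℝ → E} {T ε : ℝ} (hT : T ≤ 1)
    (hε : ε ≤ 1) (h0 : y 0 = 0) (hy : ∀ t ∈ Set.Icc 0 T, HasDerivAt y (y' t) t)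
    (hb : ∀ t ∈ Set.Icc 0 T, ‖y' t - (A (y t) + V)‖ ≤ ε * (‖y t‖ + ‖V‖)) :
    ∀ t ∈ Set.Icc 0 T, ‖y t‖ ≤ 2 * ‖V‖ * Real.exp (‖A‖ + 1) := by
  refine norm_le_of_deriv_le (by positivity) hT h0 hy fun t ht => ?_
  have h1 := hb t ht
  have h2 : y' t = (y' t - (A (y t) + V)) + (A (y t) + V) := by abel
  have h3 : ‖y' t‖ ≤ ‖y' t - (A (y t) + V)‖ + (‖A (y t)‖ + ‖V‖) := by
    conv_lhs => rw [h2]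
    exact (norm_add_le _ _).trans (add_le_add_right (norm_add_le _ _) _)
  have h4 := A.le_opNorm (y t)
  have h5 : ε * (‖y t‖ + ‖V‖) ≤ 1 * (‖y t‖ + ‖V‖) := by gcongr
  linarith

/-- The difference `y - w` solves the homogeneous equation up to an error `ε (‖y‖ + ‖V‖)`, which the
a priori bound on `y` makes `O(ε ‖V‖)`; Gronwall's inequality preserves that order. -/
theorem norm_sub_le_of_approx_linear {A : E →L[ℝ] E} {V : E} {y y' w : ℝ → E} {ε : ℝ}
    (hε0 : 0 ≤ ε) (hε : ε ≤ 1) (h0 : y 0 = 0) (hw0 : w 0 = 0)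
    (hy : ∀ t ∈ Set.Icc (0 : ℝ) 1, HasDerivAt y (y' t) t)
    (hw : ∀ t ∈ Set.Icc (0 : ℝ) 1, HasDerivAt w (A (w t) + V) t)
    (hb : ∀ t ∈ Set.Icc (0 : ℝ) 1, ‖y' t - (A (y t) + V)‖ ≤ ε * (‖y t‖ + ‖V‖)) :
    ‖y 1 - w 1‖ ≤ ε * ((2 * Real.exp (‖A‖ + 1) + 1) * Real.exp (‖A‖ + 1)) * ‖V‖ := by
  have h1 := norm_le_of_approx_linear le_rfl hε h0 hy hb
  have h2 := norm_le_of_deriv_le (A := A) (y := fun t => y t - w t)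
    (y' := fun t => y' t - (A (w t) + V)) (T := 1)
    (c := ε * ((2 * Real.exp (‖A‖ + 1) + 1) * ‖V‖)) (by positivity) le_rfl (by simp [h0, hw0])
    (fun t ht => (hy t ht).sub (hw t ht)) (fun t ht => ?_) 1 (by simp)
  · refine h2.trans (le_of_eq (by ring))
  · have h3 : y' t - (A (w t) + V) = (y' t - (A (y t) + V)) + A (y t - w t) := by
      rw [map_sub]; abel
    rw [h3]
    have h4 := A.le_opNorm (y t - w t)
    have h5 := hb t ht
    have h6 : ε * (‖y t‖ + ‖V‖) ≤ ε * ((2 * Real.exp (‖A‖ + 1) + 1) * ‖V‖) := by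
      gcongr
      linarith [h1 t ht]
    have h7 := norm_nonneg (y t - w t)
    refine (norm_add_le _ _).trans ?_
    linarith

/-- Bootstrap argument: the set of times up to which the curve stays in `N` is closed, and it can
always be prolonged because at its end the curve is in the open set `U ⊆ N`. -/
theorem mem_of_forall_Icc_mem {X : Type*} [TopologicalSpace X] {u : ℝ → X} (hu : Continuous u)
    {N U : Set X} (hN : IsClosed N) (hU : IsOpen U) (hUN : U ⊆ N) (h0 : u 0 ∈ N)
    (h : ∀ T ∈ Set.Icc (0 : ℝ) 1, (∀ t ∈ Set.Icc 0 T, u t ∈ N) → u T ∈ U) :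
    ∀ t ∈ Set.Icc (0 : ℝ) 1, u t ∈ N := by
  -- Truncation by `min t T` makes the time interval independent of `T`, so that `S` is an
  -- intersection of closed preimages.
  set S : Set ℝ := {T | ∀ t ∈ Set.Icc (0 : ℝ) 1, u (min t T) ∈ N} with hS
  have hS' : ∀ T ∈ Set.Icc (0 : ℝ) 1, (T ∈ S ↔ ∀ t ∈ Set.Icc 0 T, u t ∈ N) := by
    intro T hT
    constructor
    · intro hTS t ht
      have := hTS t ⟨ht.1, ht.2.trans hT.2⟩
      rwa [min_eq_left ht.2] at this
    · intro hTS t ht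
      exact hTS _ ⟨le_min ht.1 hT.1, min_le_right _ _⟩
  have hcl : IsClosed S := by
    have : S = ⋂ t ∈ Set.Icc (0 : ℝ) 1, (fun T => u (min t T)) ⁻¹' N := by
      ext T; simp [hS]
    rw [this]
    exact isClosed_biInter fun t _ => hN.preimage (hu.comp (by fun_prop))
  have key : Set.Icc (0 : ℝ) 1 ⊆ S := by
    refine IsClosed.Icc_subset_of_forall_exists_gt (hcl.inter isClosed_Icc) ?_ ?_
    · rw [hS' 0 (by simp)]
      intro t ht
      have : t = 0 := le_antisymm ht.2 ht.1
      rwa [this]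
    · rintro x ⟨hxS, hx⟩ y hy
      have hx' : x ∈ Set.Icc (0 : ℝ) 1 := ⟨hx.1, hx.2.le⟩
      have h1 := (hS' x hx').1 hxS
      have h2 := h x hx' h1
      obtain ⟨δ, hδ, hball⟩ := Metric.mem_nhds_iff.1 (hu.continuousAt.preimage_mem_nhds (hU.mem_nhds h2))
      set z := min (min y 1) (x + δ / 2) with hz
      have hxy : x < y := hy
      have hxz : x < z := lt_min (lt_min hxy hx.2) (by linarith)
      have hz1 : z ≤ 1 := (min_le_left _ _).trans (min_le_right _ _)
      refine ⟨z, (hS' z ⟨hx.1.trans hxz.le, hz1⟩).2 fun t ht => ?_, hxz,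
        (min_le_left _ _).trans (min_le_left _ _)⟩
      rcases le_or_gt t x with htx | htx
      · exact h1 t ⟨ht.1, htx⟩
      · refine hUN (hball ?_)
        rw [Metric.mem_ball, Real.dist_eq, abs_of_pos (by linarith)]
        have : z ≤ x + δ / 2 := min_le_right _ _
        linarith [ht.2]
  intro t ht
  exact (hS' 1 (by simp)).1 (key (by simp)) t ht

end Gronwall

/-! ### One-parameter subgroups and the exponential map -/

section Exponential

variable {E : Type*} [NormedAddCommGroup E] [NormedSpace ℝ E]

/-- `∫₀ᵗ exp (u A) du`. -/
def expInt (A : E →L[ℝ] E) (t : ℝ) : E →L[ℝ] E := ∫ u in (0 : ℝ)..t, NormedSpace.exp (u • A)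

variable [CompleteSpace E]

theorem continuous_exp_smul (A : E →L[ℝ] E) : Continuous fun u : ℝ => NormedSpace.exp (u • A) :=
  continuous_iff_continuousAt.2 fun t => (hasDerivAt_exp_smul_const A t).continuousAt

theorem hasDerivAt_expInt (A : E →L[ℝ] E) (t : ℝ) :
    HasDerivAt (expInt A) (NormedSpace.exp (t • A)) t :=
  intervalIntegral.integral_hasDerivAt_right ((continuous_exp_smul A).intervalIntegrable _ _)
    ((continuous_exp_smul A).stronglyMeasurableAtFilter _ _) (continuous_exp_smul A).continuousAt

/-- Integrate `d/du exp (u A) = A exp (u A)`. With `A` not necessarily invertible, this replaces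
`(exp (t A) - 1) / A`, and it says that `expInt A t V` solves `w' = A w + V`. -/
theorem mul_expInt (A : E →L[ℝ] E) (t : ℝ) : A * expInt A t + 1 = NormedSpace.exp (t • A) := by
  have h := intervalIntegral.integral_eq_sub_of_hasDerivAt (a := 0) (b := t)
    (fun u _ => hasDerivAt_exp_smul_const' A u)
    (((continuous_const.mul (continuous_exp_smul A))).intervalIntegrable _ _)
  rw [zero_smul, NormedSpace.exp_zero] at h
  rw [← eq_sub_iff_add_eq, ← h, expInt]
  exact ((ContinuousLinearMap.mul ℝ (E →L[ℝ] E) A).intervalIntegral_comp_comm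
    ((continuous_exp_smul A).intervalIntegrable _ _)).symm

theorem hasDerivAt_expInt_apply (A : E →L[ℝ] E) (V : E) (t : ℝ) :
    HasDerivAt (fun t => expInt A t V) (A (expInt A t V) + V) t := by
  have h := (hasDerivAt_expInt A t).clm_apply (hasDerivAt_const t V)
  rw [← mul_expInt] at h
  simpa using h

variable {G : Type*} [TopologicalSpace G] [T2Space G] [ChartedSpace E G] [Group G]
  [LieGroup 𝓘(ℝ, E) ∞ G]

theorem contMDiff_one_mulInvariantVectorField (X : GroupLieAlgebra 𝓘(ℝ, E) G) :
    ContMDiff 𝓘(ℝ, E) 𝓘(ℝ, E).tangent 1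
      (fun g : G => (⟨g, mulInvariantVectorField X g⟩ : TangentBundle 𝓘(ℝ, E) G)) :=
  (contMDiff_mulInvariantVectorField X).of_le (by
    rw [minSmoothness_of_isRCLikeNormedField]; exact one_le_two)

/-- `γ` is a curve in `G` whose left logarithmic derivative is constantly `X`. -/
def IsExpCurve (γ : ℝ → G) (X : E) : Prop :=
  ∀ t, HasLeftDerivAt 𝓘(ℝ, ℝ) γ t ((1 : ℝ →L[ℝ] ℝ).smulRight X)

theorem isMIntegralCurve_iff_isExpCurve (γ : ℝ → G) (X : E) :
    IsMIntegralCurve (I := 𝓘(ℝ, E)) γ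
      (mulInvariantVectorField (show GroupLieAlgebra 𝓘(ℝ, E) G from X)) ↔ IsExpCurve γ X := by
  have : ∀ t, (dL (γ t) ∘L ((1 : ℝ →L[ℝ] ℝ).smulRight X) : ℝ →L[ℝ] E) =
      (1 : ℝ →L[ℝ] ℝ).smulRight (dL (γ t) X) := by
    intro t; ext; simp
  simp only [IsExpCurve, HasLeftDerivAt, this]
  rfl

theorem IsExpCurve.mul_left {γ : ℝ → G} {X : E} (h : IsExpCurve γ X) (g : G) :
    IsExpCurve (fun t => g * γ t) X := by
  intro t
  simpa using (hasLeftDerivAt_const (I := 𝓘(ℝ, ℝ)) g t).mul (h t)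

theorem IsExpCurve.unique {γ γ' : ℝ → G} {X : E} (h : IsExpCurve γ X) (h' : IsExpCurve γ' X)
    (h0 : γ 0 = γ' 0) : γ = γ' := by
  rw [← isMIntegralCurve_iff_isExpCurve] at h h'
  exact isMIntegralCurve_Ioo_eq_of_contMDiff_boundaryless (t₀ := 0)
    (contMDiff_one_mulInvariantVectorField _) h h' h0

theorem IsExpCurve.comp_mul {γ : ℝ → G} {X : E} (h : IsExpCurve γ X) (a : ℝ) :
    IsExpCurve (fun t => γ (a * t)) (a • X) := by
  intro t
  have h1 : HasDerivAt (fun t : ℝ => a * t) a t := by simpa using (hasDerivAt_id t).const_mul a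
  have h2 := HasLeftDerivAt.comp (g := fun t : ℝ => a * t) (h (a * t))
    (hasTDerivAt_iff_hasFDerivAt.2 h1.hasFDerivAt)
  convert h2 using 1
  ext
  simp

theorem IsExpCurve.comp_add {γ : ℝ → G} {X : E} (h : IsExpCurve γ X) (a : ℝ) :
    IsExpCurve (fun t => γ (a + t)) X := by
  intro t
  have h1 : HasDerivAt (fun t : ℝ => a + t) 1 t := by simpa using (hasDerivAt_id t).const_add a
  have h2 := HasLeftDerivAt.comp (g := fun t : ℝ => a + t) (h (a + t))
    (hasTDerivAt_iff_hasFDerivAt.2 h1.hasFDerivAt)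
  convert h2 using 1
  ext
  simp

variable (G) in
-- A local integral curve through `1` on `(-ε, ε)` can be left-translated to start at any point, so
-- the existence time is uniform and integral curves extend to all of `ℝ`.
theorem exists_isExpCurve (X : E) : ∃ γ : ℝ → G, IsExpCurve γ X ∧ γ 0 = 1 := by
  obtain ⟨γ, hγ0, hγ⟩ := exists_isMIntegralCurveAt_of_contMDiffAt_boundaryless (t₀ := 0)
    ((contMDiff_one_mulInvariantVectorField
      (show GroupLieAlgebra 𝓘(ℝ, E) G from X)).contMDiffAt (x := 1))
  obtain ⟨ε, hε, hball⟩ := Metric.eventually_nhds_iff_ball.1 hγ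
  have key : ∀ x : G, ∃ γ : ℝ → G, γ 0 = x ∧ IsMIntegralCurveOn (I := 𝓘(ℝ, E)) γ
      (mulInvariantVectorField (show GroupLieAlgebra 𝓘(ℝ, E) G from X)) (Set.Ioo (-ε) ε) := by
    intro x
    refine ⟨fun t => x * γ t, by simp [hγ0], fun t ht => ?_⟩
    have h1 : HasLeftDerivAt 𝓘(ℝ, ℝ) γ t ((1 : ℝ →L[ℝ] ℝ).smulRight X) := by
      have h2 := hball t (by rw [Real.ball_eq_Ioo]; simpa using ht)
      have : (dL (γ t) ∘L ((1 : ℝ →L[ℝ] ℝ).smulRight X) : ℝ →L[ℝ] E) =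
          (1 : ℝ →L[ℝ] ℝ).smulRight (dL (γ t) X) := by ext; simp
      rw [HasLeftDerivAt, this]
      exact h2
    have h2 := (hasLeftDerivAt_const (I := 𝓘(ℝ, ℝ)) x t).mul h1
    rw [ContinuousLinearMap.comp_zero, zero_add] at h2
    have : (dL (x * γ t) ∘L ((1 : ℝ →L[ℝ] ℝ).smulRight X) : ℝ →L[ℝ] E) =
        (1 : ℝ →L[ℝ] ℝ).smulRight (dL (x * γ t) X) := by ext; simp
    rw [HasLeftDerivAt, this] at h2
    exact HasMFDerivAt.hasMFDerivWithinAt h2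
  obtain ⟨δ, hδ0, hδ⟩ := exists_isMIntegralCurve_of_isMIntegralCurveOn
    (contMDiff_one_mulInvariantVectorField _) hε key 1
  exact ⟨δ, (isMIntegralCurve_iff_isExpCurve _ _).1 hδ, hδ0⟩

/-- The exponential map with arguments in the model vector space. -/
abbrev expE (G : Type*) [TopologicalSpace G] [ChartedSpace E G] [Group G] (X : E) : G :=
  lieExp (E := E) (K := G) X

/-- `lieExp` is a choice, so existence is needed before its value can be used; uniqueness then
compares the chosen curve for `t • X` with `u ↦ γ (t u)` at `u = 1`. -/
theorem IsExpCurve.eq_expE {γ : ℝ → G} {X : E} (h : IsExpCurve γ X) (h0 : γ 0 = 1) (t : ℝ) :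
    γ t = expE G (t • X) := by
  obtain ⟨δ, hδ, hδ0⟩ := exists_isExpCurve G (t • X)
  have hex : ∃ γ : ℝ → G, IsMIntegralCurve (I := 𝓘(ℝ, E)) γ
      (mulInvariantVectorField (show GroupLieAlgebra 𝓘(ℝ, E) G from t • X)) ∧ γ 0 = 1 :=
    ⟨δ, (isMIntegralCurve_iff_isExpCurve _ _).2 hδ, hδ0⟩
  have hs := Classical.epsilon_spec hex
  have h1 := (isMIntegralCurve_iff_isExpCurve _ _).1 hs.1
  have h2 := h1.unique (h.comp_mul t) (by rw [hs.2]; simp [h0])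
  have h3 := congrFun h2 1
  rw [mul_one] at h3
  exact h3.symm

variable (G) in
theorem isExpCurve_expE (X : E) : IsExpCurve (fun t : ℝ => expE G (t • X)) X := by
  obtain ⟨γ, hγ, h0⟩ := exists_isExpCurve G X
  have : γ = fun t : ℝ => expE G (t • X) := funext fun t => hγ.eq_expE h0 t
  rwa [← this]

variable (G) in
theorem expE_zero : expE G (0 : E) = 1 := by
  obtain ⟨γ, hγ, h0⟩ := exists_isExpCurve G (0 : E)
  have := hγ.eq_expE h0 0
  rw [zero_smul] at this
  rw [← this, h0]

variable (G) in
theorem expE_neg (X : E) : expE G (-X) = (expE G X)⁻¹ := by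
  have h1 := ((isExpCurve_expE G X).comp_add (-1)).mul_left (expE G X)
  have h2 := (h1.unique (isExpCurve_expE G X) (by
    simp only [add_zero, zero_smul, expE_zero]
    have h3 := (isExpCurve_expE G X).comp_add 1
    have h4 := ((isExpCurve_expE G X).mul_left (expE G X)).unique h3 (by simp [expE_zero])
    have h5 := congrFun h4 (-1)
    simp only [add_neg_cancel, zero_smul, expE_zero] at h5
    exact h5))
  have h6 := congrFun h2 0
  simp only [add_zero, zero_smul, expE_zero, neg_smul, one_smul] at h6
  exact eq_inv_of_mul_eq_one_right h6

end Exponential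

/-! ### Homomorphisms, and `Ad` of an exponential -/

section Homomorphism

variable {E : Type*} [NormedAddCommGroup E] [NormedSpace ℝ E] [CompleteSpace E]
  {G : Type*} [TopologicalSpace G] [ChartedSpace E G] [Group G] [LieGroup 𝓘(ℝ, E) ∞ G]
  {E' : Type*} [NormedAddCommGroup E'] [NormedSpace ℝ E'] [CompleteSpace E']
  {G' : Type*} [TopologicalSpace G'] [ChartedSpace E' G'] [Group G'] [LieGroup 𝓘(ℝ, E') ∞ G']

/-- The differential at `1` of a homomorphism. -/
def homE (E E' : Type*) [NormedAddCommGroup E] [NormedSpace ℝ E] [NormedAddCommGroup E']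
    [NormedSpace ℝ E'] {G G' : Type*} [TopologicalSpace G] [ChartedSpace E G] [Group G]
    [TopologicalSpace G'] [ChartedSpace E' G'] [Group G'] (φ : G →* G') : E →L[ℝ] E' :=
  tderiv 𝓘(ℝ, E) 𝓘(ℝ, E') φ 1

theorem hasTDerivAt_hom {φ : G →* G'} (hφ : MDifferentiable 𝓘(ℝ, E) 𝓘(ℝ, E') φ) :
    HasTDerivAt 𝓘(ℝ, E) 𝓘(ℝ, E') φ 1 (homE E E' φ) :=
  (hφ 1).hasTDerivAt

theorem homE_adE {φ : G →* G'} (hφ : MDifferentiable 𝓘(ℝ, E) 𝓘(ℝ, E') φ) (g : G) (V : E) :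
    homE E E' φ (adE g V) = adE (φ g) (homE E E' φ V) := by
  have h1 := HasTDerivAt.comp (x := (1 : G)) (g := φ) (f := fun y : G => g * y * g⁻¹)
    (D' := homE E E' φ) (by
      rw [mul_one, mul_inv_cancel]; exact hasTDerivAt_hom hφ) (mdifferentiable_conj g 1).hasTDerivAt
  have h2 := HasTDerivAt.comp (x := (1 : G)) (g := fun y : G' => φ g * y * (φ g)⁻¹) (f := φ)
    (D' := adE (φ g)) (by
      rw [map_one]; exact (mdifferentiable_conj (φ g) 1).hasTDerivAt) (hasTDerivAt_hom hφ)
  simp only [map_mul, map_inv] at h1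
  exact congrArg (fun T : E →L[ℝ] E' => T V) (h1.unique h2)

/-- Differentiate the equivariance `homE_adE` in the group variable at `1`. -/
theorem homE_brR {φ : G →* G'} (hφ : MDifferentiable 𝓘(ℝ, E) 𝓘(ℝ, E') φ) (X V : E) :
    homE E E' φ (brR G V X) = brR G' (homE E E' φ V) (homE E E' φ X) := by
  have h1 := HasTDerivAt.comp (x := (1 : G)) (f := fun g : G => adE g V)
    (hasTDerivAt_iff_hasFDerivAt.2 (homE E E' φ).hasFDerivAt) (hasTDerivAt_adE_one V)
  have h2 := HasTDerivAt.comp (x := (1 : G)) (g := fun g : G' => adE g (homE E E' φ V))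
    (D' := brR G' (homE E E' φ V)) (f := φ) (by
      rw [map_one]; exact hasTDerivAt_adE_one _) (hasTDerivAt_hom hφ)
  simp only [homE_adE hφ] at h1
  exact congrArg (fun T : E →L[ℝ] E' => T X) (h1.unique h2)

theorem hasLeftDerivAt_hom {φ : G →* G'} (hφ : MDifferentiable 𝓘(ℝ, E) 𝓘(ℝ, E') φ) (g : G) :
    HasLeftDerivAt 𝓘(ℝ, E) φ g (homE E E' φ ∘L dLInv g) := by
  have h1 : HasLeftDerivAt 𝓘(ℝ, E) φ 1 (homE E E' φ) := by
    rw [HasLeftDerivAt, map_one, dL_one, ContinuousLinearMap.id_comp]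
    exact hasTDerivAt_hom hφ
  have h2 : HasLeftDerivAt 𝓘(ℝ, E) (fun y => φ (g⁻¹ * y)) g (homE E E' φ ∘L dLInv g) := by
    refine HasLeftDerivAt.comp (g := fun y : G => g⁻¹ * y) (f := φ) ?_
      (mdifferentiable_mul_left g⁻¹ g).hasTDerivAt
    rw [inv_mul_cancel]
    exact h1
  have h3 := (hasLeftDerivAt_const (I := 𝓘(ℝ, E)) (φ g) g).mul h2
  simpa using h3

theorem adE_brR (g : G) (X V : E) : adE g (brR G V X) = brR G (adE g V) (adE g X) :=
  homE_brR (φ := (MulAut.conj g).toMonoidHom) (mdifferentiable_conj g) X V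

variable [T2Space G]

/-- The derivative in `t` is `Ad (exp t X) ⁅X, X⁆ = 0`. -/
theorem adE_expE_self (X : E) (t : ℝ) : adE (expE G (t • X)) X = X := by
  have h1 : ∀ t, HasDerivAt (fun t : ℝ => adE (expE G (t • X)) X) 0 t := by
    intro t
    have h := (isExpCurve_expE G X t).adE X
    rw [hasTDerivAt_iff_hasFDerivAt] at h
    convert h.hasDerivAt using 1
    simp [brR]
  have h2 := is_const_of_deriv_eq_zero (fun t => (h1 t).differentiableAt) (fun t => (h1 t).deriv) t 0
  simpa [expE_zero, adE_one] using h2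

theorem brR_adE_expE (X V : E) (t : ℝ) :
    brR G X (adE (expE G (t • X)) V) = adE (expE G (t • X)) (brR G X V) := by
  rw [adE_brR, adE_expE_self]

/-- The curve `exp (-t A) (Ad (exp (-t X)) V)` has zero derivative, hence equals its value `V` at `t
= 0`. The sign matches because `brR G X` is `-ad X`. -/
theorem adE_expE_neg (X V : E) :
    adE (expE G (-X)) V = NormedSpace.exp (brR G X) V := by
  set A := brR G X with hA
  have h1 : ∀ t, HasDerivAt (fun t : ℝ => NormedSpace.exp ((-t) • A) (adE (expE G (t • -X)) V))
      0 t := by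
    intro t
    have h := (isExpCurve_expE G (-X) t).adE V
    rw [hasTDerivAt_iff_hasFDerivAt] at h
    have h3 : HasDerivAt (fun t : ℝ => NormedSpace.exp ((-t) • A))
        (-(NormedSpace.exp ((-t) • A) * A)) t := by
      have := HasDerivAt.scomp t (hasDerivAt_exp_smul_const A (-t)) (hasDerivAt_neg t)
      simpa [Function.comp_def] using this
    convert h3.clm_apply h.hasDerivAt using 1
    have h4 : brR G V (-X) = A V := by rw [map_neg, brR_swap, neg_neg]
    have h5 : A (adE (expE G (t • -X)) V) = adE (expE G (t • -X)) (A V) := by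
      have := brR_adE_expE (G := G) X V (-t)
      rwa [neg_smul, ← smul_neg] at this
    simp only [smul_neg] at h5
    simp [h4, h5]
  have h2 := is_const_of_deriv_eq_zero (fun t => (h1 t).differentiableAt) (fun t => (h1 t).deriv) 1 0
  simp only [neg_zero, zero_smul, expE_zero, adE_one, one_smul, neg_smul, NormedSpace.exp_zero] at h2
  have h3 : NormedSpace.exp A * NormedSpace.exp (-A) = 1 := by
    let : NormedAlgebra ℚ (E →L[ℝ] E) := .restrictScalars ℚ ℝ _
    rw [← NormedSpace.exp_add_of_commute ((Commute.refl A).neg_right), add_neg_cancel,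
      NormedSpace.exp_zero]
  have h4 := congrArg (fun v => NormedSpace.exp A v) h2
  have h5 := congrArg (fun T : E →L[ℝ] E => T (adE (expE G (-X)) V)) h3
  exact h5.symm.trans h4

end Homomorphism

/-! ### The derivative of the exponential map -/

section DerivExp

variable {E : Type*} [NormedAddCommGroup E] [NormedSpace ℝ E] [FiniteDimensional ℝ E]
  {G : Type*} [TopologicalSpace G] [T2Space G] [ChartedSpace E G] [Group G] [LieGroup 𝓘(ℝ, E) ∞ G]

variable (G) in
/-- The vector field of the curve `exp (t W)⁻¹ exp (t (W + V))` in the chart at `1`. -/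
def expField (W : E) (p : E × E) : E := chtLeft E G p.1 (W + p.2) - chtRight E G p.1 W

theorem chtLeft_one : chtLeft E G (cht E (1 : G) 1) = ContinuousLinearMap.id ℝ E := by
  have := (eventually_chtLeft (E := E) (G := G)).self_of_nhds
  rwa [cht_symm_self, tderiv_cht_self, dL_one] at this

variable (G) in
-- First-order expansion of the field at `(c, 0)`, where `c` is the chart image of `1`: it vanishes
-- there, its derivative in `V` is the identity, and its derivative in `z` is the difference of the
-- left and right derivatives, that is, `brR G W`.
theorem expField_isLittleO (W : E) {ε : ℝ} (hε : 0 < ε) :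
    ∃ ρ > 0, ∀ z V : E, ‖z - cht E (1 : G) 1‖ ≤ ρ → ‖V‖ ≤ ρ →
      ‖expField G W (z, V) - (brR G W (z - cht E (1 : G) 1) + V)‖ ≤
        ε * (‖z - cht E (1 : G) 1‖ + ‖V‖) := by
  set c := cht E (1 : G) 1 with hc
  have h1 : HasFDerivAt (fun p : E × E => chtLeft E G p.1)
      (fderiv ℝ (chtLeft E G) c ∘L ContinuousLinearMap.fst ℝ E E) (c, 0) :=
    HasFDerivAt.comp (g := chtLeft E G) (f := Prod.fst) (c, (0 : E))
      (contDiffAt_chtLeft.differentiableAt (by simp)).hasFDerivAt hasFDerivAt_fst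
  have h1' : HasFDerivAt (fun p : E × E => W + p.2) (ContinuousLinearMap.snd ℝ E E) (c, 0) :=
    hasFDerivAt_snd.const_add W
  have h2 : HasFDerivAt (fun p : E × E => chtRight E G p.1 W)
      (chtSnd E G W ∘L ContinuousLinearMap.fst ℝ E E) (c, 0) :=
    HasFDerivAt.comp (g := fun z => chtRight E G z W) (f := Prod.fst) (c, (0 : E))
      (hasFDerivAt_chtRight W) hasFDerivAt_fst
  have h3 := (h1.clm_apply h1').sub h2
  have h4 : ∀ w, fderiv ℝ (chtLeft E G) c w W = chtSnd E G w W := by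
    intro w
    have := (((contDiffAt_chtLeft (E := E) (G := G)).differentiableAt
      (by simp)).hasFDerivAt.clm_apply (hasFDerivAt_const W _)).unique (hasFDerivAt_chtLeft W)
    have := congrArg (fun T : E →L[ℝ] E => T w) this
    simpa [hc] using this
  have h5 : HasFDerivAt (expField G W)
      (brR G W ∘L ContinuousLinearMap.fst ℝ E E + ContinuousLinearMap.snd ℝ E E) (c, 0) := by
    refine HasFDerivAt.congr_fderiv h3 ?_
    refine ContinuousLinearMap.ext fun p => ?_
    have h6 : chtLeft E G c = ContinuousLinearMap.id ℝ E := chtLeft_one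
    simp [brR, h4, h6]
    abel
  have h6 : expField G W (c, 0) = 0 := by
    simp only [expField, hc, chtLeft_one, chtRight_one, add_zero, sub_self]
  rw [hasFDerivAt_iff_isLittleO, Asymptotics.isLittleO_iff] at h5
  obtain ⟨δ, hδ, hball⟩ := Metric.eventually_nhds_iff_ball.1 (h5 hε)
  refine ⟨δ / 2, by positivity, fun z V hz hV => ?_⟩
  have hn : ‖((z, V) - (c, 0) : E × E)‖ = max ‖z - c‖ ‖V‖ := by
    simp [Prod.norm_def]
  have h7 := hball (z, V) (by
    rw [mem_ball_iff_norm, hn]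
    exact max_lt (by linarith) (by linarith))
  rw [h6, sub_zero, hn] at h7
  change ‖expField G W (z, V) - (brR G W (z - c) + (V - 0))‖ ≤ _ at h7
  rw [sub_zero] at h7
  refine h7.trans ?_
  gcongr
  exact max_le (by linarith [norm_nonneg V]) (by linarith [norm_nonneg (z - c)])

/-- With `g = γ⁻¹ γ'`, the product rule gives the left logarithmic derivative `(W + V) - Ad (g⁻¹)
W`; the second term is the right-invariant field of `W`. -/
theorem hasDerivAt_cht_curve {W V : E} {γ γ' : ℝ → G} (hγ : IsExpCurve γ W)
    (hγ' : IsExpCurve γ' (W + V)) {t : ℝ} (hs : (γ t)⁻¹ * γ' t ∈ (cht E (1 : G)).source)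
    (hL : chtLeft E G (cht E (1 : G) ((γ t)⁻¹ * γ' t)) =
      tderiv 𝓘(ℝ, E) 𝓘(ℝ, E) (cht E (1 : G)) ((γ t)⁻¹ * γ' t) ∘L dL ((γ t)⁻¹ * γ' t))
    (hR : chtRight E G (cht E (1 : G) ((γ t)⁻¹ * γ' t)) =
      tderiv 𝓘(ℝ, E) 𝓘(ℝ, E) (cht E (1 : G)) ((γ t)⁻¹ * γ' t) ∘L dL ((γ t)⁻¹ * γ' t) ∘L
        adE ((γ t)⁻¹ * γ' t)⁻¹) :
    HasDerivAt (fun t => cht E (1 : G) ((γ t)⁻¹ * γ' t))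
      (expField G W (cht E (1 : G) ((γ t)⁻¹ * γ' t), V)) t := by
  have h1 := (hγ t).inv.mul (hγ' t)
  have h2 := HasTDerivAt.comp (f := fun t => (γ t)⁻¹ * γ' t) (cht_hasTDerivAt hs) h1
  rw [hasTDerivAt_iff_hasFDerivAt] at h2
  convert h2.hasDerivAt using 1
  rw [expField, hL, hR]
  simp [adE_mul_apply]
  abel

variable (G) in
-- The curve `exp (t W)⁻¹ exp (t (W + V))` starts at `1` and in the chart nearly solves `z' = A (z -
-- c) + V`. Its endpoint therefore differs from the exact solution `expInt A 1 V` by `o(‖V‖)`. Prior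
-- differentiability of the exponential map is not needed.
theorem expE_estimate (W : E) {ε : ℝ} (hε : 0 < ε) :
    ∀ᶠ V in nhds (0 : E), (expE G W)⁻¹ * expE G (W + V) ∈ (cht E (1 : G)).source ∧
      ‖cht E (1 : G) ((expE G W)⁻¹ * expE G (W + V)) - cht E (1 : G) 1 -
        expInt (brR G W) 1 V‖ ≤ ε * ‖V‖ := by
  set A := brR G W with hA
  set c := cht E (1 : G) 1 with hc
  set C := (2 * Real.exp (‖A‖ + 1) + 1) * Real.exp (‖A‖ + 1) with hC
  have hCpos : 0 < C := by positivity
  -- Dividing by the constant `C` of the comparison estimate yields `ε` at the end; the bound by `1`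
  -- allows the a priori estimate.
  obtain ⟨ρ₁, hρ₁, hest⟩ := expField_isLittleO G W (ε := min 1 (ε / C)) (by positivity)
  obtain ⟨ρ₂, hρ₂, hnice⟩ := Metric.eventually_nhds_iff_ball.1
    ((eventually_chtLeft (E := E) (G := G)).and ((eventually_chtRight (E := E) (G := G)).and
      (cht_target_mem_nhds (E := E) (1 : G))))
  set ρ := min ρ₁ (ρ₂ / 2) with hρ
  have hρpos : 0 < ρ := by positivity
  have hball : Metric.closedBall c ρ ⊆ Metric.ball c ρ₂ :=
    Metric.closedBall_subset_ball ((min_le_right _ _).trans_lt (by linarith))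
  have htarget : Metric.closedBall c ρ ⊆ (cht E (1 : G)).target :=
    fun z hz => (hnice z (hball hz)).2.2
  set N : Set G := (cht E (1 : G)).symm '' Metric.closedBall c ρ with hN
  set U : Set G := (cht E (1 : G)).source ∩ cht E (1 : G) ⁻¹' Metric.ball c ρ with hU
  -- Closed balls are compact in finite dimension, so the image is compact, hence closed in the
  -- Hausdorff group.
  have hNclosed : IsClosed N :=
    ((isCompact_closedBall c ρ).image_of_continuousOn
      ((continuousOn_extChartAt_symm (1 : G)).mono htarget)).isClosed
  have hUopen : IsOpen U := isOpen_extChartAt_preimage' (1 : G) Metric.isOpen_ball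
  have hUN : U ⊆ N := by
    rintro g ⟨hg, hg'⟩
    exact ⟨_, Metric.ball_subset_closedBall hg', (cht E (1 : G)).left_inv hg⟩
  have hNsource : ∀ g ∈ N, g ∈ (cht E (1 : G)).source ∧ ‖cht E (1 : G) g - c‖ ≤ ρ ∧
      chtLeft E G (cht E (1 : G) g) =
        tderiv 𝓘(ℝ, E) 𝓘(ℝ, E) (cht E (1 : G)) g ∘L dL g ∧
      chtRight E G (cht E (1 : G) g) =
        tderiv 𝓘(ℝ, E) 𝓘(ℝ, E) (cht E (1 : G)) g ∘L dL g ∘L adE g⁻¹ := by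
    rintro g ⟨z, hz, rfl⟩
    have h1 := hnice z (hball hz)
    rw [(cht E (1 : G)).right_inv (htarget hz)]
    exact ⟨(cht E (1 : G)).map_target (htarget hz), mem_closedBall_iff_norm.1 hz, h1.1, h1.2.1⟩
  -- The second bound makes the a priori estimate `2 ‖V‖ exp (‖A‖ + 1)` smaller than `ρ`, as the
  -- bootstrap requires.
  have hsmall : ∀ᶠ V in nhds (0 : E), ‖V‖ < min ρ (ρ / (2 * Real.exp (‖A‖ + 1))) := by
    have : Filter.Tendsto (fun V : E => ‖V‖) (nhds 0) (nhds 0) := by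
      simpa using (continuous_norm (E := E)).tendsto 0
    exact this.eventually_lt_const (by positivity)
  filter_upwards [hsmall] with V hV
  have hVρ : ‖V‖ ≤ ρ := hV.le.trans (min_le_left _ _)
  have hV' : 2 * ‖V‖ * Real.exp (‖A‖ + 1) < ρ := by
    have := hV.trans_le (min_le_right _ _)
    rw [lt_div_iff₀ (by positivity)] at this
    linarith
  set u : ℝ → G := fun t => (expE G (t • W))⁻¹ * expE G (t • (W + V)) with hu
  have hucont : Continuous u :=
    continuous_iff_continuousAt.2 fun t => HasTDerivAt.mdifferentiableAt
      ((isExpCurve_expE G W t).inv.mul (isExpCurve_expE G (W + V) t)) |>.continuousAt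
  have hu0 : u 0 = 1 := by simp [hu, expE_zero]
  have hderiv : ∀ t, u t ∈ N → HasDerivAt (fun t => cht E (1 : G) (u t) - c)
      (expField G W (cht E (1 : G) (u t), V)) t := by
    intro t ht
    obtain ⟨h1, h2, h3, h4⟩ := hNsource _ ht
    exact (hasDerivAt_cht_curve (isExpCurve_expE G W) (isExpCurve_expE G (W + V)) h1 h3 h4).sub_const c
  have hbound : ∀ t, u t ∈ N → ‖expField G W (cht E (1 : G) (u t), V) -
      (A (cht E (1 : G) (u t) - c) + V)‖ ≤ min 1 (ε / C) * (‖cht E (1 : G) (u t) - c‖ + ‖V‖) := by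
    intro t ht
    obtain ⟨h1, h2, h3, h4⟩ := hNsource _ ht
    exact hest _ _ (h2.trans (min_le_left _ _)) (hVρ.trans (min_le_left _ _))
  have hz0 : cht E (1 : G) (u 0) - c = 0 := by rw [hu0, sub_self]
  have hmem : ∀ t ∈ Set.Icc (0 : ℝ) 1, u t ∈ N := by
    refine mem_of_forall_Icc_mem hucont hNclosed hUopen hUN ?_ ?_
    · rw [hu0]
      exact ⟨c, Metric.mem_closedBall_self hρpos.le, cht_symm_self 1⟩
    · intro T hT hTN
      have h1 := norm_le_of_approx_linear (A := A) (V := V) (T := T) hT.2 (min_le_left 1 (ε / C))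
        hz0 (fun t ht => hderiv t (hTN t ht)) (fun t ht => hbound t (hTN t ht)) T ⟨hT.1, le_rfl⟩
      exact ⟨(hNsource _ (hTN T ⟨hT.1, le_rfl⟩)).1, mem_ball_iff_norm.2 (h1.trans_lt hV')⟩
  have hfin := norm_sub_le_of_approx_linear (A := A) (V := V) (w := fun t => expInt A t V)
    (by positivity) (min_le_left 1 (ε / C)) hz0 (by simp [expInt])
    (fun t ht => hderiv t (hmem t ht)) (fun t _ => hasDerivAt_expInt_apply A V t)
    (fun t ht => hbound t (hmem t ht))
  have hu1 : u 1 = (expE G W)⁻¹ * expE G (W + V) := by simp [hu]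
  rw [hu1] at hfin
  refine ⟨hu1 ▸ (hNsource _ (hmem 1 (by simp))).1, hfin.trans ?_⟩
  rw [← hC]
  gcongr
  calc min 1 (ε / C) * C ≤ ε / C * C := by gcongr; exact min_le_right _ _
    _ = ε := by field_simp

/-- The derivative of the exponential map. -/
theorem hasLeftDerivAt_expE (W : E) :
    HasLeftDerivAt 𝓘(ℝ, E) (fun Z : E => expE G Z) W (expInt (brR G W) 1) := by
  have h0 : cht E (1 : G) ((expE G W)⁻¹ * expE G (W + 0)) = cht E (1 : G) 1 := by simp
  have h1 : HasFDerivAt (fun V => cht E (1 : G) ((expE G W)⁻¹ * expE G (W + V)))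
      (expInt (brR G W) 1) 0 := by
    rw [hasFDerivAt_iff_isLittleO, Asymptotics.isLittleO_iff]
    intro ε hε
    filter_upwards [expE_estimate G W hε] with V hV
    rw [h0, sub_zero]
    exact hV.2
  have h2 := HasTDerivAt.comp (x := (0 : E)) (g := (cht E (1 : G)).symm)
    (D' := ContinuousLinearMap.id ℝ E)
    (f := fun V : E => cht E (1 : G) ((expE G W)⁻¹ * expE G (W + V))) (by
      rw [h0, ← tderiv_cht_symm_self (1 : G)]
      exact cht_symm_hasTDerivAt (cht_self_mem 1)) (hasTDerivAt_iff_hasFDerivAt.2 h1)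
  have h3 : HasTDerivAt 𝓘(ℝ, E) 𝓘(ℝ, E) (fun V : E => (expE G W)⁻¹ * expE G (W + V)) 0
      (ContinuousLinearMap.id ℝ E ∘L expInt (brR G W) 1) := by
    refine h2.congr_of_eventuallyEq ?_
    filter_upwards [expE_estimate G W one_pos] with V hV
    exact ((cht E (1 : G)).left_inv hV.1).symm
  have h4 : HasLeftDerivAt 𝓘(ℝ, E) (fun V : E => (expE G W)⁻¹ * expE G (W + V)) 0
      (expInt (brR G W) 1) := by
    rw [HasLeftDerivAt]
    simpa [dL_one] using h3
  have h5 : HasTDerivAt 𝓘(ℝ, E) 𝓘(ℝ, E) (fun Z : E => Z - W) W (ContinuousLinearMap.id ℝ E) :=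
    hasTDerivAt_iff_hasFDerivAt.2 ((hasFDerivAt_id W).sub_const W)
  have h6 := HasLeftDerivAt.comp (g := fun Z : E => Z - W)
    (f := fun V : E => (expE G W)⁻¹ * expE G (W + V)) (by rw [sub_self]; exact h4) h5
  -- Write `exp Z = exp W · (exp W)⁻¹ exp (W + (Z - W))`; a constant left factor does not change the
  -- left logarithmic derivative.
  have h7 := (hasLeftDerivAt_const (I := 𝓘(ℝ, E)) (expE G W) W).mul h6
  simpa using h7

end DerivExp

/-! ### Complex Lie groups as real Lie groups -/

section RestrictScalars

variable {EG : Type*} [NormedAddCommGroup EG] [NormedSpace ℂ EG]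
  {G : Type*} [TopologicalSpace G] [ChartedSpace EG G]

theorem isManifold_real [h : IsManifold 𝓘(ℂ, EG) ∞ G] : IsManifold 𝓘(ℝ, EG) ∞ G := by
  refine isManifold_of_contDiffOn 𝓘(ℝ, EG) ∞ G fun e e' he he' => ?_
  have h1 := HasGroupoid.compatible (G := contDiffGroupoid ∞ 𝓘(ℂ, EG)) he he'
  rw [contDiffGroupoid, mem_groupoid_of_pregroupoid] at h1
  exact ContDiffOn.restrict_scalars ℝ h1.1

variable [Group G]

theorem lieGroup_real [h : LieGroup 𝓘(ℂ, EG) ∞ G] : LieGroup 𝓘(ℝ, EG) ∞ G := by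
  have : IsManifold 𝓘(ℝ, EG) ∞ G := isManifold_real
  refine { contMDiff_mul := fun p => ?_, contMDiff_inv := fun g => ?_ }
  · have h1 := contMDiffAt_iff.1 (contMDiff_mul 𝓘(ℂ, EG) (G := G) ∞ p)
    exact contMDiffAt_iff.2 ⟨h1.1, ContDiffWithinAt.restrict_scalars ℝ h1.2⟩
  · have h1 := contMDiffAt_iff.1 (contMDiff_inv 𝓘(ℂ, EG) (G := G) ∞ g)
    exact contMDiffAt_iff.2 ⟨h1.1, ContDiffWithinAt.restrict_scalars ℝ h1.2⟩

theorem tderiv_I_smul {f : G → G} {x : G} (hf : MDifferentiableAt 𝓘(ℂ, EG) 𝓘(ℂ, EG) f x) (v : EG) :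
    tderiv 𝓘(ℝ, EG) 𝓘(ℝ, EG) f x (Complex.I • v) =
      Complex.I • tderiv 𝓘(ℝ, EG) 𝓘(ℝ, EG) f x v := by
  have h1 := hf.hasMFDerivAt
  set D : EG →L[ℂ] EG := mfderiv 𝓘(ℂ, EG) 𝓘(ℂ, EG) f x with hD
  have h2 : HasTDerivAt 𝓘(ℝ, EG) 𝓘(ℝ, EG) f x (D.restrictScalars ℝ) :=
    ⟨h1.1, HasFDerivWithinAt.restrictScalars ℝ h1.2⟩
  rw [h2.tderiv]
  exact D.map_smul _ _

variable [LieGroup 𝓘(ℂ, EG) ∞ G]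

theorem dL_I_smul (g : G) (v : EG) : dL g (Complex.I • v) = Complex.I • dL g v :=
  tderiv_I_smul ((contMDiff_mul_left (I := 𝓘(ℂ, EG)) (n := ∞) (a := g)).mdifferentiable
    (by simp) _) v

theorem adE_I_smul (g : G) (v : EG) : adE g (Complex.I • v) = Complex.I • adE g v :=
  tderiv_I_smul ((((contMDiff_const (I' := 𝓘(ℂ, EG)) (c := g)).mul contMDiff_id).mul
    (contMDiff_const (c := g⁻¹))).mdifferentiable (n := ∞) (by simp) _) v

/-- Conjugation is holomorphic, so `Ad g` is complex linear; differentiating in `g` makes the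
bracket complex linear in this argument, and antisymmetry handles the other. -/
theorem brR_I_smul_left [LieGroup 𝓘(ℝ, EG) ∞ G] [CompleteSpace EG] (v w : EG) :
    brR G (Complex.I • v) w = Complex.I • brR G v w := by
  have h1 := hasTDerivAt_adE_one (G := G) (Complex.I • v)
  have h2 := hasTDerivAt_adE_one (G := G) v
  have h3 := HasTDerivAt.comp (f := fun g : G => adE g v) (hasTDerivAt_iff_hasFDerivAt.2
    ((Complex.I • ContinuousLinearMap.id ℂ EG : EG →L[ℂ] EG).restrictScalars ℝ).hasFDerivAt) h2
  simp only [adE_I_smul] at h1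
  exact congrArg (fun T : EG →L[ℝ] EG => T w) (h1.unique h3)

theorem brR_I_smul_right [LieGroup 𝓘(ℝ, EG) ∞ G] [CompleteSpace EG] (v w : EG) :
    brR G v (Complex.I • w) = Complex.I • brR G v w := by
  rw [brR_swap, brR_I_smul_left, brR_swap w v, smul_neg, neg_neg]

end RestrictScalars

/-! ### Exponentials and their integrals in Banach algebras -/

section AlgebraExponential

variable {𝔸 𝔹 F : Type*} [NormedRing 𝔸] [NormedAlgebra ℝ 𝔸] [CompleteSpace 𝔸]
  [NormedRing 𝔹] [NormedAlgebra ℝ 𝔹] [CompleteSpace 𝔹] [NormedAddCommGroup F] [NormedSpace ℝ F]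

/-- `∫₀ᵗ exp (u a) du`. -/
def expIntegral (a : 𝔸) (t : ℝ) : 𝔸 := ∫ u in (0 : ℝ)..t, NormedSpace.exp (u • a)

theorem continuous_exp_smul_alg (a : 𝔸) : Continuous fun u : ℝ => NormedSpace.exp (u • a) :=
  continuous_iff_continuousAt.2 fun t => (hasDerivAt_exp_smul_const a t).continuousAt

theorem intervalIntegrable_exp_smul (a : 𝔸) (s t : ℝ) :
    IntervalIntegrable (fun u : ℝ => NormedSpace.exp (u • a)) MeasureTheory.volume s t :=
  (continuous_exp_smul_alg a).intervalIntegrable _ _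

/-- Termwise comparison of the exponential series. Only agreement on powers is assumed, so it covers
entrywise conjugation, intertwining relations `M U = U D`, and passing from operators to matrices.
-/
theorem map_exp_eq_of_map_pow_eq (f : 𝔸 →L[ℝ] F) (g : 𝔹 →L[ℝ] F) {a : 𝔸} {b : 𝔹}
    (h : ∀ k : ℕ, f (a ^ k) = g (b ^ k)) : f (NormedSpace.exp a) = g (NormedSpace.exp b) := by
  have h1 := (NormedSpace.exp_series_hasSum_exp' (𝕂 := ℝ) a).mapL f
  have h2 := (NormedSpace.exp_series_hasSum_exp' (𝕂 := ℝ) b).mapL g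
  refine h1.unique ?_
  convert h2 using 2 with k
  rw [map_smul, map_smul, h]

theorem map_exp_smul_eq_of_map_pow_eq (f : 𝔸 →L[ℝ] F) (g : 𝔹 →L[ℝ] F) {a : 𝔸} {b : 𝔹}
    (h : ∀ k : ℕ, f (a ^ k) = g (b ^ k)) (t : ℝ) :
    f (NormedSpace.exp (t • a)) = g (NormedSpace.exp (t • b)) :=
  map_exp_eq_of_map_pow_eq f g fun k => by rw [smul_pow, smul_pow, map_smul, map_smul, h]

theorem map_expIntegral_eq_of_map_pow_eq [CompleteSpace F] (f : 𝔸 →L[ℝ] F) (g : 𝔹 →L[ℝ] F)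
    {a : 𝔸} {b : 𝔹} (h : ∀ k : ℕ, f (a ^ k) = g (b ^ k)) (t : ℝ) :
    f (expIntegral a t) = g (expIntegral b t) := by
  rw [expIntegral, expIntegral, ← f.intervalIntegral_comp_comm (intervalIntegrable_exp_smul a _ _),
    ← g.intervalIntegral_comp_comm (intervalIntegrable_exp_smul b _ _)]
  simp only [map_exp_smul_eq_of_map_pow_eq f g h]

theorem exp_add_smul (a : 𝔸) (s t : ℝ) :
    NormedSpace.exp ((s + t) • a) = NormedSpace.exp (s • a) * NormedSpace.exp (t • a) := by
  let _ : NormedAlgebra ℚ 𝔸 := NormedAlgebra.restrictScalars ℚ ℝ 𝔸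
  rw [add_smul, NormedSpace.exp_add_of_commute (((Commute.refl a).smul_left s).smul_right t)]

/-- The cocycle identity: split the integral at `s` and pull `exp (s a)` out of the second part. -/
theorem expIntegral_add (a : 𝔸) (s t : ℝ) :
    expIntegral a (s + t) = expIntegral a s + NormedSpace.exp (s • a) * expIntegral a t := by
  rw [expIntegral, expIntegral, ← intervalIntegral.integral_add_adjacent_intervals
    (intervalIntegrable_exp_smul a 0 s) (intervalIntegrable_exp_smul a s (s + t))]
  congr 1
  have h := intervalIntegral.integral_comp_add_left (a := 0) (b := t)
    (fun u : ℝ => NormedSpace.exp (u • a)) s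
  rw [add_zero] at h
  rw [← h]
  simp only [exp_add_smul]
  exact (ContinuousLinearMap.mul ℝ 𝔸 _).intervalIntegral_comp_comm
    (intervalIntegrable_exp_smul a _ _)

theorem smul_expIntegral_smul (a : 𝔸) (s : ℝ) : s • expIntegral (s • a) 1 = expIntegral a s := by
  have h := intervalIntegral.smul_integral_comp_mul_right (a := 0) (b := 1)
    (fun u : ℝ => NormedSpace.exp (u • a)) s
  rw [zero_mul, one_mul] at h
  rw [expIntegral, expIntegral, ← h]
  simp only [mul_smul]

/-- Substitute `u ↦ s - u` in the integral. -/
theorem exp_mul_expIntegral_neg (a : 𝔸) (s : ℝ) :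
    NormedSpace.exp (s • a) * expIntegral (-a) s = expIntegral a s := by
  have h := (ContinuousLinearMap.mul ℝ 𝔸 (NormedSpace.exp (s • a))).intervalIntegral_comp_comm
    (intervalIntegrable_exp_smul (-a) 0 s)
  have h2 := intervalIntegral.integral_comp_sub_left (a := 0) (b := s)
    (fun u : ℝ => NormedSpace.exp (u • a)) s
  rw [sub_zero, sub_self] at h2
  rw [expIntegral, expIntegral, ← h2]
  refine h.symm.trans (intervalIntegral.integral_congr fun u _ => ?_)
  simp only [ContinuousLinearMap.mul_apply']
  rw [sub_eq_add_neg, exp_add_smul, neg_smul, smul_neg]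

theorem exp_neg_smul_mul_exp_smul (a : 𝔸) (s : ℝ) :
    NormedSpace.exp ((-s) • a) * NormedSpace.exp (s • a) = 1 := by
  rw [← exp_add_smul, neg_add_cancel, zero_smul, NormedSpace.exp_zero]

end AlgebraExponential

/-! ### Determinants of integrated matrix exponentials -/

section MatrixExponential

open scoped Matrix.Norms.Operator
open Matrix

variable {n : ℕ}

theorem matrix_exp_mul_expIntegral_neg (M : Matrix (Fin n) (Fin n) ℂ) (s : ℝ) :
    NormedSpace.exp (s • M) * expIntegral (-M) s = expIntegral M s :=
  exp_mul_expIntegral_neg M s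

theorem matrix_exp_neg_smul_mul_exp_smul (M : Matrix (Fin n) (Fin n) ℂ) (s : ℝ) :
    NormedSpace.exp ((-s) • M) * NormedSpace.exp (s • M) = 1 :=
  exp_neg_smul_mul_exp_smul M s

theorem matrix_expIntegral_add (M : Matrix (Fin n) (Fin n) ℂ) (s t : ℝ) :
    expIntegral M (s + t) = expIntegral M s + NormedSpace.exp (s • M) * expIntegral M t :=
  expIntegral_add M s t

/-- With `N = M / 2`, transposition gives `det exp (-N) = det exp N`, so `det exp M = (det exp N)² =
det exp (-N) · det exp N = 1`. -/
theorem det_exp_eq_one_of_transpose_eq_neg {M : Matrix (Fin n) (Fin n) ℂ} (hM : Mᵀ = -M) :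
    (NormedSpace.exp M).det = 1 := by
  set N := (2⁻¹ : ℝ) • M with hN
  have h1 : (NormedSpace.exp (-N)).det = (NormedSpace.exp N).det := by
    rw [show -N = Nᵀ by rw [hN, transpose_smul, hM, smul_neg], exp_transpose, det_transpose]
  have h2 := matrix_exp_neg_smul_mul_exp_smul N 1
  rw [neg_smul, one_smul] at h2
  have h3 : NormedSpace.exp M = NormedSpace.exp N * NormedSpace.exp N := by
    have := exp_add_smul M 2⁻¹ 2⁻¹
    rwa [show (2⁻¹ + 2⁻¹ : ℝ) = 1 by norm_num, one_smul] at this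
  rw [h3, det_mul]
  nth_rewrite 1 [← h1]
  rw [← det_mul, h2, det_one]

variable (n) in
/-- Entrywise complex conjugation of matrices. -/
def conjMatrix : Matrix (Fin n) (Fin n) ℂ →L[ℝ] Matrix (Fin n) (Fin n) ℂ :=
  LinearMap.toContinuousLinearMap
    { toFun := fun M => M.map (starRingEnd ℂ)
      map_add' := fun _ _ => by ext; simp
      map_smul' := fun _ _ => by ext; simp }

theorem conjMatrix_apply (M : Matrix (Fin n) (Fin n) ℂ) :
    conjMatrix n M = M.map (starRingEnd ℂ) := rfl

theorem conjMatrix_pow (M : Matrix (Fin n) (Fin n) ℂ) (k : ℕ) :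
    conjMatrix n (M ^ k) = conjMatrix n M ^ k :=
  map_pow (starRingEnd ℂ).mapMatrix M k

theorem conjMatrix_exp (M : Matrix (Fin n) (Fin n) ℂ) (t : ℝ) :
    conjMatrix n (NormedSpace.exp (t • M)) = NormedSpace.exp (t • conjMatrix n M) :=
  map_exp_smul_eq_of_map_pow_eq (conjMatrix n) (ContinuousLinearMap.id ℝ _)
    (fun k => conjMatrix_pow M k) t

theorem conjMatrix_expIntegral (M : Matrix (Fin n) (Fin n) ℂ) (t : ℝ) :
    conjMatrix n (expIntegral M t) = expIntegral (conjMatrix n M) t :=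
  map_expIntegral_eq_of_map_pow_eq (conjMatrix n) (ContinuousLinearMap.id ℝ _)
    (fun k => conjMatrix_pow M k) t

/-- Conjugation turns `M` into `-M`. The upper left block `exp (-s M)` has determinant `1` and
inverse `exp (s M)`; the Schur complement is `i (E_M(s') + exp (s' M) exp (s M) E_{-M}(s))`, which
the reflection and cocycle identities collapse to `i E_M(s' + s)`. -/
theorem det_exp_expIntegral_blocks {M : Matrix (Fin n) (Fin n) ℂ} (hM : Mᵀ = -M)
    (hM' : conjMatrix n M = -M) (s s' : ℝ) :
    (fromBlocks (conjMatrix n (NormedSpace.exp (s • M)))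
      (conjMatrix n (Complex.I • expIntegral M s))
      (NormedSpace.exp (s' • M)) (Complex.I • expIntegral M s')).det =
      Complex.I ^ n * (expIntegral M (s + s')).det := by
  have h0 : conjMatrix n (Complex.I • expIntegral M s) = -(Complex.I • expIntegral (-M) s) := by
    rw [← hM', ← conjMatrix_expIntegral]
    ext i j
    simp [conjMatrix_apply]
  have h1 : conjMatrix n (NormedSpace.exp (s • M)) = NormedSpace.exp (-s • M) := by
    rw [conjMatrix_exp, hM', smul_neg, neg_smul]
  have hl : NormedSpace.exp (-s • M) * NormedSpace.exp (s • M) = 1 := matrix_exp_neg_smul_mul_exp_smul M s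
  have hr : NormedSpace.exp (s • M) * NormedSpace.exp (-s • M) = 1 := by
    simpa using matrix_exp_neg_smul_mul_exp_smul M (-s)
  let _ : Invertible (NormedSpace.exp (-s • M)) := ⟨NormedSpace.exp (s • M), hr, hl⟩
  have hd : (NormedSpace.exp (-s • M)).det = 1 :=
    det_exp_eq_one_of_transpose_eq_neg (by rw [transpose_smul, hM, smul_neg])
  rw [h0, h1, det_fromBlocks₁₁, hd, one_mul, show ⅟(NormedSpace.exp (-s • M)) =
    NormedSpace.exp (s • M) from rfl, mul_neg, sub_neg_eq_add, mul_assoc, mul_smul_comm,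
    matrix_exp_mul_expIntegral_neg, mul_smul_comm, ← smul_add, ← matrix_expIntegral_add, det_smul,
    Fintype.card_fin, add_comm s]

theorem det_expIntegral_smul (M : Matrix (Fin n) (Fin n) ℂ) (s : ℝ) :
    (expIntegral M s).det = (s : ℂ) ^ n * (expIntegral (s • M) 1).det := by
  rw [← smul_expIntegral_smul, show s • expIntegral (s • M) 1 = (s : ℂ) • expIntegral (s • M) 1 from
    (Complex.coe_smul _ _).symm, det_smul, Fintype.card_fin]

theorem expIntegral_diagonal (d : Fin n → ℂ) (t : ℝ) :
    expIntegral (diagonal d) t = diagonal fun i => ∫ u in (0 : ℝ)..t, Complex.exp (u * d i) := by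
  have h1 : ∀ u : ℝ, NormedSpace.exp (u • diagonal d) =
      diagonal (fun i => Complex.exp (u * d i)) := by
    intro u
    rw [← diagonal_smul, Matrix.exp_diagonal]
    congr 1
    ext i
    rw [Pi.coe_exp, Complex.exp_eq_exp_ℂ]
    simp
  ext i j
  have h2 := (Matrix.entryLinearMap ℝ ℂ i j).toContinuousLinearMap.intervalIntegral_comp_comm
    (intervalIntegrable_exp_smul (diagonal d) 0 t)
  refine h2.symm.trans ((intervalIntegral.integral_congr fun u _ => congrArg
    (fun N : Matrix (Fin n) (Fin n) ℂ => N i j) (h1 u)).trans ?_)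
  by_cases hij : i = j
  · subst hij
    simp
  · simp [hij]

theorem integral_cexp_mul_real (r : ℝ) :
    ∫ u in (0 : ℝ)..1, Complex.exp (u * ((2 * r : ℝ) : ℂ)) = ((Real.exp r * sinhc r : ℝ) : ℂ) := by
  have h : ∀ u : ℝ, Complex.exp (u * ((2 * r : ℝ) : ℂ)) = ((Real.exp (u * (2 * r)) : ℝ) : ℂ) := by
    intro u; push_cast; rfl
  simp only [h]
  rw [intervalIntegral.integral_ofReal]
  congr 1
  by_cases hr : r = 0
  · simp [hr, sinhc]
  · rw [intervalIntegral.integral_comp_mul_right _ (by simpa using hr), integral_exp, sinhc,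
      if_neg hr, Real.sinh_eq]
    simp only [zero_mul, one_mul, Real.exp_zero, smul_eq_mul]
    rw [two_mul, Real.exp_add, Real.exp_neg]
    field_simp
    ring

/-- If `2 M` is diagonalized by `U`, with real eigenvalues `2 d i`. -/
theorem det_expIntegral_of_mul_eq_mul_diagonal {M U : Matrix (Fin n) (Fin n) ℂ} (hU : U.det ≠ 0)
    {d : Fin n → ℝ} (h : M * U = U * diagonal fun i => ((2 * d i : ℝ) : ℂ)) :
    (expIntegral M 1).det = ((∏ i, (Real.exp (d i) * sinhc (d i)) : ℝ) : ℂ) := by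
  set D := diagonal fun i => ((2 * d i : ℝ) : ℂ) with hD
  -- The intertwining relation passes to powers, hence to the integrated exponential; `U` then
  -- cancels in the determinant.
  have h1 : ∀ k : ℕ, M ^ k * U = U * D ^ k := by
    intro k
    induction k with
    | zero => simp
    | succ k ih => rw [pow_succ, mul_assoc, h, ← mul_assoc, ih, mul_assoc, ← pow_succ]
  have h2 := map_expIntegral_eq_of_map_pow_eq ((ContinuousLinearMap.mul ℝ _).flip U)
    (ContinuousLinearMap.mul ℝ _ U) h1 1
  simp only [ContinuousLinearMap.flip_apply, ContinuousLinearMap.mul_apply'] at h2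
  have h3 := congrArg det h2
  rw [det_mul, det_mul, mul_comm] at h3
  rw [mul_left_cancel₀ hU h3, hD, expIntegral_diagonal, det_diagonal]
  push_cast [integral_cexp_mul_real]
  refine Finset.prod_congr rfl fun i _ => ?_
  have := integral_cexp_mul_real (d i)
  push_cast at this
  exact this

variable {E : Type*} [NormedAddCommGroup E] [NormedSpace ℝ E] [CompleteSpace E]

theorem map_pow_apply_of_intertwine (L : E →L[ℝ] (Fin n → ℂ)) {A : E →L[ℝ] E}
    {M : Matrix (Fin n) (Fin n) ℂ} (h : ∀ v, L (A v) = M *ᵥ L v) (k : ℕ) :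
    ∀ v, L ((A ^ k) v) = (M ^ k) *ᵥ L v := by
  induction k with
  | zero => intro v; simp
  | succ k ih => intro v; rw [pow_succ, pow_succ, mul_apply_eq_comp, ih, h,
      mulVec_mulVec]

/-- `M ↦ M w` for complex matrices `M`. -/
def mulVecFlip (w : Fin n → ℂ) : Matrix (Fin n) (Fin n) ℂ →L[ℝ] (Fin n → ℂ) :=
  LinearMap.toContinuousLinearMap
    { toFun := fun M => M *ᵥ w
      map_add' := fun _ _ => add_mulVec _ _ _
      map_smul' := fun _ _ => smul_mulVec _ _ _ }

theorem map_exp_apply_of_intertwine (L : E →L[ℝ] (Fin n → ℂ)) {A : E →L[ℝ] E}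
    {M : Matrix (Fin n) (Fin n) ℂ} (h : ∀ v, L (A v) = M *ᵥ L v) (v : E) :
    L (NormedSpace.exp A v) = NormedSpace.exp M *ᵥ L v :=
  map_exp_eq_of_map_pow_eq (L ∘L ContinuousLinearMap.apply ℝ E v) (mulVecFlip (L v))
    fun k => map_pow_apply_of_intertwine L h k v

theorem map_expInt_apply_of_intertwine (L : E →L[ℝ] (Fin n → ℂ)) {A : E →L[ℝ] E}
    {M : Matrix (Fin n) (Fin n) ℂ} (h : ∀ v, L (A v) = M *ᵥ L v) (v : E) (t : ℝ) :
    L (expInt A t v) = expIntegral M t *ᵥ L v :=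
  map_expIntegral_eq_of_map_pow_eq (L ∘L ContinuousLinearMap.apply ℝ E v) (mulVecFlip (L v))
    (fun k => map_pow_apply_of_intertwine L h k v) t

end MatrixExponential

/-! ### The Hermitian matrix of `-i ad Y` -/

section AdjointMatrix

open scoped Matrix.Norms.Operator
open Matrix

variable {E : Type*} [NormedAddCommGroup E] [NormedSpace ℝ E] [FiniteDimensional ℝ E]
  [CompleteSpace E] {K : Type*} [TopologicalSpace K] [ChartedSpace E K] [Group K]
  [LieGroup 𝓘(ℝ, E) ∞ K] {n : ℕ}

/-- The infinitesimal form of the invariance of an inner product. -/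
theorem invariant_brR {B : LinearMap.BilinForm ℝ E}
    (hB : ∀ (k : K) (Y Z : E), B (adE k Y) (adE k Z) = B Y Z) (Y Z V : E) :
    B (brR K Y V) Z + B Y (brR K Z V) = 0 := by
  let Bc : E →L[ℝ] E →L[ℝ] ℝ := LinearMap.toContinuousLinearMap
    (LinearMap.toContinuousLinearMap.toLinearMap ∘ₗ B)
  have hBc : ∀ a b, Bc a b = B a b := fun _ _ => rfl
  have h1 := (hasTDerivAt_adE_one (G := K) Y).prodMk (hasTDerivAt_adE_one (G := K) Z)
  have h2 := Bc.isBoundedBilinearMap.hasFDerivAt (adE (1 : K) Y, adE (1 : K) Z)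
  have h3 : HasTDerivAt 𝓘(ℝ, E) 𝓘(ℝ, ℝ) (fun g : K => Bc (adE g Y) (adE g Z)) 1 _ :=
    HasTDerivAt.comp (I' := 𝓘(ℝ, E).prod 𝓘(ℝ, E)) (g := fun p : E × E => Bc p.1 p.2)
      (f := fun g : K => (adE g Y, adE g Z)) (by
        rw [← modelWithCornersSelf_prod, chartedSpaceSelf_prod]
        exact hasTDerivAt_iff_hasFDerivAt.2 h2) h1
  simp only [hBc, hB] at h3
  have h4 := h3.unique (hasTDerivAt_const _ _)
  have h5 := congrArg (fun T : E →L[ℝ] ℝ => T V) h4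
  simp only [adE_one] at h5
  rw [add_comm]
  exact h5

variable (K) in
/-- The matrix of `-i ad Y` in the basis `X`. -/
def adMatrix (X : Module.Basis (Fin n) ℝ E) (Y : E) : Matrix (Fin n) (Fin n) ℂ :=
  Matrix.of fun j k => Complex.I * (X.coord j (brR K Y (X k)) : ℂ)

theorem coord_eq_inner {B : LinearMap.BilinForm ℝ E} {X : Module.Basis (Fin n) ℝ E}
    (hX : ∀ i j, B (X i) (X j) = if i = j then 1 else 0) (j : Fin n) (V : E) :
    X.coord j V = B (X j) V := by
  have : X.coord j = B (X j) := X.ext fun k => by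
    rw [hX, Module.Basis.coord_apply, Module.Basis.repr_self, Finsupp.single_apply]
    simp only [eq_comm]
  rw [this]

theorem adMatrix_smul (X : Module.Basis (Fin n) ℝ E) (s : ℝ) (Y : E) :
    adMatrix K X (s • Y) = s • adMatrix K X Y := by
  ext j k
  rw [Matrix.smul_apply, adMatrix, adMatrix, of_apply, of_apply, brR_swap, map_smul, ← smul_neg,
    ← brR_swap, map_smul, smul_eq_mul, Complex.ofReal_mul, Complex.real_smul]
  ring

theorem conjMatrix_adMatrix (X : Module.Basis (Fin n) ℝ E) (Y : E) :
    conjMatrix n (adMatrix K X Y) = -adMatrix K X Y := by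
  ext j k
  simp [conjMatrix_apply, adMatrix]

theorem transpose_adMatrix {B : LinearMap.BilinForm ℝ E} (hs : ∀ Y Z, B Y Z = B Z Y)
    (hB : ∀ (k : K) (Y Z : E), B (adE k Y) (adE k Z) = B Y Z) {X : Module.Basis (Fin n) ℝ E}
    (hX : ∀ i j, B (X i) (X j) = if i = j then 1 else 0) (Y : E) :
    (adMatrix K X Y)ᵀ = -adMatrix K X Y := by
  ext j k
  rw [Matrix.neg_apply, adMatrix, transpose_apply, of_apply, of_apply, ← mul_neg,
    ← Complex.ofReal_neg, coord_eq_inner hX, coord_eq_inner hX, brR_swap, map_neg, brR_swap Y (X k), map_neg, neg_neg]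
  have := invariant_brR hB (X j) (X k) Y
  rw [hs] at this
  congr 2
  linarith

theorem isHermitian_of_transpose_of_conj {M : Matrix (Fin n) (Fin n) ℂ} (h : Mᵀ = -M)
    (h' : conjMatrix n M = -M) : M.IsHermitian := by
  rw [Matrix.IsHermitian, conjTranspose, h]
  exact (map_neg (conjMatrix n) M).trans (by rw [h', neg_neg])

theorem sinhc_pos (t : ℝ) : 0 < sinhc t := by
  rw [sinhc]
  split_ifs with h
  · exact one_pos
  · rcases lt_or_gt_of_ne h with h | h
    · exact div_pos_of_neg_of_neg (Real.sinh_neg_iff.2 h) h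
    · exact div_pos (Real.sinh_pos_iff.2 h) h

/-- Unitary diagonalization gives a product of the numbers `∫₀¹ exp (u λ) du > 0`, with `λ = 2 · (λ
/ 2)` to fit the form of the eigenvalue lemma. -/
theorem det_expIntegral_pos {M : Matrix (Fin n) (Fin n) ℂ} (hM : M.IsHermitian) :
    ∃ r : ℝ, 0 < r ∧ (expIntegral M 1).det = r := by
  refine ⟨_, Finset.prod_pos fun i _ => ?_, det_expIntegral_of_mul_eq_mul_diagonal
    (U := hM.eigenvectorUnitary) (d := fun i => hM.eigenvalues i / 2) ?_ ?_⟩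
  · exact mul_pos (Real.exp_pos _) (sinhc_pos _)
  · intro h
    have := congrArg Matrix.det (Unitary.mul_star_self_of_mem hM.eigenvectorUnitary.2)
    rw [det_mul, h, zero_mul, det_one] at this
    exact zero_ne_one this
  · ext i j
    have := congrFun (hM.mulVec_eigenvectorBasis j) i
    rw [Matrix.mul_diagonal]
    simp only [Matrix.mul_apply, Matrix.mulVec, dotProduct, Pi.smul_apply] at this ⊢
    simp only [IsHermitian.eigenvectorUnitary_apply]
    rw [this]
    simp [mul_comm]
    left; ring

end AdjointMatrix

/-! ### The derivative of `ψ_s` and the holomorphic 1-forms -/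

section Polarization

open scoped Matrix.Norms.Operator
open Matrix

variable {E : Type*} [NormedAddCommGroup E] [NormedSpace ℝ E] [FiniteDimensional ℝ E]
  [CompleteSpace E] {K : Type*} [TopologicalSpace K] [ChartedSpace E K] [Group K]
  [LieGroup 𝓘(ℝ, E) ∞ K]
  {EG : Type*} [NormedAddCommGroup EG] [NormedSpace ℂ EG] [FiniteDimensional ℂ EG]
  {G : Type*} [TopologicalSpace G] [T2Space G] [ChartedSpace EG G] [Group G]
  [LieGroup 𝓘(ℂ, EG) ∞ G] {n : ℕ} {ι : K →* G}

theorem IsComplexification.existsUnique (hι : IsComplexification E EG ι) (Z : EG) :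
    ∃! A : E × E, Z = homE E EG ι A.1 + Complex.I • homE E EG ι A.2 :=
  hι.lie_eq Z

/-- The unique decomposition `Lie G = Lie K ⊕ i Lie K`, read in real and imaginary parts of
coefficients, says that the image of a real basis of `Lie K` is a complex basis of `Lie G`. -/
theorem IsComplexification.bijective (hι : IsComplexification E EG ι)
    (X : Module.Basis (Fin n) ℝ E) :
    Function.Bijective (Fintype.linearCombination ℂ fun k => homE E EG ι (X k)) := by
  have key : ∀ a b : Fin n → ℝ, Fintype.linearCombination ℂ (fun k => homE E EG ι (X k))
      (fun k => a k + Complex.I * b k) =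
      homE E EG ι (∑ k, a k • X k) + Complex.I • homE E EG ι (∑ k, b k • X k) := by
    intro a b
    simp only [Fintype.linearCombination_apply, map_sum, map_smul, Finset.smul_sum,
      ← Finset.sum_add_distrib, add_smul, mul_smul, Complex.coe_smul]
  constructor
  · rw [injective_iff_map_eq_zero]
    intro c hc
    have hc' : c = fun k => ((c k).re : ℂ) + Complex.I * ((c k).im : ℂ) := by
      ext k; rw [mul_comm, Complex.re_add_im]
    rw [hc', key] at hc
    have h := (hι.existsUnique (0 : EG)).unique (y₁ := (_, _)) (y₂ := (0, 0)) hc.symm (by simp)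
    have h1 : ∀ a : Fin n → ℝ, ∑ k, a k • X k = 0 → a = 0 := fun a ha =>
      funext (Fintype.linearIndependent_iff.1 X.linearIndependent a ha)
    have h2 := h1 _ (Prod.ext_iff.1 h).1
    have h3 := h1 _ (Prod.ext_iff.1 h).2
    ext k
    exact Complex.ext (congrFun h2 k) (congrFun h3 k)
  · intro Z
    obtain ⟨A, hA, -⟩ := hι.existsUnique Z
    refine ⟨fun k => (X.repr A.1 k : ℂ) + Complex.I * (X.repr A.2 k : ℂ), ?_⟩
    rw [key, X.sum_repr, X.sum_repr]
    exact hA.symm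

/-- The complex coordinates on `Lie G = Lie K ⊕ i Lie K` given by a basis of `Lie K`. -/
def complexCoord (hι : IsComplexification E EG ι) (X : Module.Basis (Fin n) ℝ E) :
    EG ≃ₗ[ℂ] (Fin n → ℂ) :=
  (LinearEquiv.ofBijective _ (hι.bijective X)).symm

theorem complexCoord_homE_basis (hι : IsComplexification E EG ι) (X : Module.Basis (Fin n) ℝ E)
    (k : Fin n) : complexCoord hι X (homE E EG ι (X k)) = Pi.single k 1 := by
  rw [complexCoord, LinearEquiv.symm_apply_eq]
  simp [LinearEquiv.ofBijective_apply]

theorem sum_complexCoord_smul (hι : IsComplexification E EG ι) (X : Module.Basis (Fin n) ℝ E)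
    (v : EG) : ∑ k, complexCoord hι X v k • homE E EG ι (X k) = v :=
  (LinearEquiv.ofBijective _ (hι.bijective X)).apply_symm_apply v

theorem complexCoord_homE (hι : IsComplexification E EG ι) (X : Module.Basis (Fin n) ℝ E)
    (V : E) (j : Fin n) : complexCoord hι X (homE E EG ι V) j = (X.coord j V : ℂ) := by
  conv_lhs => rw [← X.sum_repr V]
  rw [map_sum, map_sum, Finset.sum_apply, Finset.sum_eq_single j]
  · rw [map_smul, ← Complex.coe_smul, map_smul, complexCoord_homE_basis]
    simp
  · intro k _ hk
    rw [map_smul, ← Complex.coe_smul, map_smul, complexCoord_homE_basis]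
    simp [hk.symm]
  · simp

/-- The complex coordinates on `Lie G`, as a continuous real linear map. -/
def realCoord (hι : IsComplexification E EG ι) (X : Module.Basis (Fin n) ℝ E) :
    EG →L[ℝ] (Fin n → ℂ) :=
  (LinearMap.toContinuousLinearMap (complexCoord hι X).toLinearMap).restrictScalars ℝ

theorem realCoord_apply (hι : IsComplexification E EG ι) (X : Module.Basis (Fin n) ℝ E) (v : EG) :
    realCoord hι X v = complexCoord hι X v := rfl

theorem realCoord_smul (hι : IsComplexification E EG ι) (X : Module.Basis (Fin n) ℝ E) (c : ℂ)
    (v : EG) : realCoord hι X (c • v) = c • realCoord hι X v :=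
  map_smul (complexCoord hι X) c v

variable [CompleteSpace EG]

/-- The operator is complex linear, so it suffices to compute it on the basis, where it is `i` times
the image of a bracket in `Lie K`. -/
theorem realCoord_brR [LieGroup 𝓘(ℝ, EG) ∞ G] (hι : IsComplexification E EG ι)
    (X : Module.Basis (Fin n) ℝ E) (Y : E) (v : EG) :
    realCoord hι X (brR G (Complex.I • homE E EG ι Y) v) =
      adMatrix K X Y *ᵥ realCoord hι X v := by
  have hs : MDifferentiable 𝓘(ℝ, E) 𝓘(ℝ, EG) ι := hι.smooth.mdifferentiable (by simp)
  have h1 : ∀ k, brR G (Complex.I • homE E EG ι Y) (homE E EG ι (X k)) =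
      Complex.I • homE E EG ι (brR K Y (X k)) := by
    intro k
    rw [brR_I_smul_left, homE_brR hs]
  have h2 : ∀ (c : ℂ) (w : EG), brR G (Complex.I • homE E EG ι Y) (c • w) =
      c • brR G (Complex.I • homE E EG ι Y) w := by
    intro c w
    rw [← Complex.re_add_im c, add_smul, add_smul, map_add, mul_smul, mul_smul, Complex.coe_smul,
      Complex.coe_smul, Complex.coe_smul, Complex.coe_smul, map_smul, map_smul, brR_I_smul_right]
  simp only [realCoord_apply]
  conv_lhs => rw [← sum_complexCoord_smul hι X v]
  rw [map_sum, map_sum]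
  ext j
  rw [Finset.sum_apply, mulVec, dotProduct]
  refine Finset.sum_congr rfl fun k _ => ?_
  rw [h2, h1, map_smul, map_smul]
  simp only [Pi.smul_apply, smul_eq_mul, complexCoord_homE, adMatrix, of_apply]
  ring

/-- The derivative of `ψ_s`, translated to the Lie algebra from the left, in complex coordinates. -/
theorem exists_dpsi_eq (hι : IsComplexification E EG ι) (X : Module.Basis (Fin n) ℝ E) (s : ℝ)
    (x : K) (Y : E) :
    ∃ D : E × E →L[ℝ] EG, (dpsi (EG := EG) ι s (x, Y) : E × E →L[ℝ] EG) =
        dL (psi (EG := EG) ι s (x, Y)) ∘L D ∧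
      ∀ v : E × E, realCoord hι X (D v) =
        NormedSpace.exp (s • adMatrix K X Y) *ᵥ (fun j => (X.coord j (dLInv x v.1) : ℂ)) +
          (Complex.I • expIntegral (adMatrix K X Y) s) *ᵥ (fun j => (X.coord j v.2 : ℂ)) := by
  have : LieGroup 𝓘(ℝ, EG) ∞ G := lieGroup_real
  have : FiniteDimensional ℝ EG := FiniteDimensional.complexToReal EG
  have hs : MDifferentiable 𝓘(ℝ, E) 𝓘(ℝ, EG) ι := hι.smooth.mdifferentiable (by simp)
  set T : E →L[ℝ] EG := ((Complex.I • ContinuousLinearMap.id ℂ EG : EG →L[ℂ] EG).restrictScalars ℝ)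
    ∘L homE E EG ι ∘L (s • ContinuousLinearMap.id ℝ E) with hT
  have hT' : ∀ Z : E, T Z = Complex.I • homE E EG ι (s • Z) := fun Z => rfl
  have hψ : psi (EG := EG) ι s = fun p : K × E => ι p.1 * expE G (T p.2) := rfl
  have h1 := (hasLeftDerivAt_hom (E := E) (E' := EG) hs x).comp
    (g := fun p : K × E => p.1) (x := (x, Y)) (hasTDerivAt_fst (I := 𝓘(ℝ, E)) (I' := 𝓘(ℝ, E)) (x, Y))
  have h2 := ((hasLeftDerivAt_expE (G := G) (T Y)).comp
    (hasTDerivAt_iff_hasFDerivAt.2 T.hasFDerivAt)).comp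
    (g := fun p : K × E => p.2) (x := (x, Y)) (hasTDerivAt_snd (I := 𝓘(ℝ, E)) (I' := 𝓘(ℝ, E)) (x, Y))
  -- The product rule gives `Ad (exp (-isY))` on the base direction and the derivative of the
  -- exponential map on the fibre direction.
  have h3 := h1.mul h2
  refine ⟨_, HasTDerivAt.tderiv h3, fun v => ?_⟩
  have hM : ∀ w, realCoord hι X (brR G (T Y) w) = (s • adMatrix K X Y) *ᵥ realCoord hι X w := by
    intro w
    rw [hT', realCoord_brR, adMatrix_smul]
  have hξ : ∀ V : E, realCoord hι X (homE E EG ι V) = fun j => (X.coord j V : ℂ) := fun V =>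
    funext fun j => complexCoord_homE hι X V j
  simp only [_root_.add_apply, ContinuousLinearMap.comp_apply, map_add,
    ContinuousLinearMap.coe_fst', ContinuousLinearMap.coe_snd', ← expE_neg, adE_expE_neg]
  rw [map_exp_apply_of_intertwine _ hM, map_expInt_apply_of_intertwine _ hM, hξ, hT',
    ← smul_expIntegral_smul (adMatrix K X Y) s, realCoord_smul, map_smul, map_smul, hξ]
  congr 1
  rw [mulVec_smul, mulVec_smul, smul_mulVec, smul_mulVec]

/-- The linear form `(ξ, Z) ↦ w^j(ξ)` at a point of `K × Lie K`. -/
def baseForm (X : Module.Basis (Fin n) ℝ E) (x : K) (j : Fin n) : E × E →ₗ[ℝ] ℂ :=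
  Complex.ofRealCLM.toLinearMap ∘ₗ X.coord j ∘ₗ (dLInv x).toLinearMap ∘ₗ LinearMap.fst ℝ E E

/-- The linear form `(ξ, Z) ↦ y^j(Z)` on `E × E`. -/
def fiberForm (X : Module.Basis (Fin n) ℝ E) (j : Fin n) : E × E →ₗ[ℝ] ℂ :=
  Complex.ofRealCLM.toLinearMap ∘ₗ X.coord j ∘ₗ LinearMap.snd ℝ E E

theorem baseForm_apply (X : Module.Basis (Fin n) ℝ E) (x : K) (j : Fin n) (v : E × E) :
    baseForm X x j v = (X.coord j (dLInv x v.1) : ℂ) := rfl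

theorem fiberForm_apply (X : Module.Basis (Fin n) ℝ E) (j : Fin n) (v : E × E) :
    fiberForm X j v = (X.coord j v.2 : ℂ) := rfl

/-- `Y` acts on `Lie K` by operators that are skew for some inner product with orthonormal basis
`X`. -/
theorem eq_zero_of_exp_mulVec_add_expIntegral_mulVec {M : Matrix (Fin n) (Fin n) ℂ} (hM : Mᵀ = -M)
    (hM' : conjMatrix n M = -M) {s : ℝ} (hs : s ≠ 0) (a b : Fin n → ℝ)
    (h : NormedSpace.exp (s • M) *ᵥ (fun j => (a j : ℂ)) +
      (Complex.I • expIntegral M s) *ᵥ (fun j => (b j : ℂ)) = 0) : a = 0 ∧ b = 0 := by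
  -- For real `a, b` the equation and its conjugate form a square system whose matrix is the block
  -- matrix with `s' = s`, which is nonsingular.
  have hdet := det_exp_expIntegral_blocks hM hM' s s
  obtain ⟨r, hr, hr'⟩ := det_expIntegral_pos (M := (s + s) • M)
    (isHermitian_of_transpose_of_conj (by rw [transpose_smul, hM, smul_neg])
      (by rw [map_smul, hM', smul_neg]))
  rw [det_expIntegral_smul, hr'] at hdet
  set N := fromBlocks (conjMatrix n (NormedSpace.exp (s • M)))
      (conjMatrix n (Complex.I • expIntegral M s))
      (NormedSpace.exp (s • M)) (Complex.I • expIntegral M s) with hN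
  have hne : N.det ≠ 0 := by
    rw [hdet]
    have : ((s + s : ℝ) : ℂ) ≠ 0 := Complex.ofReal_ne_zero.2 (by
      rw [← two_mul]; exact mul_ne_zero two_ne_zero hs)
    have h2 : (r : ℂ) ≠ 0 := Complex.ofReal_ne_zero.2 hr.ne'
    exact mul_ne_zero (pow_ne_zero _ Complex.I_ne_zero) (mul_ne_zero (pow_ne_zero _ this) h2)
  have hconj : ∀ (A : Matrix (Fin n) (Fin n) ℂ) (c : Fin n → ℝ) (j : Fin n),
      (conjMatrix n A *ᵥ fun j => (c j : ℂ)) j = starRingEnd ℂ ((A *ᵥ fun j => (c j : ℂ)) j) := by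
    intro A c j
    simp [conjMatrix_apply, mulVec, dotProduct]
  have h0 : N *ᵥ Sum.elim (fun j => (a j : ℂ)) (fun j => (b j : ℂ)) = 0 := by
    rw [hN, fromBlocks_mulVec]
    ext (j | j)
    · have := congrArg (starRingEnd ℂ) (congrFun h j)
      simpa [hconj] using this
    · exact congrFun h j
  have h1 := eq_zero_of_mulVec_eq_zero hne h0
  exact ⟨funext fun j => Complex.ofReal_eq_zero.1 (congrFun h1 (Sum.inl j)),
    funext fun j => Complex.ofReal_eq_zero.1 (congrFun h1 (Sum.inr j))⟩

/-- Let `C` be the derivative of `ψ_s`, left-translated and in complex coordinates. Then `C ∘ J_s =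
i C` and `C X̃_k` is the `k`-th unit vector, which forces `w̃^j = Re C_j`; thus `η̃^j = Re C_j - i
Re (i C_j) = C_j`. -/
theorem tildeEta_apply {B : LinearMap.BilinForm ℝ E} (hBs : ∀ Y Z, B Y Z = B Z Y)
    (hB : ∀ (k : K) (Y Z : E), B (adE k Y) (adE k Z) = B Y Z)
    (hι : IsComplexification E EG ι) (X : Module.Basis (Fin n) ℝ E)
    (hX : ∀ i j, B (X i) (X j) = if i = j then 1 else 0) {s : ℝ} (hs : s ≠ 0)
    (x : K) (Y : E) (j : Fin n) (v : E × E) :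
    (tildeEta EG ι (show Module.Basis (Fin n) ℝ (GroupLieAlgebra 𝓘(ℝ, E) K) from X) s j (x, Y) :
        E × E →ₗ[ℝ] ℂ) v =
      ∑ k, NormedSpace.exp (s • adMatrix K X Y) j k * baseForm X x k v +
        ∑ k, (Complex.I • expIntegral (adMatrix K X Y) s) j k * fiberForm X k v := by
  have : LieGroup 𝓘(ℝ, EG) ∞ G := lieGroup_real
  have : FiniteDimensional ℝ EG := FiniteDimensional.complexToReal EG
  obtain ⟨D, hD, hDv⟩ := exists_dpsi_eq hι X s x Y
  set g := psi (EG := EG) ι s (x, Y) with hg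
  set T : E × E →L[ℝ] EG := dpsi (EG := EG) ι s (x, Y) with hT
  have hTv : ∀ v, T v = dL g (D v) := fun v => by rw [hD]; rfl
  -- `ContinuousLinearMap.inverse` is zero on non-invertible maps, so `J` and `tildeX` have their
  -- meaning only once the derivative is known to be invertible.
  have hinj : Function.Injective T := by
    rw [injective_iff_map_eq_zero]
    intro v hv
    rw [hTv, ← map_zero (dL g)] at hv
    have h1 := hDv v
    rw [dL_injective g hv, map_zero] at h1
    obtain ⟨ha, hb⟩ := eq_zero_of_exp_mulVec_add_expIntegral_mulVec (transpose_adMatrix hBs hB hX Y)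
      (conjMatrix_adMatrix X Y) hs (fun j => X.coord j (dLInv x v.1)) (fun j => X.coord j v.2)
      h1.symm
    have h2 : dLInv x v.1 = 0 := X.ext_elem fun j => by simpa using congrFun ha j
    have h3 : v.2 = 0 := X.ext_elem fun j => by simpa using congrFun hb j
    have h4 : v.1 = 0 := by rw [← dL_dLInv x v.1, h2, map_zero]
    exact Prod.ext h4 h3
  have hdim : Module.finrank ℝ (E × E) = Module.finrank ℝ EG := by
    rw [Module.finrank_prod, Module.finrank_eq_card_basis X, finrank_real_of_complex,
      LinearEquiv.finrank_eq (complexCoord hι X)]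
    simp [two_mul]
  let e : (E × E) ≃L[ℝ] EG :=
    (LinearEquiv.ofInjectiveOfFinrankEq T.toLinearMap hinj hdim).toContinuousLinearEquiv
  have he : T = (e : E × E →L[ℝ] EG) := by ext v <;> rfl
  have hTinv : T.inverse = (e.symm : EG →L[ℝ] E × E) := by
    rw [he]; exact ContinuousLinearMap.inverse_equiv e
  have hTT : ∀ w, T (T.inverse w) = w := by
    intro w
    rw [hTinv, he]
    exact e.apply_symm_apply w
  let C : E × E →ₗ[ℝ] (Fin n → ℂ) := (realCoord hι X ∘L D).toLinearMap
  have hC : ∀ v, C v = realCoord hι X (dLInv g (T v)) := fun v => by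
    rw [hTv, dLInv_dL]; rfl
  have hCinj : Function.Injective C := by
    intro v w hvw
    have h1 : D v = D w := (complexCoord hι X).injective hvw
    exact hinj (by rw [hTv, hTv, h1])
  let Jv : E × E →ₗ[ℝ] E × E := (J EG ι s (x, Y)).toLinearMap
  have hJ : ∀ v, C (Jv v) = Complex.I • C v := by
    intro v
    have h1 : T (Jv v) = Complex.I • T v := hTT _
    rw [hC, h1, hTv, ← dL_I_smul, dLInv_dL, realCoord_smul]
    rfl
  let tX : Fin n → E × E := fun k => tildeX EG ι s
    (show GroupLieAlgebra 𝓘(ℝ, E) K from X k) (x, Y)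
  have htX : ∀ k, C (tX k) = Pi.single k 1 := by
    intro k
    have h1 : T (tX k) = dL g (homE E EG ι (X k)) := hTT _
    rw [hC, h1, dLInv_dL, realCoord_apply, complexCoord_homE_basis]
  -- The vectors `X̃_k` and `J_s X̃_k` span, so the defining values of `w̃^j` determine it.
  have hspan : ∀ v, v = ∑ k, ((C v k).re • tX k + (C v k).im • Jv (tX k)) := by
    intro v
    apply hCinj
    ext j
    simp only [map_sum, map_add, map_smul, hJ, htX, Finset.sum_apply, Pi.add_apply, Pi.smul_apply]
    rw [Finset.sum_eq_single j]
    · simp only [Pi.single_eq_same, Complex.real_smul, smul_eq_mul, mul_one]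
      rw [Complex.re_add_im]
    · intro k _ hk
      simp [hk.symm]
    · simp
  let W : E × E →ₗ[ℝ] ℝ := tildeW EG ι
    (show Module.Basis (Fin n) ℝ (GroupLieAlgebra 𝓘(ℝ, E) K) from X) s j (x, Y)
  -- The form `Re C_j` shows that the choice in `tildeW` is not vacuous.
  have hW : ∀ k, W (tX k) = (if j = k then 1 else 0) ∧ W (Jv (tX k)) = 0 := by
    refine Classical.epsilon_spec (p := fun w : E × E →ₗ[ℝ] ℝ => ∀ k : Fin n,
      w (tX k) = (if j = k then 1 else 0) ∧ w (Jv (tX k)) = 0)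
      ⟨Complex.reLm ∘ₗ LinearMap.proj j ∘ₗ C, fun k => ?_⟩
    simp only [LinearMap.comp_apply, LinearMap.proj_apply, hJ, htX, Complex.reLm_coe,
      Pi.single_apply, Pi.smul_apply]
    constructor <;> split_ifs <;> simp
  have hWv : ∀ v, W v = (C v j).re := by
    intro v
    conv_lhs => rw [hspan v]
    simp only [map_sum, map_add, map_smul, hW]
    simp
  have hfin : (tildeEta EG ι
      (show Module.Basis (Fin n) ℝ (GroupLieAlgebra 𝓘(ℝ, E) K) from X) s j (x, Y) :
        E × E →ₗ[ℝ] ℂ) v = (W v : ℂ) - Complex.I * (W (Jv v) : ℂ) := rfl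
  rw [hfin, hWv, hWv, hJ]
  have h5 : C v j = _ := congrFun (hDv v) j
  refine Eq.trans ?_ h5
  apply Complex.ext <;> simp

end Polarization

/-! ### The wedge product of the holomorphic volume forms -/

section OmegaWedge

open scoped Matrix.Norms.Operator
open Matrix

theorem wedgeOneForms_append_blocks {V : Type*} [AddCommGroup V] [Module ℝ V] {n : ℕ}
    (A B C D : Matrix (Fin n) (Fin n) ℂ) (a b ζ ζ' : Fin n → V →ₗ[ℝ] ℂ)
    (h : ∀ i v, ζ i v = ∑ k, A i k * a k v + ∑ k, B i k * b k v)
    (h' : ∀ i v, ζ' i v = ∑ k, C i k * a k v + ∑ k, D i k * b k v) :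
    wedgeOneForms (Fin.append ζ ζ') =
      (fromBlocks A B C D).det • wedgeOneForms (Fin.append a b) := by
  rw [← det_reindex_self finSumFinEquiv]
  refine wedgeOneForms_matrix _ _ _ fun i v => ?_
  rw [Fin.sum_univ_add]
  refine Fin.addCases (fun i => ?_) (fun i => ?_) i
  · simp only [Fin.append_left, Fin.append_right, h, reindex_apply, submatrix_apply,
      finSumFinEquiv_symm_apply_castAdd, finSumFinEquiv_symm_apply_natAdd, fromBlocks_apply₁₁,
      fromBlocks_apply₁₂]
  · simp only [Fin.append_left, Fin.append_right, h', reindex_apply, submatrix_apply,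
      finSumFinEquiv_symm_apply_castAdd, finSumFinEquiv_symm_apply_natAdd, fromBlocks_apply₂₁,
      fromBlocks_apply₂₂]

variable {E : Type*} [NormedAddCommGroup E] [NormedSpace ℝ E] [FiniteDimensional ℝ E]
  [CompleteSpace E] {K : Type*} [TopologicalSpace K] [ChartedSpace E K] [Group K]
  [LieGroup 𝓘(ℝ, E) ∞ K]
  {EG : Type*} [NormedAddCommGroup EG] [NormedSpace ℂ EG] [FiniteDimensional ℂ EG]
  {G : Type*} [TopologicalSpace G] [T2Space G] [ChartedSpace EG G] [Group G]
  [LieGroup 𝓘(ℂ, EG) ∞ G] {n : ℕ} {ι : K →* G} [CompleteSpace EG]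

/-- Both families of 1-forms are expressed in the real coframe `w, dy`, so the block determinant is
the coefficient; `iⁿ (s + s')ⁿ` is then rewritten as `((s + s') / 2)ⁿ (2i)ⁿ`. -/
theorem wedge_conj_Omega {B : LinearMap.BilinForm ℝ E} (hBs : ∀ Y Z, B Y Z = B Z Y)
    (hB : ∀ (k : K) (Y Z : E), B (adE k Y) (adE k Z) = B Y Z)
    (hι : IsComplexification E EG ι) (X : Module.Basis (Fin n) ℝ E)
    (hX : ∀ i j, B (X i) (X j) = if i = j then 1 else 0) {s s' : ℝ} (hs : s ≠ 0) (hs' : s' ≠ 0)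
    (x : K) (Y : E) :
    (wedge (V := E × E)
      (conjForm (Omega EG ι (show Module.Basis (Fin n) ℝ (GroupLieAlgebra 𝓘(ℝ, E) K) from X) s
        (x, Y)))
      (Omega EG ι (show Module.Basis (Fin n) ℝ (GroupLieAlgebra 𝓘(ℝ, E) K) from X) s' (x, Y))) =
      ((((s + s') / 2 : ℝ) : ℂ) ^ n * (expIntegral ((s + s') • adMatrix K X Y) 1).det *
        (2 * Complex.I) ^ n) • wedgeOneForms (Fin.append (baseForm X x) (fiberForm X)) := by
  let ζ (s : ℝ) (j : Fin n) : E × E →ₗ[ℝ] ℂ := tildeEta EG ι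
    (show Module.Basis (Fin n) ℝ (GroupLieAlgebra 𝓘(ℝ, E) K) from X) s j (x, Y)
  change wedge (conjForm (wedgeOneForms (ζ s))) (wedgeOneForms (ζ s')) = _
  rw [conjForm_wedgeOneForms, wedge_wedgeOneForms]
  refine (wedgeOneForms_append_blocks (V := E × E)
    (conjMatrix n (NormedSpace.exp (s • adMatrix K X Y)))
    (conjMatrix n (Complex.I • expIntegral (adMatrix K X Y) s))
    (NormedSpace.exp (s' • adMatrix K X Y)) (Complex.I • expIntegral (adMatrix K X Y) s')
    (baseForm X x) (fiberForm X) _ _ (fun i v => ?_)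
    (fun i v => tildeEta_apply hBs hB hι X hX hs' x Y i v)).trans ?_
  · refine (congrArg (starRingEnd ℂ) (tildeEta_apply hBs hB hι X hX hs x Y i v)).trans ?_
    simp only [map_add, map_sum, map_mul, conjMatrix_apply, map_apply, baseForm_apply,
      fiberForm_apply, Complex.conj_ofReal]
  · rw [det_exp_expIntegral_blocks (transpose_adMatrix hBs hB hX Y) (conjMatrix_adMatrix X Y),
      det_expIntegral_smul]
    congr 1
    push_cast
    rw [div_pow, mul_pow]
    field_simp

end OmegaWedge

/-! ### The Maurer-Cartan form in a chart -/

section MaurerCartan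

variable {E : Type*} [NormedAddCommGroup E] [NormedSpace ℝ E]
  {K : Type*} [TopologicalSpace K] [ChartedSpace E K] [Group K] [LieGroup 𝓘(ℝ, E) ∞ K]

/-- The map `(u, w) ↦ u⁻¹ w` in the charts at `x` and `1`. -/
def chtDiv (x : K) (p : E × E) : E :=
  cht E (1 : K) (((cht E x).symm p.1)⁻¹ * (cht E x).symm p.2)

/-- The Maurer-Cartan form in the chart at `x`. -/
def chtMaurerCartan (x : K) (u : E) : E →L[ℝ] E :=
  dLInv ((cht E x).symm u) ∘L tderiv 𝓘(ℝ, E) 𝓘(ℝ, E) (cht E x).symm u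

theorem contDiffAt_chtDiv (x : K) : ContDiffAt ℝ ∞ (chtDiv x) (cht E x x, cht E x x) := by
  have h1 : ContMDiffAt (𝓘(ℝ, E).prod 𝓘(ℝ, E)) 𝓘(ℝ, E) ∞ (fun p : E × E => (cht E x).symm p.1)
      (cht E x x, cht E x x) :=
    ContMDiffAt.comp (I' := 𝓘(ℝ, E)) (g := (cht E x).symm) _
      (cht_symm_contMDiffAt (cht_self_mem x)) contMDiffAt_fst
  have h2 : ContMDiffAt (𝓘(ℝ, E).prod 𝓘(ℝ, E)) 𝓘(ℝ, E) ∞ (fun p : E × E => (cht E x).symm p.2)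
      (cht E x x, cht E x x) :=
    ContMDiffAt.comp (I' := 𝓘(ℝ, E)) (g := (cht E x).symm) _
      (cht_symm_contMDiffAt (cht_self_mem x)) contMDiffAt_snd
  have h : ContMDiffAt (𝓘(ℝ, E).prod 𝓘(ℝ, E)) 𝓘(ℝ, E) ∞ (chtDiv x) (cht E x x, cht E x x) :=
    ContMDiffAt.comp (I' := 𝓘(ℝ, E)) _ (cht_contMDiffAt (by simp)) (h1.inv.mul h2)
  rw [← contMDiffAt_iff_contDiffAt, modelWithCornersSelf_prod, ← chartedSpaceSelf_prod]
  exact h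

theorem chtMaurerCartan_self (x : K) : chtMaurerCartan x (cht E x x) = dLInv x := by
  rw [chtMaurerCartan, tderiv_cht_symm_self, cht_symm_self, ContinuousLinearMap.comp_id]

/-- Near the base point it is the partial derivative of `(u, w) ↦ u⁻¹ w` in `w` on the diagonal; the
product there is `1`, where the chart has derivative the identity. -/
theorem differentiableAt_chtMaurerCartan (x : K) :
    DifferentiableAt ℝ (chtMaurerCartan (E := E) x) (cht E x x) := by
  have h0 : Filter.Tendsto (fun u : E => (u, u)) (nhds (cht E x x))
    (nhds (cht E x x, cht E x x)) := (continuous_id.prodMk continuous_id).tendsto _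
  have h00 : ∀ᶠ p in nhds ((cht E x x, cht E x x) : E × E), DifferentiableAt ℝ (chtDiv x) p :=
    ((contDiffAt_chtDiv x).of_le (m := 1) (by simp)).eventually (by simp) |>.mono
      fun _ h => h.differentiableAt (by simp)
  have h1 : ContDiffAt ℝ ∞ (fun u => fderiv ℝ (chtDiv x) (u, u) ∘L
      ContinuousLinearMap.inr ℝ E E) (cht E x x) :=
    (ContDiffAt.comp (g := fderiv ℝ (chtDiv x)) (f := fun u => (u, u)) _
      ((contDiffAt_chtDiv x).fderiv_right (m := ∞) (by simp))
      (contDiffAt_id.prodMk contDiffAt_id)).clm_comp contDiffAt_const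
  refine (h1.differentiableAt (by simp)).congr_of_eventuallyEq ?_
  filter_upwards [h0.eventually h00, cht_target_mem_nhds (E := E) x] with u hu hu'
  have h1 := HasFDerivAt.comp (f := fun w : E => (u, w)) u hu.hasFDerivAt
    (hasFDerivAt_prodMk_right _ _)
  have h2 : HasTDerivAt 𝓘(ℝ, E) 𝓘(ℝ, E) (fun y : K => ((cht E x).symm u)⁻¹ * y)
      ((cht E x).symm u) (dLInv ((cht E x).symm u)) :=
    (mdifferentiable_mul_left _ _).hasTDerivAt
  have h3 := h2.comp (cht_symm_hasTDerivAt hu')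
  have h4 := HasTDerivAt.comp (g := cht E (1 : K)) (D' := ContinuousLinearMap.id ℝ E) (by
      rw [inv_mul_cancel, ← tderiv_cht_self (1 : K)]
      exact cht_hasTDerivAt (mem_extChartAt_source _)) h3
  rw [ContinuousLinearMap.id_comp, hasTDerivAt_iff_hasFDerivAt] at h4
  exact h4.unique h1

end MaurerCartan

/-! ### The canonical symplectic form at a point -/

section SymplecticForm

theorem extDeriv_ofSubsingleton_apply {V : Type*} [NormedAddCommGroup V] [NormedSpace ℝ V]
    [FiniteDimensional ℝ V] {b : V → V →L[ℝ] ℝ} {z : V} (hb : DifferentiableAt ℝ b z)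
    (v : Fin 2 → V) :
    extDeriv (fun z => ContinuousAlternatingMap.ofSubsingleton ℝ V ℝ (0 : Fin 1) (b z)) z v =
      fderiv ℝ b z (v 0) (v 1) - fderiv ℝ b z (v 1) (v 0) := by
  let L : (V →L[ℝ] ℝ) →L[ℝ] V [⋀^Fin 1]→L[ℝ] ℝ := LinearMap.toContinuousLinearMap
    { toFun := ContinuousAlternatingMap.ofSubsingleton ℝ V ℝ (0 : Fin 1)
      map_add' := fun _ _ => rfl
      map_smul' := fun _ _ => rfl }
  have hL : DifferentiableAt ℝ
      (fun z => ContinuousAlternatingMap.ofSubsingleton ℝ V ℝ (0 : Fin 1) (b z)) z :=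
    L.differentiableAt.comp z hb
  rw [extDeriv_apply hL, Fin.sum_univ_two]
  have h : ∀ w w', fderiv ℝ (fun z => b z w) z w' = fderiv ℝ b z w' w := fun w w' => by
    rw [fderiv_clm_apply hb (differentiableAt_const w)]
    simp
  simp only [ContinuousAlternatingMap.ofSubsingleton_apply_apply]
  rw [h, h]
  simp [Fin.removeNth, sub_eq_add_neg]

variable {E : Type*} [NormedAddCommGroup E] [NormedSpace ℝ E] [FiniteDimensional ℝ E]
  {K : Type*} [TopologicalSpace K] [ChartedSpace E K] [Group K] [LieGroup 𝓘(ℝ, E) ∞ K] {n : ℕ}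

/-- The inner product with orthonormal basis `X`. -/
def coordInner (X : Module.Basis (Fin n) ℝ E) : E →L[ℝ] E →L[ℝ] ℝ :=
  ∑ i, (LinearMap.toContinuousLinearMap (X.coord i)).smulRight
    (LinearMap.toContinuousLinearMap (X.coord i))

theorem coordInner_apply (X : Module.Basis (Fin n) ℝ E) (Y Z : E) :
    coordInner X Y Z = ∑ i, X.coord i Y * X.coord i Z := by
  simp [coordInner]

theorem theta_apply (X : Module.Basis (Fin n) ℝ E) (p : K × E) (v : E × E) :
    (theta (show Module.Basis (Fin n) ℝ (GroupLieAlgebra 𝓘(ℝ, E) K) from X) p : E × E →L[ℝ] ℝ) v =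
      coordInner X p.2 (dLInv p.1 v.1) := by
  rw [coordInner_apply]
  have h : (theta (show Module.Basis (Fin n) ℝ (GroupLieAlgebra 𝓘(ℝ, E) K) from X) p :
      E × E →L[ℝ] ℝ) = ∑ i, X.coord i p.2 • (((LinearMap.toContinuousLinearMap (X.coord i)) ∘L
        dLInv p.1) ∘L ContinuousLinearMap.fst ℝ E E) := rfl
  have h' : ∀ (f : Fin n → E × E →L[ℝ] ℝ), (∑ i, f i) v = ∑ i, f i v := fun f => by simp
  rw [h]
  exact h' _

/-- The form `θ` in a chart. -/
def chtTheta (X : Module.Basis (Fin n) ℝ E) (x : K) (z : E × E) : E × E →L[ℝ] ℝ :=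
  coordInner X z.2 ∘L chtMaurerCartan x z.1 ∘L ContinuousLinearMap.fst ℝ E E

theorem hasFDerivAt_chtTheta (X : Module.Basis (Fin n) ℝ E) (x : K) (Y : E) :
    ∃ T : E × E →L[ℝ] E × E →L[ℝ] ℝ, HasFDerivAt (chtTheta X x) T (cht E x x, Y) ∧ ∀ v w, T v w =
      coordInner X v.2 (dLInv x w.1) +
        coordInner X Y (fderiv ℝ (chtMaurerCartan x) (cht E x x) v.1 w.1) := by
  have h1 : HasFDerivAt (fun z : E × E => coordInner X z.2)
      (coordInner X ∘L ContinuousLinearMap.snd ℝ E E) (cht E x x, Y) :=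
    (coordInner X).hasFDerivAt.comp _ hasFDerivAt_snd
  have h2 := HasFDerivAt.comp (g := chtMaurerCartan x) (f := Prod.fst) (cht E x x, Y)
    (differentiableAt_chtMaurerCartan (E := E) x).hasFDerivAt hasFDerivAt_fst
  have h3 := h1.clm_comp (h2.clm_comp (hasFDerivAt_const (ContinuousLinearMap.fst ℝ E E) _))
  refine ⟨_, h3, fun v w => ?_⟩
  simpa [add_comm] using congrArg (fun T => coordInner X v.2 (T w.1)) (chtMaurerCartan_self x)

theorem extChartAt_prod_model (x : K) (Y : E) :
    extChartAt (𝓘(ℝ, E).prod 𝓘(ℝ, E)) (x, Y) = (cht E x).prod (PartialEquiv.refl E) := by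
  rw [extChartAt_prod, extChartAt_model_space_eq_id]

theorem hasTDerivAt_chart_symm (x : K) (Y : E) {z : E × E} (hz : z.1 ∈ (cht E x).target) :
    HasTDerivAt 𝓘(ℝ, E × E) (𝓘(ℝ, E).prod 𝓘(ℝ, E))
      (extChartAt (𝓘(ℝ, E).prod 𝓘(ℝ, E)) (x, Y)).symm z
      ((tderiv 𝓘(ℝ, E) 𝓘(ℝ, E) (cht E x).symm z.1 ∘L ContinuousLinearMap.fst ℝ E E).prod
        (ContinuousLinearMap.snd ℝ E E)) := by
  rw [extChartAt_prod_model]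
  exact (HasTDerivAt.comp (I := 𝓘(ℝ, E × E)) (f := Prod.fst) (x := z)
    (cht_symm_hasTDerivAt hz) (hasTDerivAt_iff_hasFDerivAt.2 hasFDerivAt_fst)).prodMk
      (hasTDerivAt_iff_hasFDerivAt.2 hasFDerivAt_snd)

theorem tderiv_chart_self (x : K) (Y : E) :
    tderiv (𝓘(ℝ, E).prod 𝓘(ℝ, E)) 𝓘(ℝ, E × E)
      (extChartAt (𝓘(ℝ, E).prod 𝓘(ℝ, E)) (x, Y)) (x, Y) = ContinuousLinearMap.id ℝ (E × E) := by
  have : IsManifold (𝓘(ℝ, E).prod 𝓘(ℝ, E)) 1 (K × E) := by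
    have : IsManifold 𝓘(ℝ, E) 1 K := IsManifold.of_le (n := ∞) (by simp)
    infer_instance
  exact mfderiv_extChartAt_self

/-- The form `c` collects the terms `y dw`. Only its skewness and its dependence on base components
alone matter, so the Maurer-Cartan equation is not needed. -/
theorem omega_apply (X : Module.Basis (Fin n) ℝ E) (x : K) (Y : E) :
    ∃ c : E →ₗ[ℝ] E →ₗ[ℝ] ℝ, (∀ a b, c a b = - c b a) ∧ ∀ v : Fin 2 → E × E,
    (omega (show Module.Basis (Fin n) ℝ (GroupLieAlgebra 𝓘(ℝ, E) K) from X) (x, Y) :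
      (E × E) [⋀^Fin 2]→L[ℝ] ℝ) v =
      coordInner X (v 1).2 (dLInv x (v 0).1) - coordInner X (v 0).2 (dLInv x (v 1).1) +
        c (v 0).1 (v 1).1 := by
  set A := fderiv ℝ (chtMaurerCartan (E := E) x) (cht E x x) with hA
  refine ⟨LinearMap.mk₂ ℝ (fun a b => coordInner X Y (A b a) - coordInner X Y (A a b))
    ?_ ?_ ?_ ?_, ?_, fun v => ?_⟩
  · intros; simp; ring
  · intros; simp; ring
  · intros; simp; ring
  · intros; simp; ring
  · intros; simp
  · obtain ⟨T, hT, hTv⟩ := hasFDerivAt_chtTheta X x Y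
    have h1 : extChartAt (𝓘(ℝ, E).prod 𝓘(ℝ, E)) (x, Y) (x, Y) = (cht E x x, Y) := by
      rw [extChartAt_prod_model]; rfl
    have h2 : (fun z : E × E => ((ContinuousAlternatingMap.ofSubsingleton ℝ (E × E) ℝ (0 : Fin 1)
        (theta (show Module.Basis (Fin n) ℝ (GroupLieAlgebra 𝓘(ℝ, E) K) from X)
        ((extChartAt (𝓘(ℝ, E).prod 𝓘(ℝ, E)) (x, Y)).symm z) : E × E →L[ℝ] ℝ)).compContinuousLinearMap
        (tderiv 𝓘(ℝ, E × E) (𝓘(ℝ, E).prod 𝓘(ℝ, E))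
          (extChartAt (𝓘(ℝ, E).prod 𝓘(ℝ, E)) (x, Y)).symm z) : (E × E) [⋀^Fin 1]→L[ℝ] ℝ))
        =ᶠ[nhds (cht E x x, Y)] fun z => ContinuousAlternatingMap.ofSubsingleton ℝ (E × E) ℝ
          (0 : Fin 1) (chtTheta X x z) := by
      have : ∀ᶠ z in nhds (cht E x x, Y), z.1 ∈ (cht E x).target :=
        continuous_fst.continuousAt.eventually (cht_target_mem_nhds x)
      filter_upwards [this] with z hz
      rw [(hasTDerivAt_chart_symm x Y hz).tderiv]
      ext w
      have h4 : (extChartAt (𝓘(ℝ, E).prod 𝓘(ℝ, E)) (x, Y)).symm z = ((cht E x).symm z.1, z.2) := by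
        rw [extChartAt_prod_model]; rfl
      rw [h4]
      exact theta_apply X ((cht E x).symm z.1, z.2) _
    have h3 : (omega (show Module.Basis (Fin n) ℝ (GroupLieAlgebra 𝓘(ℝ, E) K) from X) (x, Y) :
      (E × E) [⋀^Fin 2]→L[ℝ] ℝ) = -(ContinuousAlternatingMap.compContinuousLinearMap
        (extDeriv (fun z : E × E => ((ContinuousAlternatingMap.ofSubsingleton ℝ (E × E) ℝ (0 : Fin 1)
        (theta (show Module.Basis (Fin n) ℝ (GroupLieAlgebra 𝓘(ℝ, E) K) from X)
        ((extChartAt (𝓘(ℝ, E).prod 𝓘(ℝ, E)) (x, Y)).symm z) : E × E →L[ℝ] ℝ)).compContinuousLinearMap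
        (tderiv 𝓘(ℝ, E × E) (𝓘(ℝ, E).prod 𝓘(ℝ, E))
          (extChartAt (𝓘(ℝ, E).prod 𝓘(ℝ, E)) (x, Y)).symm z) : (E × E) [⋀^Fin 1]→L[ℝ] ℝ))
          (extChartAt (𝓘(ℝ, E).prod 𝓘(ℝ, E)) (x, Y) (x, Y)))
        (tderiv (𝓘(ℝ, E).prod 𝓘(ℝ, E)) 𝓘(ℝ, E × E)
          (extChartAt (𝓘(ℝ, E).prod 𝓘(ℝ, E)) (x, Y)) (x, Y))) := rfl
    rw [h3, tderiv_chart_self, h1, h2.extDeriv_eq]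
    have h5 := extDeriv_ofSubsingleton_apply hT.differentiableAt v
    rw [hT.fderiv, hTv, hTv] at h5
    refine (congrArg Neg.neg h5).trans ?_
    rw [LinearMap.mk₂_apply, hA]
    ring

end SymplecticForm

/-! ### The Liouville form in the coframe `w, dy` -/

section Liouville

theorem wedgeOneForms_pair_apply {V : Type*} [AddCommGroup V] [Module ℝ V] (a b : V →ₗ[ℝ] ℂ)
    (v : Fin 2 → V) : wedgeOneForms ![a, b] v = a (v 0) * b (v 1) - a (v 1) * b (v 0) := by
  rw [wedgeOneForms_apply, Matrix.det_fin_two]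
  simp

theorem wedgeOneForms_domDomCongr {V : Type*} [AddCommGroup V] [Module ℝ V] {m n : ℕ} (h : m = n)
    (f : Fin m → V →ₗ[ℝ] ℂ) : (wedgeOneForms f).domDomCongr (finCongr h) =
      wedgeOneForms fun i => f (Fin.cast h.symm i) := by
  subst h
  rfl

theorem wedgePow_sum_pairs {V : Type*} [AddCommGroup V] [Module ℝ V] {n : ℕ}
    (a b : Fin n → V →ₗ[ℝ] ℂ) :
    (wedgePow (∑ j, wedgeOneForms ![a j, b j]) n).domDomCongr (finCongr (two_mul n)) =
      ((n.factorial : ℂ) * (-1) ^ (n * (n - 1) / 2)) • wedgeOneForms (Fin.append a b) := by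
  let ext' (c : Fin n → V →ₗ[ℝ] ℂ) (i : ℕ) : V →ₗ[ℝ] ℂ := if h : i < n then c ⟨i, h⟩ else 0
  have hext : ∀ (c : Fin n → V →ₗ[ℝ] ℂ) (j : Fin n), ext' c j = c j := fun c j => by simp [ext']
  have h1 := wedgePow_eq (n := n) (ext' a) (ext' b)
  simp only [hext] at h1
  have h2 : (wedgeOneForms fun i : Fin (2 * n) => concat n (ext' a) (ext' b) i).domDomCongr
      (finCongr (two_mul n)) = wedgeOneForms (Fin.append a b) := by
    rw [wedgeOneForms_domDomCongr]
    congr 1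
    ext1 i
    refine Fin.addCases (fun i => ?_) (fun i => ?_) i
    · simp [concat, hext]
    · rw [Fin.append_right]
      simp [concat, ext']
  rw [h1, AlternatingMap.domDomCongr_smul, h2, ← Int.cast_smul_eq_zsmul ℂ]
  push_cast
  rfl

variable {E : Type*} [NormedAddCommGroup E] [NormedSpace ℝ E] [FiniteDimensional ℝ E]
  {K : Type*} [TopologicalSpace K] [ChartedSpace E K] [Group K] [LieGroup 𝓘(ℝ, E) ∞ K] {n : ℕ}

/-- Expand `c` in the left-invariant frame. The coefficients carry a factor `1/2` because
antisymmetrizing counts each skew entry twice. -/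
theorem skew_eq_sum_pairs (X : Module.Basis (Fin n) ℝ E) (x : K) (c : E →ₗ[ℝ] E →ₗ[ℝ] ℝ)
    (hc : ∀ a b, c a b = -c b a) :
    ∃ C : Matrix (Fin n) (Fin n) ℂ, ∀ v w : E × E, (c v.1 w.1 : ℂ) =
      ∑ j, (baseForm X x j v * ∑ k, C j k * baseForm X x k w -
        baseForm X x j w * ∑ k, C j k * baseForm X x k v) := by
  refine ⟨Matrix.of fun j k => ((c (dL x (X j)) (dL x (X k)) / 2 : ℝ) : ℂ), fun v w => ?_⟩
  have h1 : ∀ u : E, ∑ j, X.coord j (dLInv x u) • dL x (X j) = u := fun u => by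
    conv_rhs => rw [← dL_dLInv x u, ← X.sum_repr (dLInv x u), map_sum]
    simp only [map_smul, Module.Basis.coord_apply]
  have h2 : ∀ a b : E, c a b = ∑ j, X.coord j (dLInv x a) * ∑ k,
      c (dL x (X j)) (dL x (X k)) * X.coord k (dLInv x b) := fun a b => by
    conv_lhs => rw [← h1 a, ← h1 b]
    simp only [map_sum, LinearMap.sum_apply, map_smul, LinearMap.smul_apply, smul_eq_mul,
      Finset.mul_sum]
    rw [Finset.sum_comm]
    refine Finset.sum_congr rfl fun j _ => Finset.sum_congr rfl fun k _ => by ring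
  have h3 : c v.1 w.1 = c v.1 w.1 / 2 - c w.1 v.1 / 2 := by rw [hc w.1]; ring
  rw [h3, Finset.sum_sub_distrib, Complex.ofReal_sub]
  congr 1
  · rw [h2, Complex.ofReal_div, Complex.ofReal_sum, Finset.sum_div]
    refine Finset.sum_congr rfl fun j _ => ?_
    simp only [baseForm_apply, Matrix.of_apply, Complex.ofReal_mul, Complex.ofReal_sum,
      Finset.mul_sum, Finset.sum_div, Complex.ofReal_div]
    refine Finset.sum_congr rfl fun k _ => by push_cast; ring
  · rw [h2, Complex.ofReal_div, Complex.ofReal_sum, Finset.sum_div]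
    refine Finset.sum_congr rfl fun j _ => ?_
    simp only [baseForm_apply, Matrix.of_apply, Complex.ofReal_mul, Complex.ofReal_sum,
      Finset.mul_sum, Finset.sum_div, Complex.ofReal_div]
    refine Finset.sum_congr rfl fun k _ => by push_cast; ring

/-- The base terms are absorbed by `ρ_j = dy^j + ∑ C_{jk} w^k`, so that `ω = ∑ w^j ∧ ρ_j`. The
passage from `(w, dy)` to `(w, ρ)` is block triangular with determinant `1` and leaves the top form
unchanged. -/
theorem liouville_eq (X : Module.Basis (Fin n) ℝ E) (x : K) (Y : E) :
    (liouville (show Module.Basis (Fin n) ℝ (GroupLieAlgebra 𝓘(ℝ, E) K) from X) (x, Y) :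
      (E × E) [⋀^Fin (n + n)]→ₗ[ℝ] ℂ) =
      ((-1) ^ (n * (n - 1) / 2) : ℂ) • wedgeOneForms (Fin.append (baseForm X x) (fiberForm X)) := by
  obtain ⟨c, hc, hω⟩ := omega_apply X x Y
  obtain ⟨C, hC⟩ := skew_eq_sum_pairs X x c hc
  let ρ (j : Fin n) : E × E →ₗ[ℝ] ℂ := fiberForm X j + ∑ k, C j k • baseForm X x k
  have hρ : ∀ j v, ρ j v = fiberForm X j v + ∑ k, C j k * baseForm X x k v := fun j v => by
    simp [ρ]
  let Ω : (E × E) [⋀^Fin 2]→L[ℝ] ℝ :=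
    omega (show Module.Basis (Fin n) ℝ (GroupLieAlgebra 𝓘(ℝ, E) K) from X) (x, Y)
  have h1 : Complex.ofRealCLM.toLinearMap.compAlternatingMap Ω.toAlternatingMap =
      ∑ j, wedgeOneForms ![baseForm X x j, ρ j] := by
    ext v
    refine Eq.trans ?_ (map_sum (AddMonoidHom.mk' (fun a : (E × E) [⋀^Fin 2]→ₗ[ℝ] ℂ => a v)
      fun _ _ => rfl) _ Finset.univ).symm
    refine (congrArg Complex.ofReal (hω v)).trans ?_
    rw [Complex.ofReal_add, hC, Complex.ofReal_sub, coordInner_apply, coordInner_apply,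
      Complex.ofReal_sum, Complex.ofReal_sum, ← Finset.sum_sub_distrib, ← Finset.sum_add_distrib]
    refine Finset.sum_congr rfl fun j _ => ?_
    rw [AddMonoidHom.mk'_apply, wedgeOneForms_pair_apply, hρ, hρ]
    simp only [baseForm_apply, fiberForm_apply, Complex.ofReal_mul]
    ring
  have h2 : (liouville (show Module.Basis (Fin n) ℝ (GroupLieAlgebra 𝓘(ℝ, E) K) from X) (x, Y) :
      (E × E) [⋀^Fin (n + n)]→ₗ[ℝ] ℂ) = ((n.factorial : ℂ)⁻¹ • wedgePow
        (Complex.ofRealCLM.toLinearMap.compAlternatingMap Ω.toAlternatingMap) n).domDomCongr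
        (finCongr (two_mul n)) := rfl
  have h3 := wedgeOneForms_append_blocks 1 0 C 1 (baseForm X x) (fiberForm X) (baseForm X x) ρ
    (fun i v => by simp [Matrix.one_apply])
    (fun i v => by simp [Matrix.one_apply, hρ, add_comm])
  rw [Matrix.det_fromBlocks_zero₁₂, Matrix.det_one, mul_one, one_smul] at h3
  rw [h2, AlternatingMap.domDomCongr_smul, h1, wedgePow_sum_pairs, h3, smul_smul, ← mul_assoc,
    inv_mul_cancel₀ (Nat.cast_ne_zero.2 n.factorial_ne_zero), one_mul]

theorem bConst_smul_liouville (X : Module.Basis (Fin n) ℝ E) (x : K) (Y : E) (c : ℂ) :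
    (((c * bConst n) • liouville (show Module.Basis (Fin n) ℝ (GroupLieAlgebra 𝓘(ℝ, E) K) from X)
      (x, Y) : (E × E) [⋀^Fin (n + n)]→ₗ[ℝ] ℂ)) =
      (c * (2 * Complex.I) ^ n) • wedgeOneForms (Fin.append (baseForm X x) (fiberForm X)) := by
  refine (congrArg (fun a : (E × E) [⋀^Fin (n + n)]→ₗ[ℝ] ℂ => (c * bConst n) • a)
    (liouville_eq X x Y)).trans ?_
  rw [smul_smul, bConst, mul_assoc, mul_assoc, ← mul_pow, neg_one_mul, neg_neg, one_pow, mul_one]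

end Liouville

/-! ### Cartan subalgebras under an invariant inner product -/

section CompactLieAlgebra

variable {L : Type*} [LieRing L] [LieAlgebra ℝ L]

/-- `B` is an `ad`-invariant inner product on the real Lie algebra `L`. -/
structure IsLieInvariantInner (B : LinearMap.BilinForm ℝ L) : Prop where
  symm : ∀ x y : L, B x y = B y x
  pos : ∀ x : L, x ≠ 0 → 0 < B x x
  invariant : ∀ x y z : L, B ⁅x, y⁆ z = -B y ⁅x, z⁆

variable {B : LinearMap.BilinForm ℝ L} (hB : IsLieInvariantInner B)

include hB

theorem IsLieInvariantInner.eq_zero {x : L} (h : B x x = 0) : x = 0 := by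
  by_contra hx
  exact (hB.pos x hx).ne' h

theorem IsLieInvariantInner.nonneg (x : L) : 0 ≤ B x x := by
  by_cases hx : x = 0
  · simp [hx]
  · exact (hB.pos x hx).le

/-- A skew operator with a vanishing power on a vector kills it: `B([x, y], [x, y]) = -B(y, [x, [x,
y]])`. -/
theorem IsLieInvariantInner.lie_eq_zero_of_pow {x y : L} {k : ℕ}
    (h : ((LieAlgebra.ad ℝ L x) ^ k) y = 0) (hk : k ≠ 0) : ⁅x, y⁆ = 0 := by
  induction k generalizing y with
  | zero => exact absurd rfl hk
  | succ k ih =>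
    by_cases hk0 : k = 0
    · simpa [hk0] using h
    · rw [pow_succ, Module.End.mul_apply] at h
      have h1 : ⁅x, ⁅x, y⁆⁆ = 0 := ih h hk0
      apply hB.eq_zero
      rw [hB.invariant, h1, map_zero, neg_zero]

variable {𝔱 : LieSubalgebra ℝ L} (h𝔱 : 𝔱.IsCartanSubalgebra)

include h𝔱

/-- A Cartan subalgebra is nilpotent, so `ad x` is nilpotent on it, and skewness upgrades this to
commutativity. -/
theorem IsLieInvariantInner.lie_eq_zero_of_mem {x y : L} (hx : x ∈ 𝔱) (hy : y ∈ 𝔱) :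
    ⁅x, y⁆ = 0 := by
  obtain ⟨k, hk⟩ := LieAlgebra.nilpotent_ad_of_nilpotent_algebra ℝ 𝔱
  have h1 : ∀ (k : ℕ) (z : 𝔱), (((LieAlgebra.ad ℝ 𝔱 ⟨x, hx⟩) ^ k) z : L) =
      ((LieAlgebra.ad ℝ L x) ^ k) z := by
    intro k
    induction k with
    | zero => intro z; simp
    | succ k ih =>
      intro z
      rw [pow_succ, pow_succ, Module.End.mul_apply, Module.End.mul_apply, ih]
      rfl
  refine hB.lie_eq_zero_of_pow (k := k + 1) ?_ k.succ_ne_zero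
  rw [← h1 (k + 1) ⟨y, hy⟩, pow_succ, hk, zero_mul]
  rfl

theorem IsLieInvariantInner.mem_of_forall_lie_eq_zero {x : L} (h : ∀ y ∈ 𝔱, ⁅y, x⁆ = 0) :
    x ∈ 𝔱 := by
  rw [← h𝔱.self_normalizing, LieSubalgebra.mem_normalizer_iff']
  intro y hy
  rw [h y hy]
  exact 𝔱.zero_mem

end CompactLieAlgebra

/-! ### Root spaces in the complexified Lie algebra -/

section Complexified

local instance algebraRealComplex : Algebra ℝ ℂ := Complex.instAlgebraOfReal

local instance moduleRealComplex : Module ℝ ℂ := Algebra.toModule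

variable {L : Type*} [LieRing L] [LieAlgebra ℝ L]

variable (L) in
/-- Complex conjugation on the complexification of a real vector space. -/
def conjTensor : ℂ ⊗[ℝ] L →ₗ[ℝ] ℂ ⊗[ℝ] L := LinearMap.rTensor L Complex.conjAe.toLinearMap

theorem conjTensor_tmul (z : ℂ) (x : L) : conjTensor L (z ⊗ₜ x) = (starRingEnd ℂ z) ⊗ₜ x := rfl

theorem conjTensor_conjTensor (x : ℂ ⊗[ℝ] L) : conjTensor L (conjTensor L x) = x := by
  induction x with
  | zero => simp
  | add x y hx hy => simp [hx, hy]
  | tmul z x => simp [conjTensor_tmul]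

theorem conjTensor_smul (c : ℂ) (x : ℂ ⊗[ℝ] L) :
    conjTensor L (c • x) = starRingEnd ℂ c • conjTensor L x := by
  induction x with
  | zero => simp
  | add x y hx hy => simp [hx, hy]
  | tmul z x => simp [conjTensor_tmul, TensorProduct.smul_tmul']

theorem conjTensor_lie (x y : ℂ ⊗[ℝ] L) :
    conjTensor L ⁅x, y⁆ = ⁅conjTensor L x, conjTensor L y⁆ := by
  induction x with
  | zero => simp
  | add x x' hx hx' => simp [hx, hx']
  | tmul z x =>
    induction y with
    | zero => simp
    | add y y' hy hy' => simp [hy, hy']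
    | tmul w y => simp [conjTensor_tmul, LieAlgebra.ExtendScalars.bracket_tmul]

theorem exists_re_im (x : ℂ ⊗[ℝ] L) : ∃ a b : L, x = (1 : ℂ) ⊗ₜ a + Complex.I ⊗ₜ b := by
  induction x with
  | zero => exact ⟨0, 0, by simp⟩
  | add x y hx hy =>
    obtain ⟨a, b, rfl⟩ := hx
    obtain ⟨a', b', rfl⟩ := hy
    exact ⟨a + a', b + b', by simp only [TensorProduct.tmul_add]; abel⟩
  | tmul z x =>
    refine ⟨z.re • x, z.im • x, ?_⟩
    rw [TensorProduct.tmul_smul, TensorProduct.tmul_smul, TensorProduct.smul_tmul',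
      TensorProduct.smul_tmul', ← TensorProduct.add_tmul]
    congr 1
    simp

variable {B : LinearMap.BilinForm ℝ L} (hB : IsLieInvariantInner B)

include hB

theorem IsLieInvariantInner.baseChange_conj (a b : L) :
    B.baseChange ℂ ((1 : ℂ) ⊗ₜ a + Complex.I ⊗ₜ b) (conjTensor L ((1 : ℂ) ⊗ₜ a + Complex.I ⊗ₜ b)) =
      ((B a a + B b b : ℝ) : ℂ) := by
  simp only [map_add, conjTensor_tmul, LinearMap.add_apply, LinearMap.BilinForm.baseChange_tmul]
  rw [hB.symm b a]
  apply Complex.ext <;> simp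

theorem IsLieInvariantInner.baseChange_pos {x : ℂ ⊗[ℝ] L} (hx : x ≠ 0) :
    ∃ r : ℝ, 0 < r ∧ B.baseChange ℂ x (conjTensor L x) = r := by
  obtain ⟨a, b, rfl⟩ := exists_re_im x
  refine ⟨_, ?_, hB.baseChange_conj a b⟩
  by_cases ha : a = 0
  · have hb : b ≠ 0 := fun hb => hx (by simp [ha, hb])
    exact add_pos_of_nonneg_of_pos (hB.nonneg a) (hB.pos b hb)
  · exact add_pos_of_pos_of_nonneg (hB.pos a ha) (hB.nonneg b)

theorem IsLieInvariantInner.re_im_eq_zero {a b : L} (h : (1 : ℂ) ⊗ₜ[ℝ] a + Complex.I ⊗ₜ b = 0) :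
    a = 0 ∧ b = 0 := by
  have h1 := hB.baseChange_conj a b
  rw [h, map_zero, LinearMap.zero_apply, eq_comm, Complex.ofReal_eq_zero] at h1
  have ha := hB.nonneg a
  have hb := hB.nonneg b
  exact ⟨hB.eq_zero (by linarith), hB.eq_zero (by linarith)⟩

theorem IsLieInvariantInner.baseChange_invariant (x y z : ℂ ⊗[ℝ] L) :
    B.baseChange ℂ ⁅x, y⁆ z = -B.baseChange ℂ y ⁅x, z⁆ := by
  induction x with
  | zero => simp
  | add x x' hx hx' => simp only [add_lie, map_add, LinearMap.add_apply, hx, hx', neg_add]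
  | tmul u x =>
    induction y with
    | zero => simp
    | add y y' hy hy' => simp only [lie_add, map_add, LinearMap.add_apply, hy, hy', neg_add]
    | tmul v y =>
      induction z with
      | zero => simp
      | add z z' hz hz' => rw [map_add, hz, hz', lie_add, map_add, neg_add]
      | tmul w z =>
        simp only [LieAlgebra.ExtendScalars.bracket_tmul, LinearMap.BilinForm.baseChange_tmul,
          hB.invariant x y z, neg_smul]
        congr 2
        ring

theorem IsLieInvariantInner.baseChange_symm (x y : ℂ ⊗[ℝ] L) :
    B.baseChange ℂ x y = B.baseChange ℂ y x :=
  (LinearMap.BilinForm.IsSymm.baseChange ℂ (B₂ := B) ⟨hB.symm⟩).eq x y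

variable {𝔱 : LieSubalgebra ℝ L} (h𝔱 : 𝔱.IsCartanSubalgebra)

include h𝔱

/-- The real and imaginary parts centralize `𝔱`, hence lie in `𝔱` since `𝔱` is self-normalizing;
orthogonality to `𝔱` then makes the Hermitian square of `x` vanish. -/
theorem IsLieInvariantInner.eq_zero_of_centralizes {x : ℂ ⊗[ℝ] L}
    (h : ∀ H ∈ 𝔱, ⁅(1 : ℂ) ⊗ₜ[ℝ] H, x⁆ = 0) (h' : ∀ H ∈ 𝔱, B.baseChange ℂ x ((1 : ℂ) ⊗ₜ H) = 0) :
    x = 0 := by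
  obtain ⟨a, b, rfl⟩ := exists_re_im x
  have h1 : ∀ H ∈ 𝔱, ⁅H, a⁆ = 0 ∧ ⁅H, b⁆ = 0 := fun H hH => by
    apply hB.re_im_eq_zero
    simpa [LieAlgebra.ExtendScalars.bracket_tmul] using h H hH
  have ha : a ∈ 𝔱 := hB.mem_of_forall_lie_eq_zero h𝔱 fun H hH => (h1 H hH).1
  have hb : b ∈ 𝔱 := hB.mem_of_forall_lie_eq_zero h𝔱 fun H hH => (h1 H hH).2
  have h2 : B.baseChange ℂ ((1 : ℂ) ⊗ₜ a + Complex.I ⊗ₜ b)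
      (conjTensor L ((1 : ℂ) ⊗ₜ a + Complex.I ⊗ₜ b)) = 0 := by
    have : conjTensor L ((1 : ℂ) ⊗ₜ a + Complex.I ⊗ₜ b) =
        (1 : ℂ) ⊗ₜ a + (-Complex.I) • ((1 : ℂ) ⊗ₜ b) := by
      simp [conjTensor_tmul, TensorProduct.smul_tmul', TensorProduct.neg_tmul]
    rw [this, map_add, map_smul, h' a ha, h' b hb, smul_zero, add_zero]
  by_contra hne
  obtain ⟨r, hr, hr'⟩ := hB.baseChange_pos hne
  rw [hr'] at h2
  exact hr.ne' (Complex.ofReal_eq_zero.1 h2)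

omit hB h𝔱 in
theorem conjTensor_mem_rootSpace {α : Module.Dual ℝ 𝔱} {x : ℂ ⊗[ℝ] L}
    (hx : ∀ H : 𝔱, ⁅(1 : ℂ) ⊗ₜ[ℝ] (H : L), x⁆ = (Complex.I * (α H : ℂ)) • x) (H : 𝔱) :
    ⁅(1 : ℂ) ⊗ₜ[ℝ] (H : L), conjTensor L x⁆ = (-(Complex.I * (α H : ℂ))) • conjTensor L x := by
  have := congrArg (conjTensor L) (hx H)
  rw [conjTensor_lie, conjTensor_smul, conjTensor_tmul] at this
  simpa using this

/-- The root spaces of a compact Lie algebra are one-dimensional. -/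
theorem IsLieInvariantInner.exists_eq_smul_of_mem_rootSpace [FiniteDimensional ℝ L]
    {α : Module.Dual ℝ 𝔱} (hα : α ≠ 0)
    {e x : ℂ ⊗[ℝ] L} (he0 : e ≠ 0)
    (he : ∀ H : 𝔱, ⁅(1 : ℂ) ⊗ₜ[ℝ] (H : L), e⁆ = (Complex.I * (α H : ℂ)) • e)
    (hx : ∀ H : 𝔱, ⁅(1 : ℂ) ⊗ₜ[ℝ] (H : L), x⁆ = (Complex.I * (α H : ℂ)) • x) :
    ∃ c : ℂ, x = c • e := by
  set β := B.baseChange ℂ with hβ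
  obtain ⟨r, hr, hr'⟩ := hB.baseChange_pos he0
  set f := conjTensor L e with hf
  have hf' := conjTensor_mem_rootSpace he
  -- it suffices to treat `x` orthogonal to `e`
  suffices key : ∀ y : ℂ ⊗[ℝ] L,
      (∀ H : 𝔱, ⁅(1 : ℂ) ⊗ₜ[ℝ] (H : L), y⁆ = (Complex.I * (α H : ℂ)) • y) → β y f = 0 → y = 0 by
    refine ⟨β x f / r, sub_eq_zero.1 (key _ (fun H => ?_) ?_)⟩
    · rw [lie_sub, lie_smul, hx, he, smul_sub, smul_comm]
    · have hr0 : (r : ℂ) ≠ 0 := Complex.ofReal_ne_zero.2 hr.ne'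
      rw [map_sub, LinearMap.sub_apply, map_smul, LinearMap.smul_apply, hr', smul_eq_mul,
        div_mul_cancel₀ _ hr0, sub_self]
  clear hx x
  intro x hx hxf
  -- the dual vector of `α`
  obtain ⟨t, ht⟩ : ∃ t : 𝔱, ∀ H : 𝔱, B t H = α H := by
    let Φ : 𝔱 →ₗ[ℝ] Module.Dual ℝ 𝔱 :=
      (Module.Dual.transpose 𝔱.toSubmodule.subtype) ∘ₗ B ∘ₗ 𝔱.toSubmodule.subtype
    have hΦ : Function.Injective Φ := by
      rw [injective_iff_map_eq_zero]
      intro t ht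
      exact Subtype.ext (hB.eq_zero (congrArg (fun φ : Module.Dual ℝ 𝔱 => φ t) ht))
    have hs := (LinearMap.injective_iff_surjective_of_finrank_eq_finrank
      (Subspace.dual_finrank_eq (K := ℝ) (V := 𝔱)).symm).1 hΦ
    obtain ⟨t, ht⟩ := hs α
    exact ⟨t, fun H => congrArg (fun φ : Module.Dual ℝ 𝔱 => φ H) ht⟩
  have hlie : ∀ {y : ℂ ⊗[ℝ] L},
      (∀ H : 𝔱, ⁅(1 : ℂ) ⊗ₜ[ℝ] (H : L), y⁆ = (Complex.I * (α H : ℂ)) • y) →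
      (∀ H ∈ 𝔱, ⁅(1 : ℂ) ⊗ₜ[ℝ] H, ⁅y, f⁆⁆ = 0) ∧
      ∀ H : 𝔱, β ⁅y, f⁆ ((1 : ℂ) ⊗ₜ H) = Complex.I * α H * β y f := by
    intro y hy
    constructor
    · intro H hH
      rw [leibniz_lie, hy ⟨H, hH⟩, hf' ⟨H, hH⟩, smul_lie, lie_smul, neg_smul, add_neg_cancel]
    · intro H
      rw [hB.baseChange_symm, ← neg_eq_iff_eq_neg.2 (hB.baseChange_invariant y _ _),
        ← lie_skew y, hy, map_neg, LinearMap.neg_apply, neg_neg, map_smul, LinearMap.smul_apply,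
        smul_eq_mul]
  -- `[x, f]` has weight zero and its pairing with `𝔱` is proportional to `β x f = 0`.
  have h1 : ⁅x, f⁆ = 0 := by
    refine hB.eq_zero_of_centralizes h𝔱 (hlie hx).1 fun H hH => ?_
    rw [(hlie hx).2 ⟨H, hH⟩, hxf, mul_zero]
  have h2 : ⁅e, f⁆ = (Complex.I * r) • ((1 : ℂ) ⊗ₜ (t : L)) := by
    rw [← sub_eq_zero]
    refine hB.eq_zero_of_centralizes h𝔱 (fun H hH => ?_) fun H hH => ?_
    · rw [lie_sub, (hlie he).1 H hH, lie_smul, LieAlgebra.ExtendScalars.bracket_tmul,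
        hB.lie_eq_zero_of_mem h𝔱 hH t.2]
      simp
    · rw [map_sub, LinearMap.sub_apply, (hlie he).2 ⟨H, hH⟩, map_smul, LinearMap.smul_apply,
        LinearMap.BilinForm.baseChange_tmul, hr', ← ht]
      simp only [mul_one, Complex.real_smul, smul_eq_mul]
      ring
  have hαt : 0 < α t := by
    rw [← ht]
    refine hB.pos t fun h0 => hα ?_
    ext H
    rw [← ht, h0]
    simp
  -- By the Jacobi identity only `-[[e, f], x]` survives, and `[e, f] = i r t` acts on `x` as the
  -- scalar `-r α(t)`.
  have h3 : ⁅f, ⁅e, x⁆⁆ = ((r * α t : ℝ) : ℂ) • x := by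
    rw [leibniz_lie, ← lie_skew f e, h2, ← lie_skew f x, h1, neg_zero, lie_zero, add_zero, neg_lie,
      smul_lie, hx, smul_smul, ← neg_smul]
    congr 1
    push_cast
    linear_combination (-(r : ℂ) * α t) * Complex.I_sq
  by_contra hx0
  obtain ⟨q, hq, hq'⟩ := hB.baseChange_pos hx0
  -- Moving `f` across the form shows that the Hermitian square of `[e, x]` would be negative if `x
  -- ≠ 0`.
  have h4 : β ⁅e, x⁆ (conjTensor L ⁅e, x⁆) = ((-(r * α t * q) : ℝ) : ℂ) := by
    rw [conjTensor_lie, ← hf, ← neg_eq_iff_eq_neg.2 (hB.baseChange_invariant f _ _), ← hβ, h3,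
      map_smul, LinearMap.smul_apply, hq']
    push_cast
    simp
  have hpos : 0 < r * α t * q := by positivity
  by_cases hex : ⁅e, x⁆ = 0
  · rw [hex] at h4
    simp only [map_zero] at h4
    have := Complex.ofReal_eq_zero.1 h4.symm
    linarith
  · obtain ⟨p, hp, hp'⟩ := hB.baseChange_pos hex
    rw [← hβ, h4] at hp'
    have := Complex.ofReal_injective hp'
    linarith

end Complexified

/-! ### Simultaneous diagonalization of the Cartan subalgebra -/

section RootDecomposition

open Matrix
open scoped Matrix.Norms.Operator

local instance algebraRealComplex' : Algebra ℝ ℂ := Complex.instAlgebraOfReal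

local instance moduleRealComplex' : Module ℝ ℂ := Algebra.toModule

variable {L : Type*} [LieRing L] [LieAlgebra ℝ L] {n : ℕ}

/-- The matrix of `-i ad H` in the basis `X`. -/
def lieMatrix (X : Module.Basis (Fin n) ℝ L) : L →ₗ[ℝ] Matrix (Fin n) (Fin n) ℂ where
  toFun H := Matrix.of fun j k => Complex.I * (X.coord j ⁅X k, H⁆ : ℂ)
  map_add' H H' := by
    ext j k
    simp [mul_add]
  map_smul' c H := by
    ext j k
    simp
    ring

theorem lieMatrix_apply (X : Module.Basis (Fin n) ℝ L) (H : L) (j k : Fin n) :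
    lieMatrix X H j k = Complex.I * (X.coord j ⁅X k, H⁆ : ℂ) := rfl

theorem equivFun_one_tmul (X : Module.Basis (Fin n) ℝ L) (V : L) (j : Fin n) :
    (X.baseChange ℂ).equivFun ((1 : ℂ) ⊗ₜ[ℝ] V) j = (X.coord j V : ℂ) := by
  rw [Module.Basis.equivFun_apply, Module.Basis.baseChange_repr_tmul]
  simp

theorem equivFun_lie (X : Module.Basis (Fin n) ℝ L) (H : L) (v : ℂ ⊗[ℝ] L) :
    (X.baseChange ℂ).equivFun ⁅(1 : ℂ) ⊗ₜ[ℝ] H, v⁆ =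
      Complex.I • (lieMatrix X H *ᵥ (X.baseChange ℂ).equivFun v) := by
  conv_lhs => rw [← (X.baseChange ℂ).sum_equivFun v]
  rw [lie_sum, map_sum]
  ext j
  rw [Finset.sum_apply, Pi.smul_apply, mulVec, dotProduct, smul_eq_mul, Finset.mul_sum]
  refine Finset.sum_congr rfl fun k _ => ?_
  rw [lie_smul, map_smul, Module.Basis.baseChange_apply, LieAlgebra.ExtendScalars.bracket_tmul,
    one_mul, Pi.smul_apply, equivFun_one_tmul, lieMatrix_apply, ← lie_skew, map_neg, smul_eq_mul,
    ← mul_assoc, ← mul_assoc, Complex.I_mul_I]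
  push_cast
  ring

variable {B : LinearMap.BilinForm ℝ L} (hB : IsLieInvariantInner B) {X : Module.Basis (Fin n) ℝ L}
  (hX : ∀ i j, B (X i) (X j) = if i = j then 1 else 0)

include hX in
theorem coord_eq_form (j : Fin n) (V : L) : X.coord j V = B (X j) V := by
  have : X.coord j = B (X j) := X.ext fun k => by
    rw [hX, Module.Basis.coord_apply, Module.Basis.repr_self, Finsupp.single_apply]
    simp only [eq_comm]
  rw [this]

include hB hX

theorem coord_lie_skew (H : L) (j k : Fin n) : X.coord j ⁅X k, H⁆ = -X.coord k ⁅X j, H⁆ := by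
  rw [coord_eq_form hX, coord_eq_form hX, ← lie_skew, map_neg, hB.symm, hB.invariant,
    ← lie_skew (X j), map_neg]

theorem isHermitian_lieMatrix (H : L) : (lieMatrix X H).IsHermitian := by
  ext j k
  rw [conjTranspose_apply, lieMatrix_apply, lieMatrix_apply, coord_lie_skew hB hX H j k]
  simp

theorem trace_lieMatrix (H : L) : (lieMatrix X H).trace = 0 := by
  rw [trace]
  refine Finset.sum_eq_zero fun j _ => ?_
  have := coord_lie_skew hB hX H j j
  rw [diag_apply, lieMatrix_apply, show X.coord j ⁅X j, H⁆ = 0 by linarith]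
  simp

omit hB hX in
theorem commute_lieMatrix {H H' : L} (h : ⁅H, H'⁆ = 0) :
    Commute (lieMatrix X H) (lieMatrix X H') := by
  refine Matrix.mulVec_injective (funext fun w => ?_)
  obtain ⟨v, rfl⟩ := (X.baseChange ℂ).equivFun.surjective w
  have h1 := leibniz_lie ((1 : ℂ) ⊗ₜ[ℝ] H) ((1 : ℂ) ⊗ₜ[ℝ] H') v
  rw [LieAlgebra.ExtendScalars.bracket_tmul, h, TensorProduct.tmul_zero, zero_lie, zero_add] at h1
  have h2 := congrArg (X.baseChange ℂ).equivFun h1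
  simp only [equivFun_lie, mulVec_smul, mulVec_mulVec, smul_smul, Complex.I_mul_I, neg_smul,
    one_smul, neg_inj] at h2
  exact h2

variable {𝔱 : LieSubalgebra ℝ L} (h𝔱 : 𝔱.IsCartanSubalgebra)

include h𝔱

/-- The root space decomposition. -/
theorem exists_joint_eigenbasis :
    ∃ (lam : Fin n → Module.Dual ℝ 𝔱) (v : Module.Basis (Fin n) ℂ (ℂ ⊗[ℝ] L)),
      ∀ j (H : 𝔱), ⁅(1 : ℂ) ⊗ₜ[ℝ] (H : L), v j⁆ = (Complex.I * (lam j H : ℂ)) • v j := by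
  classical
  have : FiniteDimensional ℝ L := X.finiteDimensional_of_finite
  let b := Module.finBasis ℝ 𝔱
  let T (i : Fin (Module.finrank ℝ 𝔱)) := toEuclideanLin (lieMatrix X (b i))
  have hT : ∀ i, (T i).IsSymmetric := fun i =>
    isSymmetric_toEuclideanLin_iff.2 (isHermitian_lieMatrix hB hX (b i))
  have hC : Pairwise (Function.onFun Commute T) := fun i j _ => by
    have h1 := commute_lieMatrix (X := X) (hB.lie_eq_zero_of_mem h𝔱 (b i).2 (b j).2)
    have h2 : ∀ A A' : Matrix (Fin n) (Fin n) ℂ, Commute A A' →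
        Commute (toEuclideanLin A) (toEuclideanLin A') := fun A A' h => by
      ext v k
      simp only [Module.End.mul_apply, toLpLin_apply, mulVec_mulVec, h.eq]
    exact h2 _ _ h1
  have hint := LinearMap.IsSymmetric.directSum_isInternal_of_pairwise_commute hT hC
  let c := hint.collectedBasis fun χ => Module.finBasis ℂ
    (⨅ j, Module.End.eigenspace (T j) (χ j) : Submodule ℂ (EuclideanSpace ℂ (Fin n)))
  have : Fintype (Σ χ : Fin (Module.finrank ℝ 𝔱) → ℂ, Fin (Module.finrank ℂ
    (⨅ j, Module.End.eigenspace (T j) (χ j) : Submodule ℂ (EuclideanSpace ℂ (Fin n))))) :=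
    FiniteDimensional.fintypeBasisIndex c
  have e := Fintype.equivFinOfCardEq (n := n)
    ((Module.finrank_eq_card_basis c).symm.trans finrank_euclideanSpace_fin)
  let d := (c.reindex e).map ((WithLp.linearEquiv 2 ℂ (Fin n → ℂ)).trans
    (X.baseChange ℂ).equivFun.symm)
  let χ (j : Fin n) := (e.symm j).1
  have hc : ∀ j i, T i (c (e.symm j)) = χ j i • c (e.symm j) := fun j i => by
    have h1 := hint.collectedBasis_mem (fun χ => Module.finBasis ℂ
      (⨅ j, Module.End.eigenspace (T j) (χ j) : Submodule ℂ (EuclideanSpace ℂ (Fin n)))) (e.symm j)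
    exact Module.End.mem_eigenspace_iff.1 ((Submodule.mem_iInf _).1 h1 i)
  -- Eigenvalues of symmetric operators are real, so the weights are real linear forms.
  have hreal : ∀ j i, χ j i = ((χ j i).re : ℂ) := fun j i => by
    have h1 : Module.End.HasEigenvalue (T i) (χ j i) :=
      Module.End.hasEigenvalue_of_hasEigenvector
        ⟨Module.End.mem_eigenspace_iff.2 (hc j i), c.ne_zero _⟩
    exact (Complex.conj_eq_iff_re.1 ((hT i).conj_eigenvalue_eq_self h1)).symm
  -- Each weight is prescribed on the basis `b` of `𝔱` by the joint eigenvalues and extended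
  -- linearly.
  refine ⟨fun j => b.constr ℝ fun i => (χ j i).re, d, fun j H => ?_⟩
  have hd : (X.baseChange ℂ).equivFun (d j) = WithLp.ofLp (c (e.symm j)) := by
    have h1 : d j = (X.baseChange ℂ).equivFun.symm (WithLp.ofLp (c (e.symm j))) := by
      rw [Module.Basis.map_apply, Module.Basis.reindex_apply]
      rfl
    rw [h1, LinearEquiv.apply_symm_apply]
  apply (X.baseChange ℂ).equivFun.injective
  rw [equivFun_lie, map_smul, hd, mul_smul]
  congr 1
  have h1 : ∀ i, lieMatrix X (b i) *ᵥ WithLp.ofLp (c (e.symm j)) =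
      ((χ j i).re : ℂ) • WithLp.ofLp (c (e.symm j)) := fun i => by
    rw [← hreal]
    exact congrArg WithLp.ofLp (hc j i)
  have hH : (H : L) = ∑ i, b.repr H i • (b i : L) := by
    have h2 := congrArg 𝔱.toSubmodule.subtype (b.sum_repr H)
    simp only [map_sum, map_smul] at h2
    exact h2.symm
  rw [Module.Basis.constr_apply_fintype, hH]
  simp only [map_sum, map_smul, sum_mulVec, smul_mulVec, h1, Module.Basis.equivFun_apply,
    smul_eq_mul, Complex.ofReal_sum, Finset.sum_smul, Complex.ofReal_mul, mul_smul,
    Complex.coe_smul]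

end RootDecomposition

/-! ### The determinant on the Cartan subalgebra as a product over roots -/

section RootProduct

open Matrix
open scoped Matrix.Norms.Operator

local instance algebraRealComplex'' : Algebra ℝ ℂ := Complex.instAlgebraOfReal

local instance moduleRealComplex'' : Module ℝ ℂ := Algebra.toModule

variable {L : Type*} [LieRing L] [LieAlgebra ℝ L] {n : ℕ}

/-- The real roots of a real Lie algebra relative to a subalgebra. -/
def lieRoots (𝔱 : LieSubalgebra ℝ L) : Set (Module.Dual ℝ 𝔱) :=
  {α | α ≠ 0 ∧ ∃ v : ℂ ⊗[ℝ] L, v ≠ 0 ∧ ∀ H : 𝔱,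
    ⁅((1 : ℂ) ⊗ₜ[ℝ] (H : L) : ℂ ⊗[ℝ] L), v⁆ = (Complex.I * (α H : ℂ)) • v}

theorem neg_mem_lieRoots {𝔱 : LieSubalgebra ℝ L} {α : Module.Dual ℝ 𝔱} (h : α ∈ lieRoots 𝔱) :
    -α ∈ lieRoots 𝔱 := by
  obtain ⟨h0, v, hv, hα⟩ := h
  refine ⟨neg_ne_zero.2 h0, conjTensor L v, fun h => hv ?_, fun H => ?_⟩
  · rw [← conjTensor_conjTensor v, h, map_zero]
  · rw [conjTensor_mem_rootSpace hα]
    simp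

theorem sinhc_neg (t : ℝ) : sinhc (-t) = sinhc t := by
  simp [sinhc]

theorem sinhc_zero : sinhc 0 = 1 := by simp [sinhc]

variable {B : LinearMap.BilinForm ℝ L} (hB : IsLieInvariantInner B) {X : Module.Basis (Fin n) ℝ L}
  (hX : ∀ i j, B (X i) (X j) = if i = j then 1 else 0)
  {𝔱 : LieSubalgebra ℝ L} (h𝔱 : 𝔱.IsCartanSubalgebra)

theorem lieMatrix_mul_toMatrix {lam : Fin n → Module.Dual ℝ 𝔱}
    {v : Module.Basis (Fin n) ℂ (ℂ ⊗[ℝ] L)}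
    (hv : ∀ j (H : 𝔱), ⁅(1 : ℂ) ⊗ₜ[ℝ] (H : L), v j⁆ = (Complex.I * (lam j H : ℂ)) • v j) (H : 𝔱) :
    lieMatrix X (H : L) * (X.baseChange ℂ).toMatrix v =
      (X.baseChange ℂ).toMatrix v * diagonal fun j => (lam j H : ℂ) := by
  ext i j
  have h1 := equivFun_lie X (H : L) (v j)
  rw [hv, map_smul, mul_smul] at h1
  have h2 := congrFun (smul_right_injective _ Complex.I_ne_zero h1) i
  rw [Matrix.mul_diagonal, mul_comm]
  exact h2.symm

include hB hX in
-- The sum is the trace of `-i ad H`, which vanishes because `ad H` is skew.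
theorem sum_weights_eq_zero {lam : Fin n → Module.Dual ℝ 𝔱}
    {v : Module.Basis (Fin n) ℂ (ℂ ⊗[ℝ] L)}
    (hv : ∀ j (H : 𝔱), ⁅(1 : ℂ) ⊗ₜ[ℝ] (H : L), v j⁆ = (Complex.I * (lam j H : ℂ)) • v j) (H : 𝔱) :
    ∑ j, lam j H = 0 := by
  have h1 := congrArg (fun A => (A * v.toMatrix (X.baseChange ℂ)).trace)
    (lieMatrix_mul_toMatrix (X := X) hv H)
  rw [mul_assoc, Module.Basis.toMatrix_mul_toMatrix_flip, mul_one, trace_lieMatrix hB hX,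
    mul_assoc, trace_mul_comm, mul_assoc, Module.Basis.toMatrix_mul_toMatrix_flip, mul_one,
    trace_diagonal, ← Complex.ofReal_sum] at h1
  exact (Complex.ofReal_eq_zero.1 h1.symm)

include hB h𝔱 in
-- Zero weights contribute `1`. The nonzero weights are distinct, by one-dimensionality of root
-- spaces, and exhaust the roots, which are the disjoint union of `P` and `-P`; evenness of `sinhc`
-- gives the square.
theorem prod_weights_eq {lam : Fin n → Module.Dual ℝ 𝔱}
    {v : Module.Basis (Fin n) ℂ (ℂ ⊗[ℝ] L)} [FiniteDimensional ℝ L]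
    (hv : ∀ j (H : 𝔱), ⁅(1 : ℂ) ⊗ₜ[ℝ] (H : L), v j⁆ = (Complex.I * (lam j H : ℂ)) • v j)
    {P : Finset (Module.Dual ℝ 𝔱)} (hP : IsPositiveSystem (lieRoots 𝔱) P) (H : 𝔱) :
    ∏ j, sinhc (lam j H) = (∏ α ∈ P, sinhc (α H)) ^ 2 := by
  classical
  have hinj : ∀ j k, lam j ≠ 0 → lam j = lam k → j = k := by
    intro j k hj hjk
    obtain ⟨c, hc⟩ := hB.exists_eq_smul_of_mem_rootSpace h𝔱 hj (v.ne_zero j) (hv j)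
      (x := v k) (by rw [hjk]; exact hv k)
    by_contra hne
    have h1 := congrArg (fun w => v.repr w k) hc
    simp [hne] at h1
  have hroot : ∀ α, α ∈ lieRoots 𝔱 ↔ α ≠ 0 ∧ ∃ j, lam j = α := by
    intro α
    constructor
    · rintro ⟨h0, w, hw, hα⟩
      refine ⟨h0, ?_⟩
      obtain ⟨j, hj⟩ : ∃ j, v.repr w j ≠ 0 := by
        by_contra hcon
        push Not at hcon
        exact hw (v.ext_elem fun j => by simpa using hcon j)
      refine ⟨j, ?_⟩
      ext H
      -- Comparing a nonzero coordinate of the root vector in the joint eigenbasis identifies the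
      -- root with a weight.
      have h1 := congrArg (fun u => v.repr u j) (hα H)
      conv_lhs at h1 => rw [← v.sum_repr w]
      simp only [lie_sum, lie_smul, hv, map_sum, map_smul, Finsupp.coe_finsetSum, Finset.sum_apply,
        Finsupp.smul_apply, Module.Basis.repr_self, smul_eq_mul] at h1
      rw [Finset.sum_eq_single j (fun k _ hk => by simp [hk]) (by simp)] at h1
      simp only [Finsupp.single_eq_same, mul_one] at h1
      have h2 := mul_left_cancel₀ hj (h1.trans (mul_comm _ _))
      exact Complex.ofReal_injective (mul_left_cancel₀ Complex.I_ne_zero h2)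
    · rintro ⟨h0, j, rfl⟩
      exact ⟨h0, v j, v.ne_zero j, hv j⟩
  set S := Finset.univ.filter fun j => lam j ≠ 0 with hS
  have h1 : ∏ j, sinhc (lam j H) = ∏ j ∈ S, sinhc (lam j H) := by
    refine (Finset.prod_subset (Finset.subset_univ S) fun j _ hj => ?_).symm
    have : lam j = 0 := by simpa [hS] using hj
    rw [this, LinearMap.zero_apply, sinhc_zero]
  have h2 : ∏ j ∈ S, sinhc (lam j H) = ∏ α ∈ S.image lam, sinhc (α H) := by
    rw [Finset.prod_image]
    intro j hj k _ hjk
    exact hinj j k (Finset.mem_filter.1 hj).2 hjk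
  have h3 : S.image lam = P ∪ P.image Neg.neg := by
    ext α
    have h4 : α ∈ S.image lam ↔ α ∈ lieRoots 𝔱 := by
      rw [hroot]
      simp only [Finset.mem_image, hS, Finset.mem_filter, Finset.mem_univ, true_and]
      constructor
      · rintro ⟨j, hj, rfl⟩
        exact ⟨hj, j, rfl⟩
      · rintro ⟨h0, j, rfl⟩
        exact ⟨j, h0, rfl⟩
    rw [h4, Finset.mem_union, Finset.mem_image]
    constructor
    · intro h
      rcases hP.mem_or_neg_mem α h with h | h
      · exact Or.inl h
      · exact Or.inr ⟨-α, h, neg_neg α⟩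
    · rintro (h | ⟨β, hβ, rfl⟩)
      · exact hP.subset α h
      · exact neg_mem_lieRoots (hP.subset β hβ)
  have h5 : Disjoint P (P.image Neg.neg) := by
    rw [Finset.disjoint_left]
    intro α hα hα'
    obtain ⟨β, hβ, rfl⟩ := Finset.mem_image.1 hα'
    exact hP.not_both β hβ hα
  rw [h1, h2, h3, Finset.prod_union h5, Finset.prod_image fun a _ b _ h => neg_injective h, sq]
  congr 1
  exact Finset.prod_congr rfl fun α _ => sinhc_neg _

include hB hX h𝔱 in
theorem det_expIntegral_lieMatrix {P : Finset (Module.Dual ℝ 𝔱)}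
    (hP : IsPositiveSystem (lieRoots 𝔱) P) (H : 𝔱) :
    (expIntegral (lieMatrix X ((2 : ℝ) • (H : L))) 1).det =
      (((∏ α ∈ P, sinhc (α H)) ^ 2 : ℝ) : ℂ) := by
  have : FiniteDimensional ℝ L := X.finiteDimensional_of_finite
  obtain ⟨lam, v, hv⟩ := exists_joint_eigenbasis hB hX h𝔱
  rw [det_expIntegral_of_mul_eq_mul_diagonal (U := (X.baseChange ℂ).toMatrix v)
    (d := fun j => lam j H), Finset.prod_mul_distrib, ← Real.exp_sum,
    sum_weights_eq_zero hB hX hv, Real.exp_zero, one_mul, prod_weights_eq hB h𝔱 hv hP]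
  · intro h
    have := congrArg Matrix.det (v.toMatrix_mul_toMatrix_flip (X.baseChange ℂ))
    rw [det_mul, h, mul_zero, det_one] at this
    exact zero_ne_one this
  · have h1 := lieMatrix_mul_toMatrix (X := X) hv ((2 : ℝ) • H)
    simp only [map_smul, smul_eq_mul] at h1
    exact h1

end RootProduct

/-! ### Regular elements -/

section Regular

local instance algebraRealComplex₃ : Algebra ℝ ℂ := Complex.instAlgebraOfReal

local instance moduleRealComplex₃ : Module ℝ ℂ := Algebra.toModule

/-- A Cartan subalgebra of a compact Lie algebra is the centralizer of one of its elements. -/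
theorem exists_regular {L : Type*} [LieRing L] [LieAlgebra ℝ L] {n : ℕ}
    {B : LinearMap.BilinForm ℝ L} (hB : IsLieInvariantInner B) {X : Module.Basis (Fin n) ℝ L}
    (hX : ∀ i j, B (X i) (X j) = if i = j then 1 else 0)
    {𝔱 : LieSubalgebra ℝ L} (h𝔱 : 𝔱.IsCartanSubalgebra) :
    ∃ H₀ ∈ 𝔱, ∀ y : L, ⁅H₀, y⁆ = 0 → y ∈ 𝔱 := by
  obtain ⟨lam, v, hv⟩ := exists_joint_eigenbasis hB hX h𝔱
  -- Finitely many nonzero linear forms over an infinite field have a common point where none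
  -- vanishes.
  obtain ⟨H₀, hH₀⟩ := Module.Dual.exists_forall_ne_zero_of_forall_exists
    (f := fun j : {j : Fin n // lam j ≠ 0} => lam j) (by
      rintro ⟨j, hj⟩
      by_contra hcon
      push Not at hcon
      exact hj (LinearMap.ext hcon))
  refine ⟨H₀, H₀.2, fun y hy => hB.mem_of_forall_lie_eq_zero h𝔱 fun H hH => ?_⟩
  have hlie : ∀ H : 𝔱, ⁅(1 : ℂ) ⊗ₜ[ℝ] (H : L), (1 : ℂ) ⊗ₜ[ℝ] y⁆ =
      ∑ j, (v.repr ((1 : ℂ) ⊗ₜ[ℝ] y) j * (Complex.I * (lam j H : ℂ))) • v j := by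
    intro H
    conv_lhs => rw [← v.sum_repr ((1 : ℂ) ⊗ₜ[ℝ] y)]
    simp only [lie_sum, lie_smul, hv, smul_smul]
  have h0 := hlie H₀
  rw [LieAlgebra.ExtendScalars.bracket_tmul, hy, TensorProduct.tmul_zero, eq_comm] at h0
  have h1 := Fintype.linearIndependent_iff.1 v.linearIndependent _ h0
  have h2 : ⁅(1 : ℂ) ⊗ₜ[ℝ] H, (1 : ℂ) ⊗ₜ[ℝ] y⁆ = 0 := by
    rw [hlie ⟨H, hH⟩]
    refine Finset.sum_eq_zero fun j _ => ?_
    by_cases hj : lam j = 0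
    · simp [hj]
    · have h3 : (lam j H₀ : ℂ) ≠ 0 := Complex.ofReal_ne_zero.2 (hH₀ ⟨j, hj⟩)
      rw [(mul_eq_zero.1 (h1 j)).resolve_right (mul_ne_zero Complex.I_ne_zero h3), zero_mul,
        zero_smul]
  rw [LieAlgebra.ExtendScalars.bracket_tmul, one_mul] at h2
  exact (hB.re_im_eq_zero (a := ⁅H, y⁆) (b := 0) (by rw [h2]; simp)).1

end Regular

/-! ### Conjugacy into the Cartan subalgebra -/

section Conjugacy

variable {E : Type*} [NormedAddCommGroup E] [NormedSpace ℝ E] [FiniteDimensional ℝ E]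
  [CompleteSpace E] {K : Type*} [TopologicalSpace K] [ChartedSpace E K] [Group K]
  [LieGroup 𝓘(ℝ, E) ∞ K] {n : ℕ}

theorem IsAdInvariantInner.isLieInvariantInner
    {B : LinearMap.BilinForm ℝ (GroupLieAlgebra 𝓘(ℝ, E) K)} (hB : IsAdInvariantInner B) :
    IsLieInvariantInner B := by
  refine ⟨hB.symm, hB.pos, fun V Y Z => ?_⟩
  have h : B ⁅V, Y⁆ Z + B Y ⁅V, Z⁆ = 0 :=
    (congrArg₂ (fun a b : GroupLieAlgebra 𝓘(ℝ, E) K => B a Z + B Y b)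
      (brR_apply (E := E) (G := K) Y V) (brR_apply (E := E) (G := K) Z V)).symm.trans
      (invariant_brR (K := K) (B := (show LinearMap.BilinForm ℝ E from B)) hB.invariant Y Z V)
  exact eq_neg_of_add_eq_zero_left h

theorem lieMatrix_eq_adMatrix (X : Module.Basis (Fin n) ℝ (GroupLieAlgebra 𝓘(ℝ, E) K)) (Y : E) :
    lieMatrix X (show GroupLieAlgebra 𝓘(ℝ, E) K from Y) =
      adMatrix K (show Module.Basis (Fin n) ℝ E from X) Y := by
  ext j k
  rw [adMatrix, Matrix.of_apply, brR_apply]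
  rfl

theorem tderiv_eq_zero_of_isMax {f : K → ℝ} {D : E →L[ℝ] ℝ} (hf : HasTDerivAt 𝓘(ℝ, E) 𝓘(ℝ, ℝ) f 1 D)
    (hmax : ∀ x, f x ≤ f 1) : D = 0 := by
  have h1 := HasTDerivAt.comp (g := f) (f := (cht E (1 : K)).symm) (x := cht E (1 : K) 1)
    (by rw [cht_symm_self]; exact hf) (cht_symm_hasTDerivAt (cht_self_mem (1 : K)))
  rw [tderiv_cht_symm_self, ContinuousLinearMap.comp_id, hasTDerivAt_iff_hasFDerivAt] at h1
  refine IsLocalMax.hasFDerivAt_eq_zero (Filter.Eventually.of_forall fun z => ?_) h1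
  simp only [cht_symm_self]
  exact hmax _

/-- In a compact Lie group, every element of the Lie algebra is conjugate to an element of a given
Cartan subalgebra. -/
theorem exists_Ad_mem [CompactSpace K]
    {B : LinearMap.BilinForm ℝ (GroupLieAlgebra 𝓘(ℝ, E) K)} (hB : IsAdInvariantInner B)
    {X : Module.Basis (Fin n) ℝ (GroupLieAlgebra 𝓘(ℝ, E) K)}
    (hX : ∀ i j, B (X i) (X j) = if i = j then 1 else 0)
    {𝔱 : LieSubalgebra ℝ (GroupLieAlgebra 𝓘(ℝ, E) K)} (h𝔱 : 𝔱.IsCartanSubalgebra)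
    (Y : GroupLieAlgebra 𝓘(ℝ, E) K) : ∃ k : K, Ad k Y ∈ 𝔱 := by
  have hL := hB.isLieInvariantInner
  obtain ⟨H₀, hH₀, hreg⟩ := exists_regular hL hX h𝔱
  let β : E →L[ℝ] ℝ := LinearMap.toContinuousLinearMap
    ((show LinearMap.BilinForm ℝ E from B).flip H₀)
  have hcont : Continuous fun k : K => β (adE k (show E from Y)) :=
    β.continuous.comp (continuous_iff_continuousAt.2 fun k =>
      (hasTDerivAt_adE (show E from Y) k).mdifferentiableAt.continuousAt)
  -- Compactness provides a maximum of `k ↦ B (Ad k Y, H₀)`; its criticality will make `Ad k Y`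
  -- commute with the regular element `H₀`.
  obtain ⟨k, -, hk⟩ := isCompact_univ.exists_isMaxOn ⟨(1 : K), Set.mem_univ _⟩ hcont.continuousOn
  refine ⟨k, hreg _ ?_⟩
  have h1 := HasTDerivAt.comp (g := β) (hasTDerivAt_iff_hasFDerivAt.2 β.hasFDerivAt)
    (hasTDerivAt_adE_one (G := K) (adE k (show E from Y)))
  have h2 := tderiv_eq_zero_of_isMax h1 fun x => by
    rw [← adE_mul_apply, ← adE_mul_apply, one_mul]
    exact hk (Set.mem_univ (x * k))
  have h3 : ∀ V : GroupLieAlgebra 𝓘(ℝ, E) K, B ⁅V, Ad k Y⁆ H₀ = 0 := fun V => by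
    have h4 := congrArg (fun T : E →L[ℝ] ℝ => T V) h2
    exact (congrArg β (brR_apply (E := E) (G := K) (adE k (show E from Y)) V)).symm.trans h4
  apply hL.eq_zero
  -- For this direction invariance turns the critical point equation into `B([H₀, Ad k Y], [H₀, Ad k
  -- Y]) = 0`.
  have h5 := h3 ⁅H₀, Ad k Y⁆
  rw [← lie_skew ⁅H₀, Ad k Y⁆ (Ad k Y), map_neg, LinearMap.neg_apply, hL.invariant, neg_neg,
    ← lie_skew (Ad k Y) H₀, map_neg, neg_eq_zero] at h5
  exact h5

end Conjugacy

/-! ### The determinant as the square of `η` -/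

section AdInvariance

open Matrix
open scoped Matrix.Norms.Operator

variable {E : Type*} [NormedAddCommGroup E] [NormedSpace ℝ E] [FiniteDimensional ℝ E]
  [CompleteSpace E] {K : Type*} [TopologicalSpace K] [ChartedSpace E K] [Group K]
  [LieGroup 𝓘(ℝ, E) ∞ K] {n : ℕ}

/-- The matrix of `Ad k` is invertible and intertwines `ad Y` with `ad (Ad k Y)`, since `Ad k`
preserves brackets. -/
theorem det_expIntegral_adMatrix_adE (X : Module.Basis (Fin n) ℝ E) (k : K) (Y : E) :
    (expIntegral (adMatrix K X (adE k Y)) 1).det = (expIntegral (adMatrix K X Y) 1).det := by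
  let A (k : K) : Matrix (Fin n) (Fin n) ℂ := Matrix.of fun j l => (X.coord j (adE k (X l)) : ℂ)
  have hexp : ∀ (T : E →L[ℝ] E) (V : E) (j : Fin n), (X.coord j (T V) : ℂ) =
      ∑ l, (X.coord j (T (X l)) : ℂ) * (X.coord l V : ℂ) := fun T V j => by
    conv_lhs => rw [← X.sum_repr V]
    simp only [map_sum, map_smul, Complex.ofReal_sum, smul_eq_mul, Complex.ofReal_mul]
    exact Finset.sum_congr rfl fun l _ => mul_comm _ _
  have hA : A k * A k⁻¹ = 1 := by
    ext i j
    rw [Matrix.mul_apply]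
    refine (hexp (adE k) (adE k⁻¹ (X j)) i).symm.trans ?_
    rw [adE_apply_inv, Module.Basis.coord_apply, Module.Basis.repr_self, Finsupp.single_apply,
      Matrix.one_apply]
    simp only [eq_comm, apply_ite Complex.ofReal, Complex.ofReal_one, Complex.ofReal_zero]
  have hdet : (A k).det ≠ 0 := fun h => by
    have := congrArg Matrix.det hA
    rw [det_mul, h, zero_mul, det_one] at this
    exact zero_ne_one this
  have h1 : adMatrix K X (adE k Y) * A k = A k * adMatrix K X Y := by
    ext i j
    rw [Matrix.mul_apply, Matrix.mul_apply]
    have h2 := hexp (brR K (adE k Y)) (adE k (X j)) i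
    have h3 := hexp (adE k) (brR K Y (X j)) i
    rw [adE_brR, h2] at h3
    simp only [adMatrix, of_apply, A]
    simp only [mul_assoc, mul_left_comm _ Complex.I, ← Finset.mul_sum]
    rw [h3]
  have h2 : ∀ m : ℕ, adMatrix K X (adE k Y) ^ m * A k = A k * adMatrix K X Y ^ m := by
    intro m
    induction m with
    | zero => simp
    | succ m ih => rw [pow_succ, mul_assoc, h1, ← mul_assoc, ih, mul_assoc, ← pow_succ]
  have h3 := map_expIntegral_eq_of_map_pow_eq ((ContinuousLinearMap.mul ℝ _).flip (A k))
    (ContinuousLinearMap.mul ℝ _ (A k)) h2 1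
  simp only [ContinuousLinearMap.flip_apply, ContinuousLinearMap.mul_apply'] at h3
  have h4 := congrArg det h3
  rw [det_mul, det_mul, mul_comm] at h4
  exact mul_left_cancel₀ hdet h4

/-- Both sides are `Ad`-invariant and agree on `𝔱`, so conjugacy into `𝔱` suffices. -/
theorem det_expIntegral_adMatrix [CompactSpace K]
    {B : LinearMap.BilinForm ℝ (GroupLieAlgebra 𝓘(ℝ, E) K)} (hB : IsAdInvariantInner B)
    {X : Module.Basis (Fin n) ℝ (GroupLieAlgebra 𝓘(ℝ, E) K)}
    (hX : ∀ i j, B (X i) (X j) = if i = j then 1 else 0)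
    {𝔱 : LieSubalgebra ℝ (GroupLieAlgebra 𝓘(ℝ, E) K)} (h𝔱 : 𝔱.IsCartanSubalgebra)
    {P : Finset (Module.Dual ℝ 𝔱)} (hP : IsPositiveSystem (realRoots 𝔱) P) (Y : E) :
    (expIntegral (adMatrix K (show Module.Basis (Fin n) ℝ E from X) ((2 : ℝ) • Y)) 1).det =
      ((eta 𝔱 P Y ^ 2 : ℝ) : ℂ) := by
  let XE : Module.Basis (Fin n) ℝ E := X
  let F (Y : E) : ℂ := (expIntegral (adMatrix K XE ((2 : ℝ) • Y)) 1).det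
  have hF : ∀ (k : K) (Y : E), F (adE k Y) = F Y := fun k Y => by
    simp only [F]
    rw [← map_smul, det_expIntegral_adMatrix_adE]
  have hFt : ∀ H : 𝔱, F (show E from (H : GroupLieAlgebra 𝓘(ℝ, E) K)) = (((∏ α ∈ P, sinhc (α H)) ^ 2 : ℝ) : ℂ) := fun H => by
    have h1 := det_expIntegral_lieMatrix hB.isLieInvariantInner hX h𝔱 hP H
    rw [← h1]
    exact congrArg (fun M => (expIntegral M 1).det) (lieMatrix_eq_adMatrix X _).symm
  -- That an invariant extension `η` exists is shown by the square root of the determinant itself,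
  -- which avoids any discussion of the Weyl group; on `𝔱` the product is positive, so the root
  -- returns it.
  have heta : (∀ (k : K) (Y : GroupLieAlgebra 𝓘(ℝ, E) K), eta 𝔱 P (Ad k Y) = eta 𝔱 P Y) ∧
      ∀ H : 𝔱, eta 𝔱 P H = ∏ α ∈ P, sinhc (α H) := by
    refine Classical.epsilon_spec (p := fun f : GroupLieAlgebra 𝓘(ℝ, E) K → ℝ =>
      (∀ (k : K) (Y : GroupLieAlgebra 𝓘(ℝ, E) K), f (Ad k Y) = f Y) ∧
        ∀ H : 𝔱, f H = ∏ α ∈ P, sinhc (α H))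
      ⟨fun Y => Real.sqrt (F Y).re, fun k Y => ?_, fun H => ?_⟩
    · exact congrArg (fun z : ℂ => Real.sqrt z.re) (hF k Y)
    · refine (congrArg (fun z : ℂ => Real.sqrt z.re) (hFt H)).trans ?_
      rw [Complex.ofReal_re]
      exact Real.sqrt_sq (Finset.prod_nonneg fun α _ => (sinhc_pos _).le)
  obtain ⟨k, hk⟩ := exists_Ad_mem hB hX h𝔱 Y
  have h1 := (heta.1 k Y).symm.trans (heta.2 ⟨_, hk⟩)
  have h2 := hFt ⟨_, hk⟩
  refine (hF k Y).symm.trans (h2.trans ?_)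
  rw [← h1]

end AdInvariance

/-! ### Assembly of the pairing formula -/

section

variable {E : Type*} [NormedAddCommGroup E] [NormedSpace ℝ E] [FiniteDimensional ℝ E]
  [CompleteSpace E] {K : Type*} [TopologicalSpace K] [CompactSpace K]
  [ChartedSpace E K] [Group K] [LieGroup 𝓘(ℝ, E) ∞ K]
  {EG : Type*} [NormedAddCommGroup EG] [NormedSpace ℂ EG] [FiniteDimensional ℂ EG]
  {G : Type*} [TopologicalSpace G] [T2Space G] [ChartedSpace EG G] [Group G]
  [LieGroup 𝓘(ℂ, EG) ∞ G]

theorem wedge_conj_Omega_eq_eta {ι : K →* G} (hι : IsComplexification E EG ι)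
    {B : LinearMap.BilinForm ℝ (GroupLieAlgebra 𝓘(ℝ, E) K)} (hB : IsAdInvariantInner B)
    {n : ℕ} {X : Module.Basis (Fin n) ℝ (GroupLieAlgebra 𝓘(ℝ, E) K)}
    (hX : ∀ i j, B (X i) (X j) = if i = j then 1 else 0)
    {𝔱 : LieSubalgebra ℝ (GroupLieAlgebra 𝓘(ℝ, E) K)} (h𝔱 : 𝔱.IsCartanSubalgebra)
    {P : Finset (Module.Dual ℝ 𝔱)} (hP : IsPositiveSystem (realRoots 𝔱) P)
    {s s' : ℝ} (hs : 0 < s) (hs' : 0 < s') (x : K) (Y : E) :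
    wedge (conjForm (Omega EG ι X s (x, Y))) (Omega EG ι X s' (x, Y)) =
      (((((s + s') / 2) ^ n * eta 𝔱 P (((s + s') / 2) • Y : E) ^ 2 : ℝ) : ℂ) * bConst n) •
        liouville X (x, Y) := by
  have : CompleteSpace EG := FiniteDimensional.complete ℂ EG
  have h1 := wedge_conj_Omega (EG := EG) (B := (show LinearMap.BilinForm ℝ E from B)) hB.symm
    hB.invariant hι (show Module.Basis (Fin n) ℝ E from X) hX hs.ne' hs'.ne' x Y
  have h2 := bConst_smul_liouville (K := K) (show Module.Basis (Fin n) ℝ E from X) x Y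
    ((((s + s') / 2) ^ n * eta 𝔱 P (((s + s') / 2) • Y : E) ^ 2 : ℝ) : ℂ)
  refine h1.trans (Eq.trans ?_ h2.symm)
  rw [← adMatrix_smul, show (s + s') • Y = (2 : ℝ) • (((s + s') / 2) • Y) by
    rw [smul_smul]; congr 1; ring]
  refine congrArg (fun c : ℂ => (c * (2 * Complex.I) ^ n) • wedgeOneForms _) ?_
  refine (congrArg _ (det_expIntegral_adMatrix hB hX h𝔱 hP _)).trans ?_
  push_cast
  rfl

/-- `formNorm` is a choice, and a nonnegative coefficient `r` makes it legitimate with witness `√r`.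
-/
theorem formNorm_sq_eq {n : ℕ} {X : Module.Basis (Fin n) ℝ (GroupLieAlgebra 𝓘(ℝ, E) K)}
    {α : (p : K × E) → (TangentSpace (𝓘(ℝ, E).prod 𝓘(ℝ, E)) p) [⋀^Fin n]→ₗ[ℝ] ℂ} {p : K × E}
    {r : ℝ} (hr : 0 ≤ r)
    (h : wedge (conjForm (α p)) (α p) = ((r : ℂ) * bConst n) • liouville X p) :
    wedge (conjForm (α p)) (α p) = (((formNorm X α p ^ 2 : ℝ) : ℂ) * bConst n) • liouville X p := by
  have h1 := Classical.epsilon_spec (p := fun c : ℝ => 0 ≤ c ∧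
    wedge (conjForm (α p)) (α p) = ((c : ℂ) ^ 2 * bConst n) • liouville X p)
    ⟨Real.sqrt r, Real.sqrt_nonneg r, by rw [← Complex.ofReal_pow, Real.sq_sqrt hr, h]⟩
  rw [Complex.ofReal_pow]
  exact h1.2

end

end CotangentLieGroup

end

theorem proposition2p1
    {E : Type*} [NormedAddCommGroup E] [NormedSpace ℝ E] [FiniteDimensional ℝ E] [CompleteSpace E]
    {K : Type*} [TopologicalSpace K] [T2Space K] [CompactSpace K] [ConnectedSpace K]
    [ChartedSpace E K] [Group K] [LieGroup 𝓘(ℝ, E) ∞ K]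
    {EG : Type*} [NormedAddCommGroup EG] [NormedSpace ℂ EG] [FiniteDimensional ℂ EG]
    {G : Type*} [TopologicalSpace G] [T2Space G] [ChartedSpace EG G] [Group G]
    [LieGroup 𝓘(ℂ, EG) ∞ G]
    (ι : K →* G) (hι : IsComplexification E EG ι)
    (B : LinearMap.BilinForm ℝ (GroupLieAlgebra 𝓘(ℝ, E) K)) (hB : IsAdInvariantInner B)
    (n : ℕ) (X : Module.Basis (Fin n) ℝ (GroupLieAlgebra 𝓘(ℝ, E) K))
    (hX : ∀ i j, B (X i) (X j) = if i = j then 1 else 0)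
    (𝔱 : LieSubalgebra ℝ (GroupLieAlgebra 𝓘(ℝ, E) K)) (h𝔱 : 𝔱.IsCartanSubalgebra)
    (P : Finset (Module.Dual ℝ 𝔱)) (hP : IsPositiveSystem (realRoots 𝔱) P)
    (s s' : ℝ) (hs : 0 < s) (hs' : 0 < s') (x : K) (Y : E) :
    wedge (conjForm (Omega EG ι X s (x, Y))) (Omega EG ι X s' (x, Y)) =
        (((((s + s') / 2) ^ n * eta 𝔱 P (((s + s') / 2) • Y : E) ^ 2 : ℝ) : ℂ) * bConst n) •
          liouville X (x, Y) ∧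
      wedge (conjForm (Omega EG ι X s (x, Y))) (Omega EG ι X s' (x, Y)) =
        (((formNorm X (Omega EG ι X ((s + s') / 2)) (x, Y) ^ 2 : ℝ) : ℂ) * bConst n) •
          liouville X (x, Y) := by
  have h := wedge_conj_Omega_eq_eta hι hB hX h𝔱 hP hs hs' x Y
  have hτ : 0 < (s + s') / 2 := by positivity
  have h1 := wedge_conj_Omega_eq_eta hι hB hX h𝔱 hP hτ hτ x Y
  -- For equal parameters `τ, τ` the mean is again `τ`, so the same right-hand side computes
  -- `|Ω_τ|²`.
  rw [add_self_div_two] at h1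
  refine ⟨h, h.trans (h1.symm.trans (formNorm_sq_eq ?_ h1))⟩
  positivity
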